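/- **Model.** An external memory machine has an unbounded external memory, divided into blocks of $B$ consecutive words, and a main memory of $M$ words, $1\le B\le M/2$, together with a constant number of further words for program variables. A program is a fixed finite imperative text (assignments with arithmetic on words and indirect addressing, sequencing, conditionals, loops, access to the values of $B$ and $M$). Words written by the program are reduced modulo a word size $W$. An I/O is the transfer of one block between external and main memory; computation in main memory is free. Put $\mathrm{sort}(N)=\lceil N/B\rceil\cdot\max\{1,\log_{M/B}(N/B)\}$. **Input.** A graph $G$ on the vertices $0,\dots,n-1$ with $m$ edges and a spanning tree $T$ of $G$ are stored in external memory: the number $n$; the adjacency row representation of $G$, i.e. the array $P[0..n]$ and the array $E$ such that the neighbours of $v$ are stored, each once and in any order, at positions $P[v],\dots,P[v+1]-1$ of $E$; and the list of the edges of $T$, in any order and orientation. **Statement.** There are a program and constants $\kappa$, $C$ such that the following holds for all $B\ge 1$, $M\ge 2B$, for every connected graph $G$ with $n$ vertices and $m$ edges that contains a $C_3$, a $C_5$ or a $2K_2$ as an induced subgraph, every spanning tree $T$ of $G$, every such representation of the input, and every word size $W\ge(n+m+M)^\kappa$ (so words of $O(\log(n+m+M))$ bits suffice): the program terminates after at most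 $C\cdot\mathrm{sort}(n+m)$ I/Os, and external memory then starts with a number $k\in\{3,4,5\}$ followed by $k$ vertices of $G$ that induce in $G$, in this order, a cycle $C_3$ (if $k=3$), a cycle $C_5$ (if $k=5$), or a $2K_2$ whose two edges join the first with the second and the third with the fourth vertex (if $k=4$). In short: if a connected graph contains an induced $C_3$, $C_5$ or $2K_2$, then one such induced subgraph can be found in $O(\mathrm{sort}(n+m))$ I/Os, given a spanning tree. -/

import Mathlib

namespace ExtMem

/-! ### The external memory machine -/

/-- Parameters of an external memory machine.  Blocks consist of `B` words and main memory holds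
`M` data words.  In addition there are `extra` words of main memory for program variables; `extra`
is a constant that goes with the program.  Every word that a program computes and stores is a
natural number below `W`. -/
structure Machine where
  B : ℕ
  M : ℕ
  extra : ℕ
  W : ℕ

/-- The number of addressable words of main memory. -/
def Machine.capacity (μ : Machine) : ℕ := μ.M + μ.extra

/-- Contents of main memory and of external memory. -/
structure State where
  mem : ℕ → ℕ
  ext : ℕ → ℕ

/-- The word at a main memory address; there is nothing to be read beyond the capacity. -/
def State.get (μ : Machine) (s : State) (a : ℕ) : ℕ :=
  if a < μ.capacity then s.mem a else 0

/-- Arithmetic expressions over the words of main memory.  A program knows the block size and the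
memory size, and addresses main memory directly or indirectly through `load`. -/
inductive Expr where
  | const (k : ℕ)
  | blockSize
  | memSize
  | load (a : Expr)
  | add (e₁ e₂ : Expr)
  | sub (e₁ e₂ : Expr)
  | mul (e₁ e₂ : Expr)
  | div (e₁ e₂ : Expr)
  | mod (e₁ e₂ : Expr)
  | lt (e₁ e₂ : Expr)

/-- Value of an expression (truncated subtraction, rounded division, `lt` has value `0` or `1`). -/
def Expr.eval (μ : Machine) (s : State) : Expr → ℕ
  | .const k => k
  | .blockSize => μ.B
  | .memSize => μ.M
  | .load a => s.get μ (a.eval μ s)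
  | .add e₁ e₂ => e₁.eval μ s + e₂.eval μ s
  | .sub e₁ e₂ => e₁.eval μ s - e₂.eval μ s
  | .mul e₁ e₂ => e₁.eval μ s * e₂.eval μ s
  | .div e₁ e₂ => e₁.eval μ s / e₂.eval μ s
  | .mod e₁ e₂ => e₁.eval μ s % e₂.eval μ s
  | .lt e₁ e₂ => if e₁.eval μ s < e₂.eval μ s then 1 else 0

/-- Programs: a finite imperative program text.  `read dst blk` and `write src blk` are the only
instructions that access external memory; each of them transfers one block. -/
inductive Program where
  | skip
  | store (a e : Expr)
  | read (dst blk : Expr)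
  | write (src blk : Expr)
  | seq (p q : Program)
  | ite (c : Expr) (p q : Program)
  | while (c : Expr) (p : Program)

/-- Store the word `x`, reduced to word size, at main memory address `a`; nothing happens beyond
the capacity. -/
def State.put (μ : Machine) (s : State) (a x : ℕ) : State where
  mem := fun b => if b = a ∧ b < μ.capacity then x % μ.W else s.mem b
  ext := s.ext

/-- Copy block number `blk` of external memory, i.e. the cells `blk * B, …, blk * B + B - 1`, to
the main memory addresses `dst, …, dst + B - 1`. -/
def State.readBlock (μ : Machine) (s : State) (dst blk : ℕ) : State where
  mem := fun b =>
    if dst ≤ b ∧ b < dst + μ.B ∧ b < μ.capacity then s.ext (blk * μ.B + (b - dst)) else s.mem b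
  ext := s.ext

/-- Copy the main memory words `src, …, src + B - 1` to block number `blk` of external memory. -/
def State.writeBlock (μ : Machine) (s : State) (src blk : ℕ) : State where
  mem := s.mem
  ext := fun b =>
    if blk * μ.B ≤ b ∧ b < blk * μ.B + μ.B then s.get μ (src + (b - blk * μ.B)) else s.ext b

/-- `Exec μ p s s' k`: started in `s`, the program `p` terminates in `s'` after exactly `k` block
transfers.  Computation in main memory is free. -/
inductive Exec (μ : Machine) : Program → State → State → ℕ → Prop where
  | skip (s : State) : Exec μ .skip s s 0
  | store (a e : Expr) (s : State) :
      Exec μ (.store a e) s (s.put μ (a.eval μ s) (e.eval μ s)) 0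
  | read (dst blk : Expr) (s : State) :
      Exec μ (.read dst blk) s (s.readBlock μ (dst.eval μ s) (blk.eval μ s)) 1
  | write (src blk : Expr) (s : State) :
      Exec μ (.write src blk) s (s.writeBlock μ (src.eval μ s) (blk.eval μ s)) 1
  | seq {p q : Program} {s₁ s₂ s₃ : State} {k l : ℕ} :
      Exec μ p s₁ s₂ k → Exec μ q s₂ s₃ l → Exec μ (.seq p q) s₁ s₃ (k + l)
  | ite_true {c : Expr} {p q : Program} {s s' : State} {k : ℕ} :
      c.eval μ s ≠ 0 → Exec μ p s s' k → Exec μ (.ite c p q) s s' k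
  | ite_false {c : Expr} {p q : Program} {s s' : State} {k : ℕ} :
      c.eval μ s = 0 → Exec μ q s s' k → Exec μ (.ite c p q) s s' k
  | while_true {c : Expr} {p : Program} {s₁ s₂ s₃ : State} {k l : ℕ} :
      c.eval μ s₁ ≠ 0 → Exec μ p s₁ s₂ k → Exec μ (.while c p) s₂ s₃ l →
        Exec μ (.while c p) s₁ s₃ (k + l)
  | while_false {c : Expr} {p : Program} {s : State} :
      c.eval μ s = 0 → Exec μ (.while c p) s s 0

/-- `sort(N) = (N / B) * log_{M/B} (N / B)`, with the usual convention that the number of blocks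
is rounded up and that the logarithmic factor is at least `1`. -/
noncomputable def sortBound (B M N : ℕ) : ℝ :=
  (⌈(N : ℝ) / (B : ℝ)⌉₊ : ℝ) * max 1 (Real.logb ((M : ℝ) / (B : ℝ)) ((N : ℝ) / (B : ℝ)))

/-! ### Graphs in external memory -/

/-- `rows v` lists the neighbours of `v`, each of them once, in any order. -/
def IsNeighborLists {n : ℕ} (G : SimpleGraph (Fin n)) (rows : Fin n → List (Fin n)) : Prop :=
  ∀ v, (rows v).Nodup ∧ ∀ u, u ∈ rows v ↔ G.Adj v u

/-- `t` lists the edges of `T`, each of them once, in any order and orientation. -/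
def IsEdgeList {n : ℕ} (T : SimpleGraph (Fin n)) (t : List (Fin n × Fin n)) : Prop :=
  (t.map fun e => s(e.1, e.2)).Nodup ∧ ∀ u v, s(u, v) ∈ t.map (fun e => s(e.1, e.2)) ↔ T.Adj u v

/-- The array `P` of the adjacency row representation (with a final sentinel): the neighbours of
`v` are stored at the positions `P[v], …, P[v + 1] - 1` of the array `E`. -/
def rowStarts {n : ℕ} (rows : Fin n → List (Fin n)) : List ℕ :=
  List.ofFn fun i : Fin (n + 1) => ∑ j : Fin n, if (j : ℕ) < (i : ℕ) then (rows j).length else 0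

/-- The array `E` of the adjacency row representation: the concatenated neighbour lists. -/
def rowEntries {n : ℕ} (rows : Fin n → List (Fin n)) : List ℕ :=
  (List.ofFn rows).flatten.map fun u => (u : ℕ)

/-- The input: the number `n`, the arrays `P` and `E`, and the list of tree edges. -/
def inputWords {n : ℕ} (rows : Fin n → List (Fin n)) (t : List (Fin n × Fin n)) : List ℕ :=
  n :: (rowStarts rows ++ rowEntries rows ++ t.flatMap fun e => [(e.1 : ℕ), (e.2 : ℕ)])

/-- The input is stored from external address `0` on; everything else is `0`. -/
def initialState {n : ℕ} (rows : Fin n → List (Fin n)) (t : List (Fin n × Fin n)) : State where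
  mem := fun _ => 0
  ext := fun a => (inputWords rows t).getD a 0

/-- The graph `2K₂`, with edges `01` and `23`. -/
def twoK2 : SimpleGraph (Fin 4) := SimpleGraph.fromEdgeSet {s(0, 1), s(2, 3)}

/-- The external memory starts with `k` followed by `k` vertices of `G` which, in this order,
induce a copy of `H` in `G`. -/
def Reports {n k : ℕ} (H : SimpleGraph (Fin k)) (G : SimpleGraph (Fin n)) (s : State) : Prop :=
  s.ext 0 = k ∧ ∃ f : H ↪g G, ∀ i : Fin k, s.ext (i + 1) = (f i : ℕ)

end ExtMem

/-! Combinatorics. Order the neighbours of a vertex z by descending degree, ties by number. If their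
neighbourhoods do not decrease along this order, some neighbour b of z has a neighbour v that the
vertex b' just before b in the order lacks. Since deg b' ≥ deg b, counting yields a neighbour u of
b' that b lacks. Such a `Conflict` always contains a wanted subgraph: an edge bb', zv or zu closes
the triangle zbb', zbv or zb'u; without these edges, vu closes an induced pentagon z, b, v, u, b';
and without vu the edges bv and b'u form an induced 2K₂.

Conversely, let x have maximum degree, let the neighbourhoods of the neighbours of x be nested with
y as the first of them, and let the same hold at y with first vertex y'. Neighbours of neighbours of
x lie in N(y), because N(y) is largest. As x belongs to N(y), N(x) is contained in N(y'), and
maximality of deg x forces equality; hence neighbours of neighbours of y lie in N(x). By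
connectivity N(x) and N(y) cover the graph; they are disjoint and independent, so there is no odd
cycle, and nestedness inside each part excludes an induced 2K₂ (`chainParts`,
`ChainParts.not_contained`). So a graph with one of the three subgraphs has a conflict at x or at y,
and two checks suffice.

Checking with few transfers. Every orientation of an edge becomes one word of four digits in base K,
so that a check consists of a constant number of scans and sorts. Degrees enter through their
complements, which makes ascending words descend by degree. Sorting by rows, with z moved to the
front of each row, lets a scan number the neighbours of z. Sorting by the other endpoint v and this
rank then reduces nestedness to a local test: for every v the positive ranks in its group must be 1,
…, r. A gap gives b and v, and one more scan gives b' and u (`wp_rankPass`, `wp_gapPass`,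
`wp_exchangePass`). The edge words themselves come from the adjacency rows by one sort that
interleaves row descriptors with row entries (`wp_joinPass`).

Sorting. This is a k-way merge sort with k = max(2, M/(4B)). The buffer of kB words is sorted anew
after each block, since computation is free. A step writes the B least words and loads the next
block of the unfinished run whose last loaded word is least. This is justified by a count kept in
`MergeData.Inv`: if τ is at least the last loaded word of some unfinished run, then the number of
buffer words above τ is at most B times the number of runs whose last loaded word is above τ. Taking
τ as the least last word of an unfinished run, at least one run is not counted, so the B least words
are at most τ, while nothing unloaded is below τ.

Programs are verified in a calculus for total correctness with the number of transfers as a ghost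
component of configurations. With L = ⌈(n + 2 + 2m)/B⌉ the total is at most 8 + 22L + 15L(1 + log_k
L); `cost_le` compares it with the sorting bound and `params` shows that no word overflows. -/

namespace ExtMem

/-! ### Configurations and weakest preconditions -/

/-- A machine state split into program variables, data memory, external memory and an I/O
counter. -/
structure Conf where
  V : ℕ → ℕ
  D : ℕ → ℕ
  X : ℕ → ℕ
  t : ℕ

/-- Data memory occupies the addresses below `M + 4`; the program variables follow. -/
def Conf.st (M : ℕ) (a : Conf) : State where
  mem := fun b => if b < M + 4 then a.D b else a.V (b - (M + 4))
  ext := a.X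

/-- Total correctness: `p` terminates from `a` in a configuration that satisfies `Q`. -/
def wp (μ : Machine) (p : Program) (Q : Conf → Prop) (a : Conf) : Prop :=
  ∃ (a' : Conf) (k : ℕ), Exec μ p (a.st μ.M) (a'.st μ.M) k ∧ a'.t = a.t + k ∧ Q a'

/-- The number of additional memory words used by the programs below. -/
abbrev extraWords : ℕ := 64

/-- Program variable number `i`. -/
def var (i : ℕ) : Expr := .load (.add .memSize (.const (4 + i)))

/-- Assignment to a program variable. -/
def assign (i : ℕ) (e : Expr) : Program := .store (.add .memSize (.const (4 + i))) e

/-- Equality test. -/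
def eqE (a b : Expr) : Expr :=
  .sub (.const 1) (.add (.lt a b) (.lt b a))

/-- A counting loop. -/
def forLoop (i : ℕ) (e : Expr) (p : Program) : Program :=
  .seq (assign i (.const 0))
    (.while (.lt (var i) e) (.seq p (assign i (.add (var i) (.const 1)))))

/-! ### Proof rules for the program constructs -/

section
variable {μ : Machine} {Q R : Conf → Prop} {a : Conf} {p q : Program}

lemma eval_const (k : ℕ) (s : State) : (Expr.const k).eval μ s = k := rfl

lemma eval_blockSize (s : State) : Expr.blockSize.eval μ s = μ.B := rfl

lemma eval_memSize (s : State) : Expr.memSize.eval μ s = μ.M := rfl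

lemma eval_add (e f : Expr) (s : State) : (Expr.add e f).eval μ s = e.eval μ s + f.eval μ s := rfl

lemma eval_sub (e f : Expr) (s : State) : (Expr.sub e f).eval μ s = e.eval μ s - f.eval μ s := rfl

lemma eval_mul (e f : Expr) (s : State) : (Expr.mul e f).eval μ s = e.eval μ s * f.eval μ s := rfl

lemma eval_div (e f : Expr) (s : State) : (Expr.div e f).eval μ s = e.eval μ s / f.eval μ s := rfl

lemma eval_mod (e f : Expr) (s : State) : (Expr.mod e f).eval μ s = e.eval μ s % f.eval μ s := rfl

lemma eval_lt (e f : Expr) (s : State) :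
    (Expr.lt e f).eval μ s = if e.eval μ s < f.eval μ s then 1 else 0 := rfl

lemma eval_eqE (x y : Expr) (s : State) :
    (eqE x y).eval μ s = if x.eval μ s = y.eval μ s then 1 else 0 := by
  simp only [eqE, Expr.eval]
  split_ifs <;> omega

lemma wp_mono (h : wp μ p Q a) (hQ : ∀ a, Q a → R a) : wp μ p R a := by
  obtain ⟨a', k, h1, h2, h3⟩ := h
  exact ⟨a', k, h1, h2, hQ _ h3⟩

lemma wp_skip (h : Q a) : wp μ .skip Q a := ⟨a, 0, .skip _, rfl, h⟩

lemma wp_seq (h : wp μ p (wp μ q Q) a) : wp μ (.seq p q) Q a := by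
  obtain ⟨a', k, h1, h2, a'', l, h3, h4, h5⟩ := h
  exact ⟨a'', k + l, .seq h1 h3, by omega, h5⟩

lemma wp_ite {c : Expr} (h1 : c.eval μ (a.st μ.M) ≠ 0 → wp μ p Q a)
    (h2 : c.eval μ (a.st μ.M) = 0 → wp μ q Q a) : wp μ (.ite c p q) Q a := by
  by_cases h : c.eval μ (a.st μ.M) = 0
  · obtain ⟨a', k, h3, h4, h5⟩ := h2 h
    exact ⟨a', k, .ite_false h h3, h4, h5⟩
  · obtain ⟨a', k, h3, h4, h5⟩ := h1 h
    exact ⟨a', k, .ite_true h h3, h4, h5⟩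

lemma wp_ite_lt {e f : Expr} {x y : ℕ} (he : e.eval μ (a.st μ.M) = x)
    (hf : f.eval μ (a.st μ.M) = y) (h1 : x < y → wp μ p Q a) (h2 : y ≤ x → wp μ q Q a) :
    wp μ (.ite (.lt e f) p q) Q a := by
  refine wp_ite (fun h => h1 ?_) (fun h => h2 ?_)
  · by_contra hc
    simp [eval_lt, he, hf, hc] at h
  · by_contra hc
    simp [eval_lt, he, hf, not_le.1 hc] at h

lemma wp_ite_eq {e f : Expr} {x y : ℕ} (he : e.eval μ (a.st μ.M) = x)
    (hf : f.eval μ (a.st μ.M) = y) (h1 : x = y → wp μ p Q a) (h2 : x ≠ y → wp μ q Q a) :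
    wp μ (.ite (eqE e f) p q) Q a := by
  refine wp_ite (fun h => h1 ?_) (fun h => h2 ?_)
  · by_contra hc
    simp [eval_eqE, he, hf, hc] at h
  · intro hc
    simp [eval_eqE, he, hf, hc] at h

/-- The measure `f` only has to guarantee termination. The number of transfers is a component of the
configuration, so cost bounds are part of the invariant `I`. -/
lemma wp_while {c : Expr} (I : Conf → Prop) (f : Conf → ℕ) (h0 : I a)
    (hs : ∀ b, I b → c.eval μ (b.st μ.M) ≠ 0 → wp μ p (fun b' => I b' ∧ f b' < f b) b)
    (hQ : ∀ b, I b → c.eval μ (b.st μ.M) = 0 → Q b) : wp μ (.while c p) Q a := by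
  induction hn : f a using Nat.strong_induction_on generalizing a with
  | _ n ih =>
    by_cases h : c.eval μ (a.st μ.M) = 0
    · exact ⟨a, 0, .while_false h, rfl, hQ a h0 h⟩
    · obtain ⟨b, k, h1, h2, h3, h4⟩ := hs a h0 h
      obtain ⟨b', l, h5, h6, h7⟩ := ih (f b) (hn ▸ h4) h3 rfl
      exact ⟨b', k + l, .while_true h h1 h5, by omega, h7⟩

variable [hμ : Fact (μ.extra = extraWords)]

lemma capacity_eq : μ.capacity = μ.M + 64 := by rw [Machine.capacity, hμ.out]

lemma get_st {x : ℕ} (a : Conf) : (a.st μ.M).get μ x =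
    if x < μ.M + 4 then a.D x else if x < μ.M + 64 then a.V (x - (μ.M + 4)) else 0 := by
  unfold State.get
  rw [capacity_eq]
  simp only [Conf.st]
  split_ifs <;> first | rfl | omega

lemma eval_var {i : ℕ} (hi : i < 60) (a : Conf) : (var i).eval μ (a.st μ.M) = a.V i := by
  simp only [var, Expr.eval]
  rw [get_st, if_neg (by omega), if_pos (by omega)]
  congr 1; omega

lemma eval_load {e : Expr} (a : Conf) (he : e.eval μ (a.st μ.M) < μ.M + 4) :
    (Expr.load e).eval μ (a.st μ.M) = a.D (e.eval μ (a.st μ.M)) := by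
  simp only [Expr.eval]
  rw [get_st, if_pos he]

/-- The bound by `μ.W` makes the reduction modulo the word size void. It is the only way in which
the word size enters, so every computed value has to be bounded once. -/
lemma wp_assign {i : ℕ} {e : Expr} (hi : i < 60) {x : ℕ} (hx : e.eval μ (a.st μ.M) = x)
    (hW : x < μ.W) (h : Q { a with V := Function.update a.V i x }) :
    wp μ (assign i e) Q a := by
  refine ⟨{ a with V := Function.update a.V i x }, 0, ?_, rfl, h⟩
  have h1 := Exec.store (μ := μ) (.add .memSize (.const (4 + i))) e (a.st μ.M)
  have h2 : Expr.eval μ (a.st μ.M) (.add .memSize (.const (4 + i))) = μ.M + (4 + i) := rfl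
  rw [hx, h2] at h1
  unfold assign
  convert h1 using 1
  simp only [Conf.st, State.put, capacity_eq, State.mk.injEq, and_true]
  rw [Nat.mod_eq_of_lt hW]
  funext b
  by_cases hb : b = μ.M + (4 + i)
  · subst hb
    have : μ.M + (4 + i) - (μ.M + 4) = i := by omega
    rw [if_neg (by omega), if_pos ⟨rfl, by omega⟩, this, Function.update_self]
  · rw [if_neg (c := b = μ.M + (4 + i) ∧ _) (fun h => hb h.1)]
    split_ifs with h2
    · rfl
    · rw [Function.update_of_ne (by omega)]

lemma wp_store {e f : Expr} {x y : ℕ} (hy : e.eval μ (a.st μ.M) = y)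
    (hx : f.eval μ (a.st μ.M) = x) (hyM : y < μ.M + 4)
    (hW : x < μ.W) (h : Q { a with D := Function.update a.D y x }) :
    wp μ (.store e f) Q a := by
  refine ⟨{ a with D := Function.update a.D y x }, 0, ?_, rfl, h⟩
  have h1 := Exec.store (μ := μ) e f (a.st μ.M)
  rw [hx, hy] at h1
  convert h1 using 1
  simp only [Conf.st, State.put, capacity_eq, State.mk.injEq, and_true]
  rw [Nat.mod_eq_of_lt hW]
  funext b
  by_cases hb : b = y
  · subst hb
    rw [if_pos (by omega), if_pos ⟨rfl, by omega⟩, Function.update_self]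
  · rw [if_neg (c := b = y ∧ _) (fun h => hb h.1), Function.update_of_ne hb]

lemma wp_read {e f : Expr} {x y : ℕ} (hy : e.eval μ (a.st μ.M) = y)
    (hx : f.eval μ (a.st μ.M) = x) (hyM : y + μ.B ≤ μ.M + 4)
    (h : Q { a with
      D := fun b => if y ≤ b ∧ b < y + μ.B then a.X (x * μ.B + (b - y)) else a.D b
      t := a.t + 1 }) :
    wp μ (.read e f) Q a := by
  refine ⟨_, 1, ?_, ?_, h⟩
  swap
  · rfl
  have h1 := Exec.read (μ := μ) e f (a.st μ.M)
  rw [hx, hy] at h1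
  convert h1 using 1
  simp only [Conf.st, State.readBlock, capacity_eq, State.mk.injEq, and_true]
  funext b
  by_cases hb : y ≤ b ∧ b < y + μ.B
  · rw [if_pos (by omega), if_pos hb, if_pos (by omega)]
  · rw [if_neg hb, if_neg (c := y ≤ b ∧ _ ∧ _) (by omega)]

lemma wp_write {e f : Expr} {x y : ℕ} (hy : e.eval μ (a.st μ.M) = y)
    (hx : f.eval μ (a.st μ.M) = x) (hyM : y + μ.B ≤ μ.M + 4)
    (h : Q { a with
      X := fun b => if x * μ.B ≤ b ∧ b < x * μ.B + μ.B then a.D (y + (b - x * μ.B)) else a.X b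
      t := a.t + 1 }) :
    wp μ (.write e f) Q a := by
  refine ⟨_, 1, ?_, ?_, h⟩
  swap
  · rfl
  have h1 := Exec.write (μ := μ) e f (a.st μ.M)
  rw [hx, hy] at h1
  convert h1 using 1
  simp only [State.writeBlock, get_st]
  simp only [Conf.st, State.mk.injEq, true_and]
  funext b
  by_cases hb : x * μ.B ≤ b ∧ b < x * μ.B + μ.B
  · rw [if_pos hb, if_pos hb, if_pos (by omega)]
  · rw [if_neg hb, if_neg hb]

/-- The invariant is indexed by the number of completed rounds. The bound `e` is evaluated anew in
every round, which is why the invariant must determine its value as well as that of the counter. -/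
lemma wp_for {i : ℕ} {e : Expr} (N : ℕ) (I : ℕ → Conf → Prop) (hi : i < 60) (hN : N < μ.W)
    (h0 : I 0 { a with V := Function.update a.V i 0 })
    (hv : ∀ j b, j ≤ N → I j b → b.V i = j ∧ e.eval μ (b.st μ.M) = N)
    (hs : ∀ j b, j < N → I j b → wp μ p
      (fun b' => b'.V i = j ∧ I (j + 1) { b' with V := Function.update b'.V i (j + 1) }) b)
    (hQ : ∀ b, I N b → Q b) : wp μ (forLoop i e p) Q a := by
  refine wp_seq (wp_assign hi rfl (by simp only [Expr.eval]; omega) ?_)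
  refine wp_while (fun b => ∃ j, j ≤ N ∧ I j b) (fun b => N - b.V i) ⟨0, by omega, h0⟩ ?_ ?_
  · rintro b ⟨j, hj, hb⟩ hc
    obtain ⟨h1, h2⟩ := hv j b hj hb
    have hlt : j < N := by
      by_contra hcon
      apply hc
      simp only [Expr.eval]
      rw [if_neg]
      have := eval_var (μ := μ) hi b
      rw [this]
      omega
    refine wp_seq (wp_mono (hs j b hlt hb) ?_)
    rintro b' ⟨h3, h4⟩
    refine wp_assign hi (x := j + 1) ?_ (by omega) ⟨⟨j + 1, hlt, h4⟩, ?_⟩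
    · simp only [Expr.eval]; rw [eval_var hi, h3]
    · simp only [Function.update_self]; omega
  · rintro b ⟨j, hj, hb⟩ hc
    obtain ⟨h1, h2⟩ := hv j b hj hb
    have hge : j = N := by
      by_contra hcon
      simp only [Expr.eval] at hc
      have := eval_var (μ := μ) hi b
      rw [this, if_pos (by omega)] at hc
      omega
    subst hge
    exact hQ b hb

end
end ExtMem
namespace ExtMem

/-! ### Sorting in main memory -/

/-- The multiset of the values of `f` on `[a, b)`. -/
def ms (f : ℕ → ℕ) (a b : ℕ) : Multiset ℕ := (Multiset.Ico a b).map f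

lemma ms_congr {f g : ℕ → ℕ} {a b : ℕ} (h : ∀ x, a ≤ x → x < b → f x = g x) :
    ms f a b = ms g a b :=
  Multiset.map_congr rfl fun x hx => by
    rw [Multiset.mem_Ico] at hx
    exact h x hx.1 hx.2

lemma mem_ms {f : ℕ → ℕ} {a b y : ℕ} : y ∈ ms f a b ↔ ∃ x, a ≤ x ∧ x < b ∧ f x = y := by
  simp only [ms, Multiset.mem_map, Multiset.mem_Ico, and_assoc]

lemma ms_add {f : ℕ → ℕ} {a b c : ℕ} (h1 : a ≤ b) (h2 : b ≤ c) :
    ms f a c = ms f a b + ms f b c := by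
  rw [ms, ms, ms, ← Multiset.Ico_add_Ico_eq_Ico h1 h2, Multiset.map_add]

lemma ms_self (f : ℕ → ℕ) (a : ℕ) : ms f a a = 0 := by simp [ms]

lemma card_ms (f : ℕ → ℕ) (a b : ℕ) : (ms f a b).card = b - a := by
  rw [ms, Multiset.card_map]; exact Nat.card_Ico a b

lemma ms_shift (f : ℕ → ℕ) (a b d : ℕ) : ms f (d + a) (d + b) = ms (fun x => f (d + x)) a b := by
  rw [ms, ms, ← Multiset.map_add_left_Ico, Multiset.map_map]; rfl

/-- A transposition of two positions in the range permutes the range; this gives that exchanges in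
memory preserve the multiset of words. -/
lemma ms_comp_swap (f : ℕ → ℕ) {i j c : ℕ} (hi : i < c) (hj : j < c) :
    ms (f ∘ Equiv.swap i j) 0 c = ms f 0 c := by
  have h : (Finset.Ico 0 c).map (Equiv.swap i j).toEmbedding = Finset.Ico 0 c := by
    apply Finset.eq_of_subset_of_card_le
    · intro x hx
      simp only [Finset.mem_map, Finset.mem_Ico, Equiv.coe_toEmbedding] at hx ⊢
      obtain ⟨y, hy, rfl⟩ := hx
      rw [Equiv.swap_apply_def]
      split_ifs <;> omega
    · simp
  have h2 := congrArg Finset.val h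
  rw [Finset.map_val] at h2
  change Multiset.map _ (Multiset.Ico 0 c) = Multiset.Ico 0 c at h2
  conv_rhs => rw [ms, ← h2]
  rw [Multiset.map_map]
  rfl

/-- The word of data memory at an address. -/
def cell (e : Expr) : Expr := .load e

/-- Sort the words at the addresses below `c`. -/
def memSort (c : Expr) : Program :=
  forLoop 0 c (forLoop 1 (var 0)
    (.ite (.lt (cell (var 0)) (cell (var 1)))
      (.seq (assign 2 (cell (var 0))) (.seq (.store (var 0) (cell (var 1)))
        (.store (var 1) (var 2)))) .skip))

section
variable {μ : Machine} [hμ : Fact (μ.extra = extraWords)] {Q : Conf → Prop} {a : Conf}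

lemma eval_cell {e : Expr} {x : ℕ} (a : Conf) (hx : e.eval μ (a.st μ.M) = x) (he : x < μ.M + 4) :
    (cell e).eval μ (a.st μ.M) = a.D x := by
  subst hx
  exact eval_load a he

lemma update_swap (f : ℕ → ℕ) (i j : ℕ) :
    Function.update (Function.update f i (f j)) j (f i) = f ∘ Equiv.swap i j := by
  funext x
  simp only [Function.update_apply, Function.comp, Equiv.swap_apply_def]
  split_ifs <;> simp_all

/-- In round i the word at position i is compared with the positions j < i in turn and exchanged
whenever it is smaller. The prefix stays sorted, and the word at position i dominates the first j
positions, so that after the inner loop one more position is sorted. The quadratic time is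
irrelevant because no transfer takes place. -/
lemma wp_memSort {c : Expr} {N : ℕ} (hN : N ≤ μ.M + 4) (hNW : N < μ.W)
    (hc : ∀ b : Conf, (∀ x, 3 ≤ x → b.V x = a.V x) → c.eval μ (b.st μ.M) = N)
    (hD : ∀ x < N, a.D x < μ.W)
    (hQ : ∀ b : Conf, (∀ x, 3 ≤ x → b.V x = a.V x) → b.X = a.X → b.t = a.t →
      (∀ x, N ≤ x → b.D x = a.D x) → (∀ x y, x ≤ y → y < N → b.D x ≤ b.D y) →
      ms b.D 0 N = ms a.D 0 N → Q b) :
    wp μ (memSort c) Q a := by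
  let G : Conf → Prop := fun b => (∀ x, 3 ≤ x → b.V x = a.V x) ∧ b.X = a.X ∧ b.t = a.t ∧
      (∀ x, N ≤ x → b.D x = a.D x) ∧ ms b.D 0 N = ms a.D 0 N ∧ (∀ x < N, b.D x < μ.W)
  have Gupd : ∀ b i y, i < 3 → G b → G { b with V := Function.update b.V i y } := by
    rintro b i y hi ⟨h1, h2⟩
    refine ⟨fun x hx => ?_, h2⟩
    simp only
    rw [Function.update_of_ne (by omega), h1 x hx]
  refine wp_for N (fun j b => G b ∧ b.V 0 = j ∧ ∀ x y, x ≤ y → y < j → b.D x ≤ b.D y)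
    (by omega) hNW ?_ ?_ ?_ ?_
  · refine ⟨Gupd _ _ _ (by omega) ⟨fun _ _ => rfl, rfl, rfl, fun _ _ => rfl, rfl, hD⟩, ?_, ?_⟩
    · simp
    · intros; omega
  · rintro j b hj ⟨hG, h0, hs⟩
    exact ⟨h0, hc b hG.1⟩
  · rintro i b hi ⟨hG, h0, hs⟩
    refine wp_for i (fun j b => G b ∧ b.V 0 = i ∧ b.V 1 = j ∧
      (∀ x y, x ≤ y → y < i → b.D x ≤ b.D y) ∧ ∀ x < j, b.D x ≤ b.D i)
      (by omega) (by omega) ?_ ?_ ?_ ?_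
    · refine ⟨Gupd _ _ _ (by omega) hG, ?_, ?_, hs, by intros; omega⟩
      · simpa using h0
      · simp
    · rintro j b hj ⟨hG, h0, h1, hs⟩
      exact ⟨h1, by rw [eval_var (by omega), h0]⟩
    · rintro j b hj ⟨hG, h0, h1, hs, hlt⟩
      have e0 : (cell (var 0)).eval μ (b.st μ.M) = b.D i :=
        eval_cell b (by rw [eval_var (by omega), h0]) (by omega)
      have e1 : (cell (var 1)).eval μ (b.st μ.M) = b.D j :=
        eval_cell b (by rw [eval_var (by omega), h1]) (by omega)
      refine wp_ite ?_ ?_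
      · intro hcond
        simp only [Expr.eval, e0, e1] at hcond
        have hlt' : b.D i < b.D j := by by_contra h; simp [h] at hcond
        refine wp_seq (wp_assign (by omega) e0 (hG.2.2.2.2.2 i hi) ?_)
        refine wp_seq (wp_store (y := i) (x := b.D j) ?_ ?_ (by omega)
          (hG.2.2.2.2.2 j (by omega)) ?_)
        · rw [eval_var (by omega)]; simpa using h0
        · exact eval_cell _ (by rw [eval_var (by omega)]; simpa using h1) (by omega)
        refine wp_store (y := j) (x := b.D i) ?_ ?_ (by omega) (hG.2.2.2.2.2 i hi) ?_
        · rw [eval_var (by omega)]; simpa using h1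
        · rw [eval_var (by omega)]; simp
        simp only
        rw [update_swap]
        have hsw : ∀ x, (b.D ∘ Equiv.swap i j) x = if x = i then b.D j else if x = j then b.D i
            else b.D x := by
          intro x
          simp only [Function.comp, Equiv.swap_apply_def]
          split_ifs <;> rfl
        obtain ⟨g1, g2, g3, g4, g5, g6⟩ := hG
        refine ⟨by simpa using h1, Gupd _ 1 (j + 1) (by omega)
          (Gupd { b with D := b.D ∘ Equiv.swap i j } 2 (b.D i) (by omega)
          ⟨g1, g2, g3, ?_, ?_, ?_⟩), ?_, ?_, ?_, ?_⟩
        · intro x hx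
          simp only
          rw [hsw, if_neg (by omega), if_neg (by omega), g4 x hx]
        · rw [ms_comp_swap _ hi (by omega), g5]
        · intro x hx
          simp only
          rw [hsw]
          split_ifs
          · exact g6 _ (by omega)
          · exact g6 _ (by omega)
          · exact g6 _ hx
        · simpa using h0
        · simp
        · intro x y hxy hy
          simp only [hsw, if_neg (show x ≠ i by omega), if_neg (show y ≠ i by omega)]
          split_ifs with h2 h3 h3
          · exact le_rfl
          · exact hlt'.le.trans (h2 ▸ hs x y hxy hy)
          · exact hlt x (by omega)
          · exact hs x y hxy hy
        · intro x hx
          simp only [hsw]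
          rw [if_neg (by omega), if_pos trivial]
          split_ifs with h2
          · exact hlt'.le
          · exact hs x j (by omega) hj
      · intro hcond
        simp only [Expr.eval, e0, e1] at hcond
        have hge : b.D j ≤ b.D i := by by_contra h; simp [not_le.1 h] at hcond
        refine wp_skip ⟨h1, Gupd _ _ _ (by omega) hG, by simpa using h0, by simp, hs, ?_⟩
        intro x hx
        rcases Nat.lt_succ_iff_lt_or_eq.1 hx with h | rfl
        · exact hlt x h
        · exact hge
    · rintro b ⟨hG, h0, h1, hs, hlt⟩
      refine ⟨h0, Gupd _ _ _ (by omega) hG, by simp, ?_⟩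
      intro x y hxy hy
      rcases Nat.lt_succ_iff_lt_or_eq.1 hy with h | rfl
      · exact hs x y hxy h
      · rcases hxy.lt_or_eq with h | rfl
        · exact hlt x h
        · exact le_rfl
  · rintro b ⟨⟨g1, g2, g3, g4, g5, g6⟩, h0, hs⟩
    exact hQ b g1 g2 g3 g4 hs g5

end
end ExtMem
namespace ExtMem

/-! ### The merge invariant -/

/-- The parameters of a `k`-way merge: block size, number of ways, a value above all words, the
source cells, the first block, the length of a run and the end of the array. -/
structure MergeData where
  B : ℕ
  k : ℕ
  inf : ℕ
  S : ℕ → ℕ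
  s : ℕ
  ell : ℕ
  L : ℕ

namespace MergeData

variable (m : MergeData)

/-- The end of run number `i`. -/
def hi (i : ℕ) : ℕ := min (m.s + (i + 1) * m.ell) m.L

/-- The end of the group of runs. -/
def e : ℕ := min (m.s + m.k * m.ell) m.L

/-- Every run is sorted. -/
def RunsSorted : Prop :=
  m.ell = 1 ∨ ∀ i < m.k, ∀ c c', (m.s + i * m.ell) * m.B ≤ c → c ≤ c' → c' < m.hi i * m.B →
    m.S c ≤ m.S c'

/-- The standing assumptions of a merge. -/
structure Valid : Prop where
  B_pos : 1 ≤ m.B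
  k_pos : 1 ≤ m.k
  ell_pos : 1 ≤ m.ell
  s_lt : m.s < m.L
  lt_inf : ∀ c < m.L * m.B, m.S c < m.inf
  runs : m.RunsSorted

/-- The cells that have not been loaded yet. -/
def rest (ptr : ℕ → ℕ) : Multiset ℕ :=
  ∑ i ∈ Finset.range m.k, ms m.S (ptr i * m.B) (m.hi i * m.B)

/-- The specification of pointers and keys. -/
def KeysOk (ptr key : ℕ → ℕ) : Prop :=
  ∀ i < m.k, m.s + i * m.ell < ptr i ∧
    (ptr i < m.hi i → key i = m.S (ptr i * m.B - 1)) ∧ (m.hi i ≤ ptr i → key i = m.inf)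

/-- The invariant of a merge before block `o` of the output is written. -/
structure Inv (buf ptr key out : ℕ → ℕ) (o : ℕ) : Prop where
  sorted : ∀ x y, x ≤ y → y < m.k * m.B → buf x ≤ buf y
  mult : ∃ z, ms out (m.s * m.B) (o * m.B) + ms buf 0 (m.k * m.B) + m.rest ptr =
    ms m.S (m.s * m.B) (m.e * m.B) + Multiset.replicate z m.inf
  out_sorted : ∀ x y, m.s * m.B ≤ x → x ≤ y → y < o * m.B → out x ≤ out y
  out_buf : ∀ x y, m.s * m.B ≤ x → x < o * m.B → y < m.k * m.B → out x ≤ buf y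
  out_rest : ∀ x i c, m.s * m.B ≤ x → x < o * m.B → i < m.k → ptr i * m.B ≤ c →
    c < m.hi i * m.B → out x ≤ m.S c
  keys : m.KeysOk ptr key
  cnt : ∃ last : ℕ → ℕ, (∀ i < m.k, ptr i < m.hi i → last i = key i) ∧
    ∀ τ, (∃ j < m.k, ptr j < m.hi j ∧ key j ≤ τ) →
      (ms buf 0 (m.k * m.B)).countP (τ < ·) ≤
        m.B * ((Finset.range m.k).filter (fun i => τ < last i)).card

variable {m}

lemma hi_le (i : ℕ) : m.hi i ≤ m.L := min_le_right _ _

/-- In the first pass the runs are single, internally unsorted blocks. Then a run has nothing left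
once its first block is loaded, so the assumption `hlt` already excludes this case, and otherwise
the runs are sorted. -/
lemma runs_sorted (hm : m.Valid) {ptr key : ℕ → ℕ} (hk : m.KeysOk ptr key) {i : ℕ} (hi : i < m.k)
    (hlt : ptr i < m.hi i) {c c' : ℕ} (h1 : ptr i * m.B - 1 ≤ c) (h2 : c ≤ c')
    (h3 : c' < m.hi i * m.B) : m.S c ≤ m.S c' := by
  have h4 := (hk i hi).1
  have hB := hm.B_pos
  rcases hm.runs with h | h
  · have : m.hi i ≤ m.s + (i + 1) * m.ell := min_le_left _ _
    rw [h] at this h4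
    omega
  · refine h i hi c c' ?_ h2 h3
    have h5 : (m.s + i * m.ell + 1) * m.B ≤ ptr i * m.B := Nat.mul_le_mul_right _ h4
    rw [add_mul, one_mul] at h5
    omega

/-- Exhausted runs carry the key `m.inf`, which exceeds every word. Therefore the search for the
least key finds an unfinished run whenever there is one. -/
lemma key_lt (hm : m.Valid) {ptr key : ℕ → ℕ} (hk : m.KeysOk ptr key) {i : ℕ} (hi : i < m.k) :
    key i < m.inf ↔ ptr i < m.hi i := by
  obtain ⟨h1, h2, h3⟩ := hk i hi
  constructor
  · intro h
    by_contra hc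
    rw [h3 (not_lt.1 hc)] at h
    exact lt_irrefl _ h
  · intro h
    rw [h2 h]
    apply hm.lt_inf
    have h4 : (ptr i + 1) * m.B ≤ m.L * m.B := Nat.mul_le_mul_right _ (h.trans_le (hi_le i))
    rw [add_mul, one_mul] at h4
    have := hm.B_pos
    omega

lemma countP_ms_le (f : ℕ → ℕ) (a b : ℕ) (P : ℕ → Prop) [DecidablePred P] :
    (ms f a b).countP P ≤ b - a := by
  rw [← card_ms f a b]
  exact Multiset.countP_le_card _ _

/-- The first block of the buffer is below everything that has not been loaded yet. -/
lemma buf_le_key (hm : m.Valid) {buf ptr key out : ℕ → ℕ} {o b : ℕ}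
    (h : m.Inv buf ptr key out o) (hb : b < m.k) (hlt : ptr b < m.hi b) {x : ℕ}
    (hx : x < m.B) : buf x ≤ key b := by
  by_contra hc
  rw [not_le] at hc
  obtain ⟨last, h1, h2⟩ := h.cnt
  have h3 := h2 (key b) ⟨b, hb, hlt, le_rfl⟩
  have hk : m.B ≤ m.k * m.B := by
    have := Nat.mul_le_mul_right m.B hm.k_pos
    rwa [one_mul] at this
  -- The buffer is sorted, so if position x exceeds the key then so do all later positions.
  have h4 : m.k * m.B - x ≤ (ms buf 0 (m.k * m.B)).countP (key b < ·) := by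
    rw [ms_add (Nat.zero_le x) (by omega), Multiset.countP_add]
    have h5 : (ms buf x (m.k * m.B)).countP (key b < ·) = (ms buf x (m.k * m.B)).card := by
      rw [Multiset.countP_eq_card]
      intro y hy
      obtain ⟨z, hz1, hz2, rfl⟩ := mem_ms.1 hy
      exact hc.trans_le (h.sorted x z hz1 hz2)
    rw [h5, card_ms]
    omega
  -- Run b itself is not above its own key. This leaves at most (k - 1)B words above the key,
  -- contradicting x < B.
  have h6 : ((Finset.range m.k).filter (fun i => key b < last i)).card ≤ m.k - 1 := by
    have h7 : ((Finset.range m.k).filter (fun i => key b < last i)) ⊆ (Finset.range m.k).erase b := by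
      intro i hi
      rw [Finset.mem_filter] at hi
      rw [Finset.mem_erase]
      refine ⟨?_, hi.1⟩
      rintro rfl
      rw [h1 i hb hlt] at hi
      exact lt_irrefl _ hi.2
    refine (Finset.card_le_card h7).trans ?_
    rw [Finset.card_erase_of_mem (Finset.mem_range.2 hb), Finset.card_range]
  have h8 := h4.trans (h3.trans (Nat.mul_le_mul_left m.B h6))
  rw [Nat.mul_sub, mul_one, mul_comm m.B m.k] at h8
  omega

lemma out_step {out out' buf : ℕ → ℕ} {s o B : ℕ} (hso : s ≤ o)
    (ho1 : ∀ x < o * B, out' x = out x) (ho2 : ∀ x < B, out' (o * B + x) = buf x) :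
    ms out' (s * B) ((o + 1) * B) = ms out (s * B) (o * B) + ms buf 0 B := by
  rw [ms_add (b := o * B) (Nat.mul_le_mul_right _ hso) (Nat.mul_le_mul_right _ (by omega))]
  congr 1
  · exact ms_congr fun x _ hx => ho1 x hx
  · have : (o + 1) * B = o * B + B := by ring
    rw [this]
    have h := ms_shift out' 0 B (o * B)
    rw [add_zero] at h
    rw [h]
    exact ms_congr fun x _ hx => ho2 x hx

lemma out_cases {out out' buf : ℕ → ℕ} {o B : ℕ}
    (ho1 : ∀ x < o * B, out' x = out x) (ho2 : ∀ x < B, out' (o * B + x) = buf x) {x : ℕ}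
    (hx : x < (o + 1) * B) :
    (x < o * B ∧ out' x = out x) ∨ (∃ y < B, x = o * B + y ∧ out' x = buf y) := by
  by_cases h : x < o * B
  · exact .inl ⟨h, ho1 x h⟩
  · rw [add_mul, one_mul] at hx
    obtain ⟨y, rfl⟩ := Nat.exists_eq_add_of_le (not_lt.1 h)
    exact .inr ⟨y, by omega, rfl, ho2 y (by omega)⟩

lemma out_sorted_step {out out' buf : ℕ → ℕ} {s o B N : ℕ} (hBN : B ≤ N)
    (ho1 : ∀ x < o * B, out' x = out x) (ho2 : ∀ x < B, out' (o * B + x) = buf x)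
    (hs : ∀ x y, x ≤ y → y < N → buf x ≤ buf y)
    (h1 : ∀ x y, s * B ≤ x → x ≤ y → y < o * B → out x ≤ out y)
    (h2 : ∀ x y, s * B ≤ x → x < o * B → y < N → out x ≤ buf y) :
    ∀ x y, s * B ≤ x → x ≤ y → y < (o + 1) * B → out' x ≤ out' y := by
  intro x y hx hxy hy
  rcases out_cases ho1 ho2 (hxy.trans_lt hy) with ⟨h3, h4⟩ | ⟨x', h3, h4, h5⟩ <;>
  rcases out_cases ho1 ho2 hy with ⟨h6, h7⟩ | ⟨y', h6, h7, h8⟩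
  · rw [h4, h7]; exact h1 x y hx hxy h6
  · rw [h4, h8]; exact h2 x y' hx h3 (by omega)
  · omega
  · rw [h5, h8]; exact hs _ _ (by omega) (by omega)

lemma B_le (hm : m.Valid) : m.B ≤ m.k * m.B := by
  have := Nat.mul_le_mul_right m.B hm.k_pos
  rwa [one_mul] at this

/-- One step of a merge while some run still has blocks to be loaded. -/
lemma Inv.step_load (hm : m.Valid) {buf ptr key out buf' ptr' key' out' : ℕ → ℕ} {o b : ℕ}
    (h : m.Inv buf ptr key out o) (hso : m.s ≤ o) (hb : b < m.k) (hlt : ptr b < m.hi b)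
    (hmin : ∀ i < m.k, key b ≤ key i)
    (ho1 : ∀ x < o * m.B, out' x = out x) (ho2 : ∀ x < m.B, out' (o * m.B + x) = buf x)
    (hs : ∀ x y, x ≤ y → y < m.k * m.B → buf' x ≤ buf' y)
    (hbuf : ms buf' 0 (m.k * m.B) =
      ms m.S (ptr b * m.B) ((ptr b + 1) * m.B) + ms buf m.B (m.k * m.B))
    (hp : ∀ i < m.k, ptr' i = if i = b then ptr b + 1 else ptr i)
    (hk : ∀ i < m.k, i ≠ b → key' i = key i)
    (hkb : key' b = if ptr b + 1 < m.hi b then m.S (ptr b * m.B + m.B - 1) else m.inf) :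
    m.Inv buf' ptr' key' out' (o + 1) := by
  have hB := hm.B_pos
  have hBk := B_le hm
  have e1 : (ptr b + 1) * m.B = ptr b * m.B + m.B := by ring
  have hhi : (ptr b + 1) * m.B ≤ m.hi b * m.B := Nat.mul_le_mul_right _ hlt
  have hkeyb := (h.keys b hb).2.1 hlt
  have hnext : ∀ c, ptr b * m.B ≤ c → c < m.hi b * m.B → key b ≤ m.S c := fun c h1 h2 => by
    rw [hkeyb]
    exact runs_sorted hm h.keys hb hlt le_rfl (by omega) h2
  have hfirst : ∀ x < m.B, buf x ≤ key b := fun x hx => buf_le_key hm h hb hlt hx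
  have hrest : ∀ x i c, x < m.B → i < m.k → ptr i * m.B ≤ c → c < m.hi i * m.B →
      buf x ≤ m.S c := by
    intro x i c hx hi h1 h2
    have hlti : ptr i < m.hi i := by
      by_contra hc
      have := Nat.mul_le_mul_right m.B (not_lt.1 hc)
      omega
    refine (hfirst x hx).trans ((hmin i hi).trans ?_)
    rw [(h.keys i hi).2.1 hlti]
    exact runs_sorted hm h.keys hi hlti le_rfl (by omega) h2
  have hptr : ∀ i < m.k, ptr i ≤ ptr' i := fun i hi => by
    rw [hp i hi]
    split_ifs with h
    · rw [h]; omega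
    · exact le_rfl
  have hbuf' : ∀ y < m.k * m.B, (∃ c, ptr b * m.B ≤ c ∧ c < m.hi b * m.B ∧ m.S c = buf' y) ∨
      ∃ y', m.B ≤ y' ∧ y' < m.k * m.B ∧ buf y' = buf' y := by
    intro y hy
    have : buf' y ∈ ms buf' 0 (m.k * m.B) := mem_ms.2 ⟨y, Nat.zero_le _, hy, rfl⟩
    rw [hbuf, Multiset.mem_add, mem_ms, mem_ms] at this
    rcases this with ⟨c, h1, h2, h3⟩ | ⟨y', h1, h2, h3⟩
    · exact .inl ⟨c, h1, by omega, h3⟩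
    · exact .inr ⟨y', h1, h2, h3⟩
  refine ⟨hs, ?_, out_sorted_step hBk ho1 ho2 h.sorted h.out_sorted h.out_buf, ?_, ?_, ?_, ?_⟩
  · obtain ⟨z, hz⟩ := h.mult
    refine ⟨z, ?_⟩
    rw [← hz, out_step hso ho1 ho2, hbuf, ms_add (f := buf) (Nat.zero_le m.B) hBk]
    have h1 : m.rest ptr = ms m.S (ptr b * m.B) ((ptr b + 1) * m.B) + m.rest ptr' := by
      rw [rest, rest, ← Finset.add_sum_erase _ _ (Finset.mem_range.2 hb),
        ← Finset.add_sum_erase _ _ (Finset.mem_range.2 hb), hp b hb, if_pos rfl,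
        ms_add (b := (ptr b + 1) * m.B) (by omega) hhi, add_assoc]
      congr 2
      refine Finset.sum_congr rfl fun i hi => ?_
      rw [hp i (Finset.mem_range.1 (Finset.mem_of_mem_erase hi)), if_neg (Finset.ne_of_mem_erase hi)]
    rw [h1]
    abel
  · intro x y hx hxo hy
    rcases out_cases ho1 ho2 hxo with ⟨h3, h4⟩ | ⟨x', h3, h4, h5⟩
    · rw [h4]
      rcases hbuf' y hy with ⟨c, h1, h2, h6⟩ | ⟨y', h1, h2, h6⟩
      · rw [← h6]; exact h.out_rest x b c hx h3 hb h1 h2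
      · rw [← h6]; exact h.out_buf x y' hx h3 h2
    · rw [h5]
      rcases hbuf' y hy with ⟨c, h1, h2, h6⟩ | ⟨y', h1, h2, h6⟩
      · rw [← h6]; exact hrest x' b c h3 hb h1 h2
      · rw [← h6]; exact h.sorted _ _ (by omega) h2
  · intro x i c hx hxo hi h1 h2
    have h1' : ptr i * m.B ≤ c := (Nat.mul_le_mul_right _ (hptr i hi)).trans h1
    rcases out_cases ho1 ho2 hxo with ⟨h3, h4⟩ | ⟨x', h3, h4, h5⟩
    · rw [h4]; exact h.out_rest x i c hx h3 hi h1' h2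
    · rw [h5]; exact hrest x' i c h3 hi h1' h2
  · intro i hi
    refine ⟨(h.keys i hi).1.trans_le (hptr i hi), ?_⟩
    rw [hp i hi]
    by_cases hib : i = b
    · subst hib
      rw [if_pos rfl, hkb, e1]
      exact ⟨fun h1 => if_pos h1, fun h1 => if_neg (not_lt.2 h1)⟩
    · rw [if_neg hib, hk i hi hib]
      exact (h.keys i hi).2
  · obtain ⟨last, h1, h2⟩ := h.cnt
    -- The witness remembers the last word of the newly loaded block even if the run is thereby
    -- exhausted and its key becomes `m.inf`.
    refine ⟨Function.update last b (m.S (ptr b * m.B + m.B - 1)), ?_, ?_⟩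
    · intro i hi h3
      by_cases hib : i = b
      · subst hib
        rw [hp i hi, if_pos rfl] at h3
        rw [Function.update_self, hkb, if_pos h3]
      · rw [hp i hi, if_neg hib] at h3
        rw [Function.update_of_ne hib, hk i hi hib]
        exact h1 i hi h3
    · rintro τ ⟨j, hj, hj1, hj2⟩
      -- Run b had the least key, so every threshold that is relevant after the step was relevant
      -- before it, and the old count applies.
      have hτ : key b ≤ τ := by
        by_cases hjb : j = b
        · subst hjb
          rw [hp j hj, if_pos rfl] at hj1
          rw [hkb, if_pos hj1] at hj2
          exact (hnext _ (by omega) (by omega)).trans hj2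
        · rw [hk j hj hjb] at hj2
          exact (hmin j hj).trans hj2
      have h3 := h2 τ ⟨b, hb, hlt, hτ⟩
      rw [hbuf, Multiset.countP_add]
      rw [ms_add (f := buf) (Nat.zero_le m.B) hBk, Multiset.countP_add] at h3
      have hnot : b ∉ (Finset.range m.k).filter (fun i => τ < last i) := by
        rw [Finset.mem_filter, h1 b hb hlt]
        exact fun h => absurd h.2 (not_lt.2 hτ)
      -- Before the step run b is not counted, because its key is at most τ. If the new block
      -- reaches above τ, one run is gained, which pays for the B new words; otherwise no new word
      -- is above τ.
      have hcard : (((Finset.range m.k).filter (fun i => τ < last i)).card +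
          if τ < m.S (ptr b * m.B + m.B - 1) then 1 else 0) ≤
          ((Finset.range m.k).filter
            (fun i => τ < Function.update last b (m.S (ptr b * m.B + m.B - 1)) i)).card := by
        split_ifs with hτ2
        · rw [← Finset.card_insert_of_notMem hnot]
          apply Finset.card_le_card
          intro i hi
          rw [Finset.mem_insert] at hi
          rw [Finset.mem_filter]
          rcases hi with rfl | hi
          · rw [Function.update_self]; exact ⟨Finset.mem_range.2 hb, hτ2⟩
          · rw [Function.update_of_ne (fun hib => hnot (by rwa [hib] at hi))]
            exact Finset.mem_filter.1 hi
        · rw [add_zero]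
          apply Finset.card_le_card
          intro i hi
          rw [Finset.mem_filter, Function.update_of_ne (fun hib => hnot (by rwa [hib] at hi))]
          exact Finset.mem_filter.1 hi
      have hnew : (ms m.S (ptr b * m.B) ((ptr b + 1) * m.B)).countP (τ < ·) ≤
          m.B * if τ < m.S (ptr b * m.B + m.B - 1) then 1 else 0 := by
        split_ifs with hτ2
        · refine (countP_ms_le _ _ _ _).trans ?_
          omega
        · rw [mul_zero, Nat.le_zero, Multiset.countP_eq_zero]
          intro y hy
          obtain ⟨c, hc1, hc2, rfl⟩ := mem_ms.1 hy
          rw [not_lt]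
          refine le_trans ?_ (not_lt.1 hτ2)
          exact runs_sorted hm h.keys hb hlt (by omega) (by omega) (by omega)
      have h4 := Nat.mul_le_mul_left m.B hcard
      rw [mul_add] at h4
      omega

/-- One step of a merge after everything has been loaded. -/
lemma Inv.step_fill (hm : m.Valid) {buf ptr key out buf' out' : ℕ → ℕ} {o : ℕ}
    (h : m.Inv buf ptr key out o) (hso : m.s ≤ o) (hall : ∀ i < m.k, m.hi i ≤ ptr i)
    (hinf : ∀ x < m.k * m.B, buf x ≤ m.inf)
    (ho1 : ∀ x < o * m.B, out' x = out x) (ho2 : ∀ x < m.B, out' (o * m.B + x) = buf x)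
    (hs : ∀ x y, x ≤ y → y < m.k * m.B → buf' x ≤ buf' y)
    (hbuf : ms buf' 0 (m.k * m.B) =
      Multiset.replicate m.B m.inf + ms buf m.B (m.k * m.B)) :
    m.Inv buf' ptr key out' (o + 1) := by
  have hB := hm.B_pos
  have hBk := B_le hm
  have hbuf' : ∀ y < m.k * m.B, buf' y = m.inf ∨
      ∃ y', m.B ≤ y' ∧ y' < m.k * m.B ∧ buf y' = buf' y := by
    intro y hy
    have : buf' y ∈ ms buf' 0 (m.k * m.B) := mem_ms.2 ⟨y, Nat.zero_le _, hy, rfl⟩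
    rw [hbuf, Multiset.mem_add, mem_ms] at this
    rcases this with h1 | h1
    · exact .inl (Multiset.eq_of_mem_replicate h1)
    · exact .inr h1
  refine ⟨hs, ?_, out_sorted_step hBk ho1 ho2 h.sorted h.out_sorted h.out_buf, ?_, ?_, h.keys, ?_⟩
  · obtain ⟨z, hz⟩ := h.mult
    -- The B fill words are accounted for by B more copies of `m.inf`.
    refine ⟨m.B + z, ?_⟩
    rw [Multiset.replicate_add, add_left_comm, ← hz, out_step hso ho1 ho2, hbuf,
      ms_add (f := buf) (Nat.zero_le m.B) hBk]
    abel
  · intro x y hx hxo hy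
    rcases out_cases ho1 ho2 hxo with ⟨h3, h4⟩ | ⟨x', h3, h4, h5⟩
    · rw [h4]
      rcases hbuf' y hy with h6 | ⟨y', h1, h2, h6⟩
      · rw [h6]; exact (h.out_buf x y hx h3 hy).trans (hinf y hy)
      · rw [← h6]; exact h.out_buf x y' hx h3 h2
    · rw [h5]
      rcases hbuf' y hy with h6 | ⟨y', h1, h2, h6⟩
      · rw [h6]; exact hinf x' (by omega)
      · rw [← h6]; exact h.sorted _ _ (by omega) h2
  · intro x i c hx hxo hi h1 h2
    have := Nat.mul_le_mul_right m.B (hall i hi)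
    omega
  -- With all runs exhausted there is no relevant threshold, so the count holds vacuously.
  · refine ⟨key, fun _ _ _ => rfl, ?_⟩
    rintro τ ⟨j, hj, hj1, hj2⟩
    have := hall j hj
    omega

/-- The invariant holds after the first block of every run has been loaded. -/
lemma Inv.init (hm : m.Valid) {buf buf' ptr key out : ℕ → ℕ}
    (hb1 : ∀ i x, i < m.k → m.s + i * m.ell < m.L → x < m.B →
      buf' (i * m.B + x) = m.S ((m.s + i * m.ell) * m.B + x))
    (hb2 : ∀ i x, i < m.k → m.L ≤ m.s + i * m.ell → x < m.B → buf' (i * m.B + x) = m.inf)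
    (hs : ∀ x y, x ≤ y → y < m.k * m.B → buf x ≤ buf y)
    (hbuf : ms buf 0 (m.k * m.B) = ms buf' 0 (m.k * m.B))
    (hp : ∀ i < m.k, ptr i = m.s + i * m.ell + 1)
    (hk : ∀ i < m.k, key i = if ptr i < m.hi i then m.S (ptr i * m.B - 1) else m.inf) :
    m.Inv buf ptr key out m.s := by
  have hB := hm.B_pos
  have hkeys : m.KeysOk ptr key := by
    intro i hi
    rw [hk i hi]
    exact ⟨by rw [hp i hi]; omega, fun h => if_pos h, fun h => if_neg (not_lt.2 h)⟩
  have hblk : ∀ i, ms buf' (i * m.B) ((i + 1) * m.B) = ms (fun x => buf' (i * m.B + x)) 0 m.B := by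
    intro i
    have := ms_shift buf' 0 m.B (i * m.B)
    rw [add_zero] at this
    rw [← this, add_mul, one_mul]
  refine ⟨hs, ?_, ?_, ?_, ?_, hkeys, ?_⟩
  · rw [ms_self, zero_add, hbuf, rest]
    -- Induction on the number of runs. A run that would start beyond the end of the array
    -- contributes a block of copies of `m.inf` and has no rest.
    have : ∀ j ≤ m.k, ∃ z, ms buf' 0 (j * m.B) +
        ∑ i ∈ Finset.range j, ms m.S (ptr i * m.B) (m.hi i * m.B) =
        ms m.S (m.s * m.B) (min (m.s + j * m.ell) m.L * m.B) + Multiset.replicate z m.inf := by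
      intro j
      induction j with
      | zero =>
        intro _
        refine ⟨0, ?_⟩
        rw [zero_mul, zero_mul, add_zero, min_eq_left hm.s_lt.le]
        simp [ms_self]
      | succ j ih =>
        intro hj
        obtain ⟨z, hz⟩ := ih (by omega)
        rw [Finset.sum_range_succ, ms_add (f := buf') (b := j * m.B) (Nat.zero_le _)
          (Nat.mul_le_mul_right _ (by omega)), hblk]
        have hhi : m.hi j = min (m.s + (j + 1) * m.ell) m.L := rfl
        have hl := hm.ell_pos
        have e1 : (j + 1) * m.ell = j * m.ell + m.ell := by ring
        by_cases hlt : m.s + j * m.ell < m.L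
        · refine ⟨z, ?_⟩
          have h1 : ms (fun x => buf' (j * m.B + x)) 0 m.B =
              ms m.S ((m.s + j * m.ell) * m.B) (ptr j * m.B) := by
            rw [hp j (by omega), add_mul (m.s + j * m.ell) 1, one_mul]
            have := ms_shift m.S 0 m.B ((m.s + j * m.ell) * m.B)
            rw [add_zero] at this
            rw [this]
            exact ms_congr fun x _ hx => hb1 j x (by omega) hlt hx
          rw [h1]
          rw [min_eq_left hlt.le] at hz
          rw [← hhi, ms_add (f := m.S) (a := m.s * m.B) (b := (m.s + j * m.ell) * m.B)
            (Nat.mul_le_mul_right _ (by omega)) (Nat.mul_le_mul_right _ (by omega)),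
            ms_add (f := m.S) (a := (m.s + j * m.ell) * m.B) (b := ptr j * m.B)
            (c := m.hi j * m.B)]
          · calc _ = (ms buf' 0 (j * m.B) +
                ∑ i ∈ Finset.range j, ms m.S (ptr i * m.B) (m.hi i * m.B)) +
                (ms m.S ((m.s + j * m.ell) * m.B) (ptr j * m.B) +
                  ms m.S (ptr j * m.B) (m.hi j * m.B)) := by abel
              _ = _ := by rw [hz]; abel
          · exact Nat.mul_le_mul_right _ (by rw [hp j (by omega)]; omega)
          · exact Nat.mul_le_mul_right _ (by rw [hp j (by omega)]; omega)
        · refine ⟨z + m.B, ?_⟩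
          have h1 : ms (fun x => buf' (j * m.B + x)) 0 m.B = Multiset.replicate m.B m.inf := by
            rw [Multiset.eq_replicate]
            refine ⟨by rw [card_ms]; omega, fun y hy => ?_⟩
            obtain ⟨x, _, hx, rfl⟩ := mem_ms.1 hy
            exact hb2 j x (by omega) (by omega) hx
          have h2 : ms m.S (ptr j * m.B) (m.hi j * m.B) = 0 := by
            rw [← Multiset.card_eq_zero, card_ms]
            have : m.hi j * m.B ≤ ptr j * m.B :=
              Nat.mul_le_mul_right _ (by rw [hp j (by omega)]; omega)
            omega
          rw [h1, h2, Multiset.replicate_add, min_eq_right (by omega)]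
          rw [min_eq_right (by omega)] at hz
          calc _ = (ms buf' 0 (j * m.B) +
                ∑ i ∈ Finset.range j, ms m.S (ptr i * m.B) (m.hi i * m.B)) +
                Multiset.replicate m.B m.inf := by abel
            _ = _ := by rw [hz]; abel
    exact this m.k le_rfl
  · intros; omega
  · intros; omega
  · intros; omega
  · refine ⟨fun i => if m.s + i * m.ell < m.L then m.S ((m.s + i * m.ell) * m.B + m.B - 1)
      else m.inf, ?_, ?_⟩
    · intro i hi h1
      rw [hk i hi, if_pos h1]
      rw [hp i hi] at h1 ⊢
      simp only
      rw [if_pos (by have := hi_le (m := m) i; omega)]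
      congr 1
      rw [add_mul (m.s + i * m.ell) 1, one_mul]
    · rintro τ ⟨i₀, hi₀, hlt₀, -⟩
      rw [hbuf]
      -- A relevant threshold needs a run with a second block, which rules out runs of length one;
      -- hence the runs are sorted.
      have hrun : ∀ i < m.k, ∀ c c', (m.s + i * m.ell) * m.B ≤ c → c ≤ c' → c' < m.hi i * m.B →
          m.S c ≤ m.S c' := by
        rcases hm.runs with h | h
        · have : m.hi i₀ ≤ m.s + (i₀ + 1) * m.ell := min_le_left _ _
          rw [hp i₀ hi₀] at hlt₀
          rw [h] at this hlt₀
          omega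
        · exact h
      have : ∀ j ≤ m.k, (ms buf' 0 (j * m.B)).countP (τ < ·) ≤ m.B *
          ((Finset.range j).filter (fun i => τ < if m.s + i * m.ell < m.L then
            m.S ((m.s + i * m.ell) * m.B + m.B - 1) else m.inf)).card := by
        intro j
        induction j with
        | zero => intro _; simp [ms_self]
        | succ j ih =>
          intro hj
          have ih' := ih (by omega)
          rw [ms_add (f := buf') (b := j * m.B) (Nat.zero_le _)
            (Nat.mul_le_mul_right _ (by omega)), hblk, Multiset.countP_add,
            Finset.range_add_one, Finset.filter_insert]
          by_cases hτ : τ < if m.s + j * m.ell < m.L then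
              m.S ((m.s + j * m.ell) * m.B + m.B - 1) else m.inf
          · rw [if_pos hτ, Finset.card_insert_of_notMem (by simp), mul_add, mul_one]
            have := countP_ms_le (fun x => buf' (j * m.B + x)) 0 m.B (τ < ·)
            omega
          · have h0 : (ms (fun x => buf' (j * m.B + x)) 0 m.B).countP (τ < ·) = 0 := by
              rw [Multiset.countP_eq_zero]
              intro y hy
              obtain ⟨x, _, hx, rfl⟩ := mem_ms.1 hy
              rw [not_lt] at hτ ⊢
              refine le_trans ?_ hτ
              split_ifs with hL
              · rw [hb1 j x (by omega) hL hx]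
                refine hrun j (by omega) _ _ (by omega) (by omega) ?_
                have h1 : m.s + j * m.ell + 1 ≤ m.hi j := by
                  have := hm.ell_pos
                  have e1 : (j + 1) * m.ell = j * m.ell + m.ell := by ring
                  rw [hi, e1]; omega
                have h2 := Nat.mul_le_mul_right m.B h1
                rw [add_mul, one_mul] at h2
                omega
              · rw [hb2 j x (by omega) (by omega) hx]
            rw [if_neg hτ, h0, add_zero]
            exact ih'
      exact this m.k le_rfl

/-- When all blocks of the group have been written, the group is sorted. -/
lemma Inv.final (hm : m.Valid) {buf ptr key out : ℕ → ℕ} (h : m.Inv buf ptr key out m.e) :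
    ms out (m.s * m.B) (m.e * m.B) = ms m.S (m.s * m.B) (m.e * m.B) := by
  obtain ⟨z, hz⟩ := h.mult
  set O := ms out (m.s * m.B) (m.e * m.B)
  set T := ms m.S (m.s * m.B) (m.e * m.B)
  set R := ms buf 0 (m.k * m.B) + m.rest ptr with hR
  have hz' : O + R = T + Multiset.replicate z m.inf := by rw [hR, ← add_assoc, hz]
  have hcard : O.card = T.card := by simp only [O, T, card_ms]
  have hTinf : ∀ x ∈ T, x < m.inf := by
    intro x hx
    obtain ⟨c, -, hc, rfl⟩ := mem_ms.1 hx
    exact hm.lt_inf c (hc.trans_le (Nat.mul_le_mul_right _ (min_le_right _ _)))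
  have hOR : ∀ x ∈ O, ∀ y ∈ R, x ≤ y := by
    intro x hx y hy
    obtain ⟨c, hc1, hc2, rfl⟩ := mem_ms.1 hx
    rw [hR, Multiset.mem_add] at hy
    rcases hy with hy | hy
    · obtain ⟨d, -, hd, rfl⟩ := mem_ms.1 hy
      exact h.out_buf c d hc1 hc2 hd
    · rw [rest, Multiset.mem_sum] at hy
      obtain ⟨i, hi, hy⟩ := hy
      obtain ⟨d, hd1, hd2, rfl⟩ := mem_ms.1 hy
      exact h.out_rest c i d hc1 hc2 (Finset.mem_range.1 hi) hd1 hd2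
  have hRz : R.card = z := by
    have := congrArg Multiset.card hz'
    simp only [Multiset.card_add, Multiset.card_replicate] at this
    omega
  have hinf : ∀ x ∈ O + R, x ≤ m.inf := by
    intro x hx
    rw [hz', Multiset.mem_add] at hx
    rcases hx with hx | hx
    · exact (hTinf x hx).le
    · exact (Multiset.eq_of_mem_replicate hx).le
  -- If `m.inf` had been written, everything remaining would be at least `m.inf`, hence equal to it.
  -- Cancelling would make output and source equal as multisets, but the source contains no `m.inf`.
  have hno : ∀ x ∈ O, x ≠ m.inf := by
    intro x hx hxi
    have hRall : R = Multiset.replicate z m.inf := by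
      rw [Multiset.eq_replicate]
      refine ⟨hRz, fun y hy => le_antisymm (hinf y (Multiset.mem_add.2 (.inr hy))) ?_⟩
      rw [← hxi]
      exact hOR x hx y hy
    rw [hRall] at hz'
    have : O = T := add_right_cancel hz'
    rw [this] at hx
    exact (hTinf x hx).ne hxi
  clear_value R
  have hf := congrArg (Multiset.filter (· ≠ m.inf)) hz'
  rw [Multiset.filter_add, Multiset.filter_add, Multiset.filter_eq_self.2 hno,
    Multiset.filter_eq_self.2 (fun x hx => (hTinf x hx).ne)] at hf
  have h0 : Multiset.filter (· ≠ m.inf) (Multiset.replicate z m.inf) = 0 := by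
    rw [Multiset.filter_eq_nil]
    intro x hx
    simpa using Multiset.eq_of_mem_replicate hx
  rw [h0, add_zero] at hf
  have hc := congrArg Multiset.card hf
  rw [Multiset.card_add, hcard] at hc
  have h1 : Multiset.filter (· ≠ m.inf) R = 0 := Multiset.card_eq_zero.1 (by omega)
  rw [h1, add_zero] at hf
  exact hf

end MergeData
end ExtMem
namespace ExtMem

/-! ### The merge program -/

/-- The end of the merge buffer. -/
def bufEnd : Expr := .mul (var 16) .blockSize

/-- The address of the pointer of run `i`. -/
def ptrAddr (i : Expr) : Expr := .add bufEnd i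

/-- The address of the key of run `i`. -/
def keyAddr (i : Expr) : Expr := .add (.add bufEnd (var 16)) i

/-- Fill a block of main memory with the value above all words. -/
def fillInf (d : Expr) : Program := forLoop 7 .blockSize (.store (.add d (var 7)) (var 17))

/-- Set the key of run `i` after a block has been loaded whose last word has address `l`. -/
def setKey (i l : Expr) : Program :=
  .ite (.mul (.lt (cell (ptrAddr i)) (.add (var 6) (.mul (.add i (.const 1)) (var 8))))
      (.lt (cell (ptrAddr i)) (var 15)))
    (.store (keyAddr i) (cell l)) (.store (keyAddr i) (var 17))

/-- Load the first block of every run. -/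
def loadRuns : Program :=
  forLoop 3 (var 16)
    (.seq (.ite (.lt (.add (var 6) (.mul (var 3) (var 8))) (var 15))
        (.read (.mul (var 3) .blockSize) (.add (var 13) (.add (var 6) (.mul (var 3) (var 8)))))
        (fillInf (.mul (var 3) .blockSize)))
      (.seq (.store (ptrAddr (var 3)) (.add (.add (var 6) (.mul (var 3) (var 8))) (.const 1)))
        (setKey (var 3) (.sub (.add (.mul (var 3) .blockSize) .blockSize) (.const 1)))))

/-- Find a run with the smallest key. -/
def findMin : Program :=
  .seq (assign 4 (.const 0))
    (forLoop 3 (var 16)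
      (.ite (.lt (cell (keyAddr (var 3))) (cell (keyAddr (var 4)))) (assign 4 (var 3)) .skip))

/-- Load the next block of the run with the smallest key. -/
def loadNext : Program :=
  .ite (.lt (cell (keyAddr (var 4))) (var 17))
    (.seq (.read (.const 0) (.add (var 13) (cell (ptrAddr (var 4)))))
      (.seq (.store (ptrAddr (var 4)) (.add (cell (ptrAddr (var 4))) (.const 1)))
        (setKey (var 4) (.sub .blockSize (.const 1)))))
    (fillInf (.const 0))

/-- Write one block of output and refill the buffer. -/
def mergeStep : Program :=
  .seq (.write (.const 0) (.add (var 14) (var 5)))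
    (.seq findMin (.seq loadNext (.seq (memSort bufEnd) (assign 5 (.add (var 5) (.const 1))))))

/-- The word size is large enough for the merge program. -/
structure Params (μ : Machine) (L k inf : ℕ) : Prop where
  B_pos : 1 ≤ μ.B
  L_pos : 1 ≤ L
  k_two : 2 ≤ k
  mem : k * μ.B + k + k ≤ μ.M + 4
  word : 2 * L + k * L + k * (k * L) + inf + μ.M + 8 < μ.W

/-- The variables that hold the parameters of the merge program. -/
structure Vars (L k inf src dst s ell : ℕ) (b : Conf) : Prop where
  v6 : b.V 6 = s
  v8 : b.V 8 = ell
  v13 : b.V 13 = src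
  v14 : b.V 14 = dst
  v15 : b.V 15 = L
  v16 : b.V 16 = k
  v17 : b.V 17 = inf

section
variable {μ : Machine} [hμ : Fact (μ.extra = extraWords)] {Q : Conf → Prop} {a : Conf}
  {L k inf src dst s ell : ℕ}

lemma Vars.of_eq {b : Conf} (h : Vars L k inf src dst s ell a)
    (hb : ∀ x, 6 ≤ x → x ≠ 7 → b.V x = a.V x) : Vars L k inf src dst s ell b := by
  constructor <;> rw [hb _ (by norm_num) (by norm_num)]
  exacts [h.v6, h.v8, h.v13, h.v14, h.v15, h.v16, h.v17]

lemma wp_fillInf (P : Params μ L k inf) {d : Expr} {y : ℕ} (hv : a.V 17 = inf)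
    (hd : ∀ b : Conf, (∀ x, x ≠ 7 → b.V x = a.V x) → d.eval μ (b.st μ.M) = y)
    (hy : y + μ.B ≤ μ.M + 4)
    (hQ : ∀ b : Conf, (∀ x, x ≠ 7 → b.V x = a.V x) → b.X = a.X → b.t = a.t →
      (∀ x, b.D x = if y ≤ x ∧ x < y + μ.B then inf else a.D x) → Q b) :
    wp μ (fillInf d) Q a := by
  have := P.word
  refine wp_for μ.B (fun j b => (∀ x, x ≠ 7 → b.V x = a.V x) ∧ b.V 7 = j ∧ b.X = a.X ∧ b.t = a.t ∧
      (∀ x, b.D x = if y ≤ x ∧ x < y + j then inf else a.D x)) (by norm_num) ?_ ?_ ?_ ?_ ?_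
  · omega
  · refine ⟨fun x hx => Function.update_of_ne hx _ _, by simp, rfl, rfl, ?_⟩
    intro x
    rw [if_neg (by omega)]
  · rintro j b - ⟨h1, h2, -⟩
    exact ⟨h2, rfl⟩
  · rintro j b hj ⟨h1, h2, h3, h4, h5⟩
    refine wp_store (y := y + j) (x := inf) ?_ ?_ (by omega) (by omega) ?_
    · simp only [Expr.eval]
      rw [hd b h1, eval_var (by norm_num), h2]
    · rw [eval_var (by norm_num), h1 _ (by norm_num), hv]
    · refine ⟨h2, fun x hx => ?_, by simp, h3, h4, ?_⟩
      · simp only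
        rw [Function.update_of_ne hx, h1 x hx]
      · intro x
        simp only [Function.update_apply, h5]
        split_ifs <;> first | rfl | omega
  · rintro b ⟨h1, h2, h3, h4, h5⟩
    exact hQ b h1 h3 h4 h5

/-- The pointer is compared with the end of the run and with the end of the array. The product of
the two tests serves as their conjunction. -/
lemma wp_setKey (P : Params μ L k inf) (hv : Vars L k inf src dst s ell a) {i l : Expr} {iv lv : ℕ}
    (hi : i.eval μ (a.st μ.M) = iv) (hl : l.eval μ (a.st μ.M) = lv) (hik : iv < k)
    (hlM : lv < μ.M + 4) (hlW : a.D lv < μ.W)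
    (hQ : ∀ b : Conf, b.V = a.V → b.X = a.X → b.t = a.t →
      (∀ x, b.D x = if x = k * μ.B + k + iv then
        (if a.D (k * μ.B + iv) < min (s + (iv + 1) * ell) L then a.D lv else inf) else a.D x) →
      Q b) :
    wp μ (setKey i l) Q a := by
  have hmem := P.mem
  have hw := P.word
  have e1 : (ptrAddr i).eval μ (a.st μ.M) = k * μ.B + iv := by
    simp only [ptrAddr, bufEnd, Expr.eval, hi]
    rw [eval_var (by norm_num), hv.v16]
  have e2 : (keyAddr i).eval μ (a.st μ.M) = k * μ.B + k + iv := by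
    simp only [keyAddr, bufEnd, Expr.eval, hi]
    rw [eval_var (by norm_num), hv.v16]
  have e3 := eval_cell (μ := μ) a e1 (by omega)
  have e4 := eval_cell (μ := μ) a hl hlM
  have e5 : (var 6).eval μ (a.st μ.M) = s := by rw [eval_var (by norm_num), hv.v6]
  have e6 : (var 8).eval μ (a.st μ.M) = ell := by rw [eval_var (by norm_num), hv.v8]
  have e7 : (var 15).eval μ (a.st μ.M) = L := by rw [eval_var (by norm_num), hv.v15]
  have e8 : (var 17).eval μ (a.st μ.M) = inf := by rw [eval_var (by norm_num), hv.v17]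
  refine wp_ite ?_ ?_
  · intro hc
    simp only [Expr.eval, e3, e5, e6, e7, hi] at hc
    have h1 : a.D (k * μ.B + iv) < min (s + (iv + 1) * ell) L := by
      rw [lt_min_iff]
      by_contra h
      rw [not_and_or] at h
      rcases h with h | h <;> simp [h] at hc
    refine wp_store e2 e4 (by omega) hlW (hQ _ rfl rfl rfl ?_)
    intro x
    simp only [Function.update_apply, if_pos h1]
  · intro hc
    simp only [Expr.eval, e3, e5, e6, e7, hi] at hc
    have h1 : ¬ a.D (k * μ.B + iv) < min (s + (iv + 1) * ell) L := by
      rw [lt_min_iff]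
      intro h
      simp [h] at hc
    refine wp_store e2 e8 (by omega) (by omega) (hQ _ rfl rfl rfl ?_)
    intro x
    simp only [Function.update_apply, if_neg h1]

lemma mul_add_lt_mul {i k x B : ℕ} (hi : i < k) (hx : x < B) : i * B + x < k * B := by
  have := Nat.mul_le_mul_right B hi
  rw [Nat.succ_mul] at this
  omega

/-- The result of loading the first blocks of the first `j` runs. -/
structure Loaded (B L k inf s ell : ℕ) (S D : ℕ → ℕ) (j : ℕ) : Prop where
  data : ∀ i x, i < j → s + i * ell < L → x < B → D (i * B + x) = S ((s + i * ell) * B + x)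
  fill : ∀ i x, i < j → L ≤ s + i * ell → x < B → D (i * B + x) = inf
  ptr : ∀ i < j, D (k * B + i) = s + i * ell + 1
  key : ∀ i < j, D (k * B + k + i) =
    if D (k * B + i) < min (s + (i + 1) * ell) L then S (D (k * B + i) * B - 1) else inf

/-- Memory holds k blocks of buffer, followed by k pointers and k keys. Only runs that start inside
the array cost a read. -/
lemma wp_loadRuns (P : Params μ L k inf) (hv : Vars L k inf src dst s ell a) (hs : s < L)
    (hell : ell ≤ k * L) (hl1 : 1 ≤ ell)
    (hX : ∀ c < L * μ.B, a.X (src * μ.B + c) < inf)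
    (hQ : ∀ b : Conf, (∀ x, 4 ≤ x → x ≠ 7 → b.V x = a.V x) → b.X = a.X →
      b.t ≤ a.t + min k (L - s) →
      Loaded μ.B L k inf s ell (fun c => a.X (src * μ.B + c)) b.D k → Q b) :
    wp μ loadRuns Q a := by
  have hmem := P.mem
  have hw := P.word
  have hB := P.B_pos
  refine wp_for k (fun j b => (∀ x, 4 ≤ x → x ≠ 7 → b.V x = a.V x) ∧ b.V 3 = j ∧ b.X = a.X ∧
    b.t ≤ a.t + min j (L - s) ∧ Loaded μ.B L k inf s ell (fun c => a.X (src * μ.B + c)) b.D j)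
    (by norm_num) (by omega) ?_ ?_ ?_ ?_
  · refine ⟨fun x hx hx' => Function.update_of_ne (by omega) _ _, by simp, rfl,
      by simp, ?_⟩
    constructor <;> intros <;> omega
  · rintro j b - ⟨h1, h2, -⟩
    exact ⟨h2, by rw [eval_var (by norm_num), h1 _ (by norm_num) (by norm_num), hv.v16]⟩
  · rintro j b hj ⟨h1, h2, h3, h4, h5⟩
    have hvb : Vars L k inf src dst s ell b := hv.of_eq fun x hx => h1 x (by omega)
    have hjk : j * ell ≤ k * (k * L) := Nat.mul_le_mul hj.le hell
    have hjB : j * μ.B + μ.B ≤ k * μ.B := by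
      have := Nat.mul_le_mul_right μ.B (Nat.succ_le_of_lt hj)
      rwa [Nat.succ_mul] at this
    have eB : ∀ b : Conf, b.V 3 = j → (Expr.mul (var 3) .blockSize).eval μ (b.st μ.M) = j * μ.B :=
      fun b hb => by simp only [Expr.eval]; rw [eval_var (by norm_num), hb]
    have epos : ∀ b : Conf, Vars L k inf src dst s ell b → b.V 3 = j →
        (Expr.add (var 6) (.mul (var 3) (var 8))).eval μ (b.st μ.M) = s + j * ell := by
      intro b hb hb3
      simp only [Expr.eval]
      rw [eval_var (by norm_num), eval_var (by norm_num), eval_var (by norm_num), hb.v6, hb3, hb.v8]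
    refine wp_seq (wp_mono (Q := fun c => (∀ x, 3 ≤ x → x ≠ 7 → c.V x = b.V x) ∧ c.X = a.X ∧
      c.t ≤ a.t + min (j + 1) (L - s) ∧
      ∀ x, c.D x = if j * μ.B ≤ x ∧ x < j * μ.B + μ.B then
        (if s + j * ell < L then a.X (src * μ.B + ((s + j * ell) * μ.B + (x - j * μ.B))) else inf)
        else b.D x) ?_ ?_)
    · refine wp_ite_lt (epos b hvb h2) (y := L) (by rw [eval_var (by norm_num), hvb.v15]) ?_ ?_
      · intro hlt
        refine wp_read (y := j * μ.B) (x := src + (s + j * ell)) (eB b h2) ?_ (by omega)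
          ⟨fun _ _ _ => rfl, h3, ?_, ?_⟩
        · have := epos b hvb h2
          simp only [Expr.eval] at this ⊢
          rw [this, eval_var (by norm_num), hvb.v13]
        -- Runs are nonempty, so run j starts at least j blocks after s; this bounds the number of
        -- reads by L - s.
        · have : j ≤ j * ell := Nat.le_mul_of_pos_right j hl1
          simp only
          omega
        · intro x
          simp only [if_pos hlt]
          split_ifs
          · rw [h3]; congr 1; ring
          · rfl
      · intro hge
        have hlt := not_lt.2 hge
        refine wp_fillInf P hvb.v17 (y := j * μ.B) (fun c hc => eB c (by rw [hc _ (by norm_num), h2]))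
          (by omega) ?_
        intro c hc1 hc2 hc3 hc4
        refine ⟨fun x _ hx => hc1 x hx, by rw [hc2, h3], by omega, ?_⟩
        simpa only [if_neg hlt] using hc4
    rintro c ⟨g1, g2, g3, g4⟩
    have hvc : Vars L k inf src dst s ell c := hvb.of_eq fun x hx => g1 x (by omega)
    have hc3 : c.V 3 = j := by rw [g1 3 (by norm_num) (by norm_num), h2]
    refine wp_seq (wp_store (y := k * μ.B + j) (x := s + j * ell + 1) ?_ ?_ (by omega) (by omega) ?_)
    · simp only [ptrAddr, bufEnd, Expr.eval]
      rw [eval_var (by norm_num), eval_var (by norm_num), hvc.v16, hc3]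
    · have := epos c hvc hc3
      simp only [Expr.eval] at this ⊢
      rw [this]
    have hlast : c.D (j * μ.B + μ.B - 1) =
        if s + j * ell < L then a.X (src * μ.B + ((s + j * ell) * μ.B + (μ.B - 1))) else inf := by
      rw [g4, if_pos (by omega)]
      congr 4; omega
    refine wp_setKey (src := src) (dst := dst) (s := s) (ell := ell) P ?_ (iv := j)
      (lv := j * μ.B + μ.B - 1) ?_ ?_ hj (by omega) ?_ ?_
    · exact hvc.of_eq fun _ _ _ => rfl
    · rw [eval_var (by norm_num)]; exact hc3
    · simp only [Expr.eval]
      rw [eval_var (by norm_num), hc3]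
    · simp only
      rw [Function.update_of_ne (by omega), hlast]
      split_ifs with h
      · refine (hX _ ?_).trans (by omega)
        exact mul_add_lt_mul h (by omega)
      · omega
    intro d d1 d2 d3 d4
    simp only [Function.update_apply] at d1 d2 d3 d4
    have d5 : ∀ x < k * μ.B, d.D x = c.D x := by
      intro x hx
      rw [d4, if_neg (by omega), if_neg (by omega)]
    have hold : ∀ i x, i < j → x < μ.B → d.D (i * μ.B + x) = b.D (i * μ.B + x) := by
      intro i x hi hx
      have := mul_add_lt_mul hi hx
      rw [d5 _ (by omega), g4, if_neg (by omega)]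
    have hnew : ∀ x < μ.B, d.D (j * μ.B + x) =
        if s + j * ell < L then a.X (src * μ.B + ((s + j * ell) * μ.B + x)) else inf := by
      intro x hx
      rw [d5 _ (by omega), g4, if_pos (by omega)]
      congr 4; omega
    have hp : ∀ i, i < k → d.D (k * μ.B + i) = if i = j then s + j * ell + 1 else b.D (k * μ.B + i) := by
      intro i hi
      rw [d4, if_neg (by omega)]
      split_ifs with h h' h'
      · rfl
      · omega
      · omega
      · rw [g4, if_neg (by omega)]
    refine ⟨by rw [d1, hc3], fun x hx hx' => ?_, by simp, by rw [d2, g2], ?_, ?_⟩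
    · simp only [Function.update_apply]
      rw [if_neg (by omega), d1, g1 x (by omega) hx', h1 x hx hx']
    · simp only; omega
    · constructor
      · intro i x hi hL hx
        simp only
        rcases Nat.lt_succ_iff_lt_or_eq.1 hi with h | rfl
        · rw [hold i x h hx]; exact h5.data i x h hL hx
        · rw [hnew x hx, if_pos hL]
      · intro i x hi hL hx
        simp only
        rcases Nat.lt_succ_iff_lt_or_eq.1 hi with h | rfl
        · rw [hold i x h hx]; exact h5.fill i x h hL hx
        · rw [hnew x hx, if_neg (by omega)]
      · intro i hi
        simp only
        rw [hp i (by omega)]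
        split_ifs with h
        · rw [h]
        · exact h5.ptr i (by omega)
      · intro i hi
        simp only
        rw [hp i (by omega)]
        by_cases h : i = j
        · subst h
          rw [if_pos rfl, d4, if_pos rfl]
          simp only [if_true]
          rw [if_neg (show ¬ i * μ.B + μ.B - 1 = k * μ.B + i by omega)]
          have hcond : s + i * ell + 1 < min (s + (i + 1) * ell) L → s + i * ell < L := by
            intro h; rw [lt_min_iff] at h; omega
          split_ifs with h6
          · rw [hlast, if_pos (hcond h6)]
            congr 2
            rw [add_mul (s + i * ell) 1, one_mul]; omega
          · rfl
        · have h5k := h5.key i (by omega)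
          rw [if_neg h, ← h5k, d4, if_neg (by omega), if_neg (by omega), g4, if_neg (by omega)]
  · rintro b ⟨h1, h2, h3, h4, h5⟩
    exact hQ b h1 h3 h4 h5

end
end ExtMem
-- One step of the merge: write a block, load a block
namespace ExtMem

section
variable {μ : Machine} [hμ : Fact (μ.extra = extraWords)] {Q : Conf → Prop} {a : Conf}
  {L k inf src dst s ell : ℕ}

lemma eval_bufEnd {b : Conf} (h : b.V 16 = k) : bufEnd.eval μ (b.st μ.M) = k * μ.B := by
  simp only [bufEnd, eval_mul, eval_blockSize]
  rw [eval_var (by norm_num), h]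

lemma eval_ptrAddr {b : Conf} (h : b.V 16 = k) {e : Expr} {i : ℕ}
    (he : e.eval μ (b.st μ.M) = i) : (ptrAddr e).eval μ (b.st μ.M) = k * μ.B + i := by
  simp only [ptrAddr, eval_add, eval_bufEnd h, he]

lemma eval_keyAddr {b : Conf} (h : b.V 16 = k) {e : Expr} {i : ℕ}
    (he : e.eval μ (b.st μ.M) = i) : (keyAddr e).eval μ (b.st μ.M) = k * μ.B + k + i := by
  simp only [keyAddr, eval_add, eval_bufEnd h, he]
  rw [eval_var (by norm_num), h]

lemma wp_findMin (P : Params μ L k inf) (hv : a.V 16 = k)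
    (hQ : ∀ b : Conf, (∀ x, 5 ≤ x → b.V x = a.V x) → b.D = a.D → b.X = a.X → b.t = a.t →
      b.V 4 < k → (∀ i < k, a.D (k * μ.B + k + b.V 4) ≤ a.D (k * μ.B + k + i)) → Q b) :
    wp μ findMin Q a := by
  have hmem := P.mem
  have hw := P.word
  have hk := P.k_two
  refine wp_seq (wp_assign (by norm_num) (eval_const _ _) (by omega) ?_)
  refine wp_for k (fun j b => (∀ x, 5 ≤ x → b.V x = a.V x) ∧ b.V 3 = j ∧ b.D = a.D ∧ b.X = a.X ∧
    b.t = a.t ∧ b.V 4 < k ∧ (∀ i < j, a.D (k * μ.B + k + b.V 4) ≤ a.D (k * μ.B + k + i)))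
    (by norm_num) (by omega) ?_ ?_ ?_ ?_
  · refine ⟨fun x hx => ?_, by simp, rfl, rfl, rfl, by simp; omega, by intros; omega⟩
    simp only [Function.update_apply]
    rw [if_neg (by omega), if_neg (by omega)]
  · rintro j b - ⟨h1, h2, -⟩
    exact ⟨h2, by rw [eval_var (by norm_num), h1 _ (by norm_num), hv]⟩
  · rintro j b hj ⟨h1, h2, h3, h4, h5, h6, h7⟩
    have h16 : b.V 16 = k := by rw [h1 _ (by norm_num), hv]
    have e3 := eval_cell (μ := μ) b (eval_keyAddr h16 (eval_var (i := 3) (by norm_num) b))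
      (by rw [h2]; omega)
    have e4 := eval_cell (μ := μ) b (eval_keyAddr h16 (eval_var (i := 4) (by norm_num) b))
      (by omega)
    refine wp_ite_lt e3 e4 ?_ ?_
    · intro hlt
      rw [h2, h3] at hlt
      refine wp_assign (by norm_num) (x := j) (by rw [eval_var (by norm_num), h2]) (by omega) ?_
      refine ⟨by simpa using h2, fun x hx => ?_, by simp, h3, h4, h5, by simpa using hj, ?_⟩
      · simp only [Function.update_apply]
        rw [if_neg (by omega), if_neg (by omega), h1 x hx]
      · intro i hi
        simp only [Function.update_apply]
        rcases Nat.lt_succ_iff_lt_or_eq.1 hi with h | rfl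
        · exact hlt.le.trans (h7 i h)
        · exact le_rfl
    · intro hge
      rw [h2, h3] at hge
      refine wp_skip ⟨h2, fun x hx => ?_, by simp, h3, h4, h5, by simpa using h6, ?_⟩
      · simp only [Function.update_apply]
        rw [if_neg (by omega), h1 x hx]
      · intro i hi
        simp only [Function.update_apply]
        rcases Nat.lt_succ_iff_lt_or_eq.1 hi with h | rfl
        · exact h7 i h
        · exact hge
  · rintro b ⟨h1, h2, h3, h4, h5, h6, h7⟩
    exact hQ b h1 h3 h4 h5 h6 h7

/-- The merge data of a group of runs. -/
def mergeData (B k inf : ℕ) (X : ℕ → ℕ) (src s ell L : ℕ) : MergeData where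
  B := B
  k := k
  inf := inf
  S := fun c => X (src * B + c)
  s := s
  ell := ell
  L := L

/-- The state of a merge before block `o` of the output is written. -/
structure MergeState (μ : Machine) (k inf : ℕ) (X : ℕ → ℕ) (src dst s ell L t o : ℕ) (b : Conf) :
    Prop where
  inv : (mergeData μ.B k inf X src s ell L).Inv b.D (fun i => b.D (k * μ.B + i))
    (fun i => b.D (k * μ.B + k + i)) (fun c => b.X (dst * μ.B + c)) o
  vars : Vars L k inf src dst s ell b
  v5 : b.V 5 = o
  s_le : s ≤ o
  buf_le : ∀ x < k * μ.B, b.D x ≤ inf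
  ext : ∀ c, (c < (dst + s) * μ.B ∨ (dst + o) * μ.B ≤ c) → b.X c = X c
  time : b.t ≤ t + 2 * (o - s)

/-- The program realises `MergeData.Inv.step_load` if the least key is below `inf` and
`MergeData.Inv.step_fill` otherwise. Each output block costs one write and at most one read. -/
lemma wp_mergeStep (P : Params μ L k inf) {X : ℕ → ℕ} {t o : ℕ}
    (hm : (mergeData μ.B k inf X src s ell L).Valid)
    (hsd : src + L ≤ dst ∨ dst + L ≤ src)
    (h : MergeState μ k inf X src dst s ell L t o a) (ho : o < L)
    (hQ : ∀ b, MergeState μ k inf X src dst s ell L t (o + 1) b →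
      (∀ x, 6 ≤ x → x ≠ 7 → b.V x = a.V x) → Q b) :
    wp μ mergeStep Q a := by
  obtain ⟨hinv, hv, h5, hso, hbuf, hext, ht⟩ := h
  have hmem := P.mem
  have hw := P.word
  have hk := P.k_two
  have hB := P.B_pos
  have hkB : μ.B ≤ k * μ.B := Nat.le_mul_of_pos_left _ (by omega)
  -- Source and destination are disjoint ranges of blocks, so the output written so far leaves the
  -- source intact.
  have hS : ∀ c < L * μ.B, a.X (src * μ.B + c) = X (src * μ.B + c) := by
    intro c hc
    apply hext
    rcases hsd with h1 | h1
    · left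
      have := Nat.mul_le_mul_right μ.B (show src + L ≤ dst + s by omega)
      rw [add_mul] at this
      omega
    · right
      have := Nat.mul_le_mul_right μ.B (show dst + o ≤ src by omega)
      omega
  refine wp_seq (wp_write (y := 0) (x := dst + o) rfl ?_ (by omega) ?_)
  · rw [eval_add, eval_var (by norm_num), eval_var (by norm_num), hv.v14, h5]
  refine wp_seq (wp_findMin P hv.v16 ?_)
  intro b b1 b2 b3 b4 b5 b6
  simp only [zero_add] at b1 b2 b3 b4 b5 b6
  have b3' : ∀ c, b.X c = if (dst + o) * μ.B ≤ c ∧ c < (dst + o) * μ.B + μ.B then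
      a.D (c - (dst + o) * μ.B) else a.X c := fun c => by rw [b3]
  set j := b.V 4 with hj
  have hvb : Vars L k inf src dst s ell b := hv.of_eq fun x hx _ => b1 x (by omega)
  have e4 : (var 4).eval μ (b.st μ.M) = j := eval_var (by norm_num) b
  have hXb1 : ∀ c < (dst + o) * μ.B, b.X c = a.X c := fun c hc => by
    rw [b3', if_neg (by omega)]
  have hXb2 : ∀ c, (dst + (o + 1)) * μ.B ≤ c → b.X c = a.X c := fun c hc => by
    rw [← add_assoc, add_mul, one_mul] at hc
    rw [b3', if_neg (by omega)]
  have hbS : ∀ c < L * μ.B, b.X (src * μ.B + c) = X (src * μ.B + c) := by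
    intro c hc
    rw [← hS c hc]
    rcases hsd with h1 | h1
    · apply hXb1
      have := Nat.mul_le_mul_right μ.B (show src + L ≤ dst + o by omega)
      rw [add_mul] at this
      omega
    · apply hXb2
      have := Nat.mul_le_mul_right μ.B (show dst + (o + 1) ≤ src by omega)
      omega
  have ho1 : ∀ x < o * μ.B, b.X (dst * μ.B + x) = a.X (dst * μ.B + x) := by
    intro x hx
    apply hXb1
    rw [add_mul]; omega
  have ho2 : ∀ x < μ.B, b.X (dst * μ.B + (o * μ.B + x)) = a.D x := by
    intro x hx
    rw [b3', add_mul, if_pos (by omega)]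
    congr 1; omega
  -- the buffer after the load
  have hfin : ∀ c : Conf, (∀ x, 5 ≤ x → x ≠ 7 → c.V x = a.V x) → c.X = b.X →
      c.t ≤ a.t + 2 → (∀ x < k * μ.B, c.D x ≤ inf) →
      (∀ d : Conf, (∀ x, k * μ.B ≤ x → d.D x = c.D x) → d.X = b.X →
        (∀ x y, x ≤ y → y < k * μ.B → d.D x ≤ d.D y) →
        ms d.D 0 (k * μ.B) = ms c.D 0 (k * μ.B) →
        (mergeData μ.B k inf X src s ell L).Inv d.D (fun i => d.D (k * μ.B + i))
          (fun i => d.D (k * μ.B + k + i)) (fun c => d.X (dst * μ.B + c)) (o + 1)) →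
      wp μ (.seq (memSort bufEnd) (assign 5 (.add (var 5) (.const 1)))) Q c := by
    intro c c1 c2 c3 c4 hinv'
    refine wp_seq (wp_memSort (N := k * μ.B) (by omega) (by omega) ?_ ?_ ?_)
    · intro d hd
      apply eval_bufEnd
      rw [hd _ (by norm_num), c1 _ (by norm_num) (by norm_num), hv.v16]
    · intro x hx
      have := c4 x hx
      omega
    · intro d d1 d2 d3 d4 d5 d6
      have hd5 : d.V 5 = o := by rw [d1 _ (by norm_num), c1 _ (by norm_num) (by norm_num), h5]
      refine wp_assign (by norm_num) (x := o + 1) ?_ (by omega) ?_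
      · rw [eval_add, eval_var (by norm_num), hd5]; rfl
      · have hfr : ∀ x, 6 ≤ x → x ≠ 7 → Function.update d.V 5 (o + 1) x = a.V x := by
          intro x hx hx'
          rw [Function.update_of_ne (by omega), d1 x (by omega), c1 x (by omega) hx']
        refine hQ _ ⟨hinv' d d4 (by rw [d2, c2]) d5 d6, hv.of_eq hfr, by simp, by omega, ?_, ?_, ?_⟩
          hfr
        · intro x hx
          have : d.D x ∈ ms d.D 0 (k * μ.B) := mem_ms.2 ⟨x, Nat.zero_le _, hx, rfl⟩
          rw [d6, mem_ms] at this
          obtain ⟨y, -, hy, hy'⟩ := this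
          simp only
          rw [← hy']
          exact c4 y hy
        · intro x hx
          simp only
          rw [d2, c2]
          rcases hx with hx | hx
          · have := Nat.mul_le_mul_right μ.B (show dst + s ≤ dst + o by omega)
            rw [hXb1 x (by omega), hext x (.inl hx)]
          · have := Nat.mul_le_mul_right μ.B (show dst + o ≤ dst + (o + 1) by omega)
            rw [hXb2 x hx, hext x (.inr (by omega))]
        · simp only; omega
  have hpa : ∀ c : Conf, c.V = b.V → (ptrAddr (var 4)).eval μ (c.st μ.M) = k * μ.B + j :=
    fun c hc => eval_ptrAddr (by rw [hc, hvb.v16]) (by rw [eval_var (by norm_num), hc])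
  have hkey := eval_cell (μ := μ) b (eval_keyAddr hvb.v16 e4) (by omega)
  have hptr := eval_cell (μ := μ) b (eval_ptrAddr hvb.v16 e4) (by omega)
  rw [b2] at hkey hptr
  refine wp_seq (wp_ite_lt hkey (y := inf) (by rw [eval_var (by norm_num), hvb.v17]) ?_ ?_)
  · intro hlt
    have hlt' := (MergeData.key_lt hm hinv.keys b5).1 hlt
    have hpL : a.D (k * μ.B + j) < L := hlt'.trans_le (MergeData.hi_le j)
    refine wp_seq (wp_read (y := 0) (x := src + a.D (k * μ.B + j)) rfl ?_ (by omega) ?_)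
    · rw [eval_add, hptr, eval_var (by norm_num), hvb.v13]
    have hsrc : ∀ x < μ.B, b.X ((src + a.D (k * μ.B + j)) * μ.B + x) =
        X (src * μ.B + (a.D (k * μ.B + j) * μ.B + x)) := by
      intro x hx
      rw [add_mul, add_assoc, hbS _ (mul_add_lt_mul hpL hx)]
    simp only [zero_le, true_and, zero_add, tsub_zero]
    refine wp_seq (wp_store (y := k * μ.B + j) (x := a.D (k * μ.B + j) + 1) ?_ ?_ (by omega)
      (by omega) ?_)
    · exact hpa _ rfl
    · rw [eval_add, eval_const]
      refine congrArg (· + 1) ((eval_cell _ (hpa _ ?_) (by omega)).trans ?_)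
      · rfl
      · simp only
        rw [if_neg (by omega), b2]
    refine wp_setKey (src := src) (dst := dst) (s := s) (ell := ell) P ?_ (iv := j)
      (lv := μ.B - 1) ?_ ?_ b5 (by omega) ?_ ?_
    · exact hvb.of_eq fun _ _ _ => rfl
    · exact eval_var (by norm_num) _
    · rfl
    · simp only
      rw [Function.update_of_ne (by omega), if_pos (by omega), hsrc _ (by omega)]
      exact (hm.lt_inf _ (mul_add_lt_mul (B := μ.B) hpL (by omega))).trans (by simp only [mergeData]; omega)
    intro c c1 c2 c3 c4
    simp only [Function.update_apply] at c1 c2 c3 c4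
    simp only [if_true] at c4
    rw [if_neg (show ¬ μ.B - 1 = k * μ.B + j by omega), if_pos (show μ.B - 1 < μ.B by omega),
      hsrc _ (by omega)] at c4
    have cbuf : ∀ x < k * μ.B, c.D x = if x < μ.B then
        X (src * μ.B + (a.D (k * μ.B + j) * μ.B + x)) else a.D x := by
      intro x hx
      rw [c4, if_neg (by omega), if_neg (by omega)]
      split_ifs with hxB
      · exact hsrc x hxB
      · rw [b2]
    refine hfin c (fun x hx hx' => by rw [c1, b1 x hx]) c2 (by omega) ?_ ?_
    · intro x hx
      rw [cbuf x hx]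
      split_ifs with hxB
      · exact (hm.lt_inf _ (mul_add_lt_mul (B := μ.B) hpL hxB)).le
      · exact hbuf x hx
    · intro d d1 d2 d3 d4
      refine hinv.step_load hm hso b5 hlt' b6 (fun x hx => ?_) (fun x hx => ?_) d3 ?_ ?_ ?_ ?_
      · rw [d2]; exact ho1 x hx
      · rw [d2]; exact ho2 x hx
      · change ms d.D 0 (k * μ.B) = ms _ (a.D (k * μ.B + j) * μ.B) ((a.D (k * μ.B + j) + 1) * μ.B) +
          ms a.D μ.B (k * μ.B)
        rw [d4, ms_add (Nat.zero_le μ.B) hkB]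
        congr 1
        · have := ms_shift (mergeData μ.B k inf X src s ell L).S 0 μ.B (a.D (k * μ.B + j) * μ.B)
          rw [add_zero] at this
          rw [add_mul, one_mul, this]
          refine ms_congr fun x _ hx => ?_
          rw [cbuf x (by omega), if_pos hx]
          rfl
        · refine ms_congr fun x hx hx' => ?_
          rw [cbuf x hx', if_neg (by omega)]
      · intro i hi
        have hi' : i < k := hi
        rw [d1 _ (by omega), c4, if_neg (by omega)]
        by_cases hij : i = j
        · rw [if_pos (by omega), if_pos hij]
        · rw [if_neg (by omega), if_neg hij, if_neg (by omega), b2]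
      · intro i hi hij
        rw [d1 _ (by omega), c4, if_neg (by omega), if_neg (by omega), if_neg (by omega), b2]
      · rw [d1 _ (by omega), c4, if_pos rfl]
        congr 2
        change _ = src * μ.B + (a.D (k * μ.B + j) * μ.B + μ.B - 1)
        omega
  · intro hge
    -- The least key is `inf`, hence all keys are, and every run is exhausted.
    have hall : ∀ i < k, (mergeData μ.B k inf X src s ell L).hi i ≤ a.D (k * μ.B + i) := by
      intro i hi
      by_contra hc
      have h1 := (MergeData.key_lt hm hinv.keys hi).2 (not_le.1 hc)
      have h2 := b6 i hi
      simp only [mergeData] at h1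
      omega
    refine wp_fillInf P hvb.v17 (y := 0) (fun _ _ => rfl) (by omega) ?_
    intro c c1 c2 c3 c4
    have cbuf : ∀ x, c.D x = if x < μ.B then inf else a.D x := by
      intro x
      rw [c4, b2]
      simp
    refine hfin c (fun x hx hx' => by rw [c1 x hx', b1 x hx]) c2 (by omega) ?_ ?_
    · intro x hx
      rw [cbuf x]
      split_ifs with hxB
      · exact le_rfl
      · exact hbuf x hx
    · intro d d1 d2 d3 d4
      have hp : (fun i => d.D (k * μ.B + i)) = fun i => a.D (k * μ.B + i) := by
        funext i
        rw [d1 _ (by omega), cbuf, if_neg (by omega)]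
      have hq : (fun i => d.D (k * μ.B + k + i)) = fun i => a.D (k * μ.B + k + i) := by
        funext i
        rw [d1 _ (by omega), cbuf, if_neg (by omega)]
      rw [hp, hq]
      refine hinv.step_fill hm hso hall hbuf (fun x hx => ?_) (fun x hx => ?_) d3 ?_
      · rw [d2]; exact ho1 x hx
      · rw [d2]; exact ho2 x hx
      · change ms d.D 0 (k * μ.B) = Multiset.replicate μ.B inf + ms a.D μ.B (k * μ.B)
        rw [d4, ms_add (Nat.zero_le μ.B) hkB]
        congr 1
        · rw [Multiset.eq_replicate]
          refine ⟨by rw [card_ms]; omega, fun y hy => ?_⟩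
          obtain ⟨x, _, hx, rfl⟩ := mem_ms.1 hy
          rw [cbuf, if_pos hx]
        · refine ms_congr fun x hx hx' => ?_
          rw [cbuf x, if_neg (by omega)]

end
end ExtMem
-- Merging groups, merge passes and the complete external sort
namespace ExtMem

/-- Merge a group of `k` runs. -/
def mergeGroup : Program :=
  .seq loadRuns (.seq (memSort bufEnd) (.seq (assign 5 (var 6))
    (.seq (.while (.mul (.lt (var 5) (.add (var 6) (.mul (var 16) (var 8))))
        (.lt (var 5) (var 15))) mergeStep)
      (assign 6 (.add (var 6) (.mul (var 16) (var 8)))))))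

/-- Merge all groups of runs and exchange source and destination. -/
def mergePass : Program :=
  .seq (assign 6 (.const 0)) (.seq (.while (.lt (var 6) (var 15)) mergeGroup)
    (.seq (assign 3 (var 13)) (.seq (assign 13 (var 14)) (.seq (assign 14 (var 3))
      (assign 8 (.mul (var 8) (var 16)))))))

/-- Sort the words of the current array. -/
def mergeSort : Program :=
  .seq (assign 8 (.const 1)) (.seq mergePass (.while (.lt (var 8) (var 15)) mergePass))

/-- All runs of `ell` blocks are sorted. -/
def RunsSorted (B L ell : ℕ) (S : ℕ → ℕ) : Prop :=
  ∀ r c c', r * ell * B ≤ c → c ≤ c' → c' < min ((r + 1) * ell) L * B → S c ≤ S c'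

section
variable {μ : Machine} [hμ : Fact (μ.extra = extraWords)] {Q : Conf → Prop} {a : Conf}
  {L k inf src dst s ell : ℕ}

/-- The factor 3 counts, per block of the group, one write, at most one read during the merge, and a
share of the initial reads. -/
lemma wp_mergeGroup (P : Params μ L k inf) (hm : (mergeData μ.B k inf a.X src s ell L).Valid)
    (hsd : src + L ≤ dst ∨ dst + L ≤ src) (hv : Vars L k inf src dst s ell a) (hell : ell ≤ L)
    (hQ : ∀ b : Conf, Vars L k inf src dst (s + k * ell) ell b →
      (∀ x, 7 < x → b.V x = a.V x) →
      ms (fun c => b.X (dst * μ.B + c)) (s * μ.B) (min (s + k * ell) L * μ.B) =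
        ms (fun c => a.X (src * μ.B + c)) (s * μ.B) (min (s + k * ell) L * μ.B) →
      (∀ c c', s * μ.B ≤ c → c ≤ c' → c' < min (s + k * ell) L * μ.B →
        b.X (dst * μ.B + c) ≤ b.X (dst * μ.B + c')) →
      (∀ c, (c < (dst + s) * μ.B ∨ (dst + min (s + k * ell) L) * μ.B ≤ c) → b.X c = a.X c) →
      b.t ≤ a.t + 3 * (min (s + k * ell) L - s) → Q b) :
    wp μ mergeGroup Q a := by
  have hmem := P.mem
  have hw := P.word
  have hk := P.k_two
  have hB := P.B_pos
  have hl1 : 1 ≤ ell := hm.ell_pos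
  have hs : s < L := hm.s_lt
  have hkl : k * ell ≤ k * L := Nat.mul_le_mul_left _ hell
  have hkl2 : k ≤ k * ell := Nat.le_mul_of_pos_right _ hl1
  have hLk : L ≤ k * L := Nat.le_mul_of_pos_left _ (by omega)
  refine wp_seq (wp_loadRuns P hv hs (by omega) hl1 hm.lt_inf ?_)
  intro b b1 b2 b3 b4
  have hb16 : b.V 16 = k := by rw [b1 _ (by norm_num) (by norm_num), hv.v16]
  have bbuf : ∀ x < k * μ.B, b.D x ≤ inf := by
    intro x hx
    obtain ⟨i, y, hi, hy, rfl⟩ : ∃ i y, i < k ∧ y < μ.B ∧ i * μ.B + y = x :=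
      ⟨x / μ.B, x % μ.B, Nat.div_lt_of_lt_mul (by rwa [mul_comm]), Nat.mod_lt _ hB,
        Nat.div_add_mod' _ _⟩
    by_cases hL : s + i * ell < L
    · rw [b4.data i y hi hL hy]
      exact (hm.lt_inf _ (mul_add_lt_mul hL hy)).le
    · rw [b4.fill i y hi (by omega) hy]
  refine wp_seq (wp_memSort (N := k * μ.B) (by omega) (by omega) ?_ ?_ ?_)
  · intro d hd
    exact eval_bufEnd (by rw [hd _ (by norm_num), hb16])
  · intro x hx
    have := bbuf x hx
    omega
  intro c c1 c2 c3 c4 c5 c6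
  have hvc : Vars L k inf src dst s ell c :=
    hv.of_eq fun x hx hx' => by rw [c1 x (by omega), b1 x (by omega) hx']
  have heval : ∀ d : Conf, Vars L k inf src dst s ell d →
      (Expr.add (var 6) (.mul (var 16) (var 8))).eval μ (d.st μ.M) = s + k * ell := fun d hd => by
    rw [eval_add, eval_mul, eval_var (by norm_num), eval_var (by norm_num),
      eval_var (by norm_num), hd.v6, hd.v16, hd.v8]
  -- The initial reads do not outnumber the blocks of the group, even for the last, incomplete
  -- group.
  have hse : s + min k (L - s) ≤ min (s + k * ell) L := by omega
  refine wp_seq (wp_assign (by norm_num) (x := s) (by rw [eval_var (by norm_num), hvc.v6])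
    (by omega) ?_)
  refine wp_seq (wp_while (fun d => ∃ o ≤ min (s + k * ell) L,
    MergeState μ k inf a.X src dst s ell L b.t o d ∧ ∀ x, 6 ≤ x → x ≠ 7 → d.V x = a.V x)
    (fun d => L - d.V 5) ?_ ?_ ?_)
  · have hfr : ∀ x, 6 ≤ x → x ≠ 7 → Function.update c.V 5 s x = a.V x := by
      intro x hx hx'
      rw [Function.update_of_ne (by omega), c1 x (by omega), b1 x (by omega) hx']
    refine ⟨s, by omega, ⟨?_, hv.of_eq hfr, by simp, le_rfl, ?_, ?_, by simp only; omega⟩, hfr⟩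
    · refine MergeData.Inv.init hm (buf' := b.D) b4.data b4.fill c5 c6 ?_ ?_
      · intro i hi
        simp only
        rw [c4 _ (by omega)]
        exact b4.ptr i hi
      · intro i hi
        simp only
        rw [c4 _ (by omega), c4 _ (by omega)]
        exact b4.key i hi
    · intro x hx
      have : c.D x ∈ ms c.D 0 (k * μ.B) := mem_ms.2 ⟨x, Nat.zero_le _, hx, rfl⟩
      rw [c6, mem_ms] at this
      obtain ⟨y, -, hy, hy'⟩ := this
      simp only
      rw [← hy']
      exact bbuf y hy
    · intro x _
      simp only
      rw [c2, b2]
  · rintro d ⟨o, ho, hd, hfr⟩ hcond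
    have hlt : o < min (s + k * ell) L := by
      rw [eval_mul, eval_lt, eval_lt, heval d hd.vars, eval_var (by norm_num),
        eval_var (by norm_num), hd.vars.v15, hd.v5] at hcond
      rw [lt_min_iff]
      by_contra h
      rw [not_and_or] at h
      rcases h with h | h <;> simp [h] at hcond
    refine wp_mergeStep P hm hsd hd (by omega) ?_
    intro d' h1 h2
    refine ⟨⟨o + 1, hlt, h1, fun x hx hx' => by rw [h2 x hx hx', hfr x hx hx']⟩, ?_⟩
    rw [h1.v5, hd.v5]
    omega
  · rintro d ⟨o, ho, hd, hfr⟩ hcond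
    have hoe : o = min (s + k * ell) L := by
      rw [eval_mul, eval_lt, eval_lt, heval d hd.vars, eval_var (by norm_num),
        eval_var (by norm_num), hd.vars.v15, hd.v5] at hcond
      by_contra hne
      have h1 : o < s + k * ell := by omega
      have h2 : o < L := by omega
      simp [h1, h2] at hcond
    subst hoe
    refine wp_assign (by norm_num) (x := s + k * ell) (heval d hd.vars) (by omega) ?_
    · have hti := hd.time
      refine hQ _ ?_ ?_ (hd.inv.final hm) hd.inv.out_sorted hd.ext ?_
      · constructor
        · simp
        · simpa using hd.vars.v8
        · simpa using hd.vars.v13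
        · simpa using hd.vars.v14
        · simpa using hd.vars.v15
        · simpa using hd.vars.v16
        · simpa using hd.vars.v17
      · intro x hx
        simp only
        rw [Function.update_of_ne (by omega), hfr x (by omega) (by omega)]
      · simp only
        omega

/-- The invariant counts the completed groups g. The groups write to disjoint ranges, so the sorted
output of earlier groups persists, and the costs 3 per block add up to 3L. -/
lemma wp_mergePass (P : Params μ L k inf) (hsd : src + L ≤ dst ∨ dst + L ≤ src)
    (hsd2 : src ≤ L ∧ dst ≤ L)
    (hv : Vars L k inf src dst s ell a) (hell : ell ≤ L) (hell1 : 1 ≤ ell)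
    (hruns : ell = 1 ∨ RunsSorted μ.B L ell fun c => a.X (src * μ.B + c))
    (hX : ∀ c < L * μ.B, a.X (src * μ.B + c) < inf)
    (hQ : ∀ b : Conf, (∃ s', Vars L k inf dst src s' (ell * k) b) →
      (∀ x, 15 ≤ x → b.V x = a.V x) →
      ms (fun c => b.X (dst * μ.B + c)) 0 (L * μ.B) =
        ms (fun c => a.X (src * μ.B + c)) 0 (L * μ.B) →
      RunsSorted μ.B L (ell * k) (fun c => b.X (dst * μ.B + c)) →
      (∀ c, (c < dst * μ.B ∨ (dst + L) * μ.B ≤ c) → b.X c = a.X c) →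
      b.t ≤ a.t + 3 * L → Q b) :
    wp μ mergePass Q a := by
  have hw := P.word
  have hk := P.k_two
  have hB := P.B_pos
  have hLk : L ≤ k * L := Nat.le_mul_of_pos_left _ (by omega)
  have hlk : ell * k ≤ k * L := by rw [mul_comm]; exact Nat.mul_le_mul_left _ hell
  refine wp_seq (wp_assign (by norm_num) (eval_const _ _) (by omega) ?_)
  refine wp_seq (wp_while (fun b => ∃ g, Vars L k inf src dst (g * (k * ell)) ell b ∧
    (∀ x, 15 ≤ x → b.V x = a.V x) ∧
    ms (fun c => b.X (dst * μ.B + c)) 0 (min (g * (k * ell)) L * μ.B) =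
      ms (fun c => a.X (src * μ.B + c)) 0 (min (g * (k * ell)) L * μ.B) ∧
    (∀ r < g, ∀ c c', r * (k * ell) * μ.B ≤ c → c ≤ c' →
      c' < min ((r + 1) * (k * ell)) L * μ.B → b.X (dst * μ.B + c) ≤ b.X (dst * μ.B + c')) ∧
    (∀ c, (c < dst * μ.B ∨ (dst + min (g * (k * ell)) L) * μ.B ≤ c) → b.X c = a.X c) ∧
    b.t ≤ a.t + 3 * min (g * (k * ell)) L) (fun b => L - b.V 6) ?_ ?_ ?_)
  · refine ⟨0, ⟨by simp, ?_, ?_, ?_, ?_, ?_, ?_⟩, ?_, ?_, by intros; omega, fun _ _ => rfl,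
      by simp⟩
    · simpa using hv.v8
    · simpa using hv.v13
    · simpa using hv.v14
    · simpa using hv.v15
    · simpa using hv.v16
    · simpa using hv.v17
    · intro x hx
      simp only
      rw [Function.update_of_ne (by omega)]
    · simp [ms_self]
  · rintro b ⟨g, h1, h2, h3, h4, h5, h6⟩ hcond
    set s := g * (k * ell) with hsg
    have hs : s < L := by
      rw [eval_lt, eval_var (by norm_num), eval_var (by norm_num), h1.v6, h1.v15] at hcond
      by_contra h
      simp [h] at hcond
    have hS : ∀ c < L * μ.B, b.X (src * μ.B + c) = a.X (src * μ.B + c) := by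
      intro c hc
      apply h5
      rcases hsd with h | h
      · left
        have := Nat.mul_le_mul_right μ.B h
        rw [add_mul] at this
        omega
      · right
        have := Nat.mul_le_mul_right μ.B (show dst + min s L ≤ src by omega)
        omega
    have hm : (mergeData μ.B k inf b.X src s ell L).Valid := by
      refine ⟨hB, by simp only [mergeData]; omega, hell1, hs, ?_, ?_⟩
      · intro c hc
        exact (hS c hc).trans_lt (hX c hc)
      · rcases hruns with h | h
        · exact .inl h
        · right
          intro i hi c c' hc1 hc2 hc3
          -- Run i of group g is run gk + i of the whole array.
          have e1 : s + i * ell = (g * k + i) * ell := by rw [hsg]; ring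
          have e2 : s + (i + 1) * ell = (g * k + i + 1) * ell := by rw [hsg]; ring
          have hc3' : c' < min ((g * k + i + 1) * ell) L * μ.B := by rw [← e2]; exact hc3
          have hcL : c' < L * μ.B :=
            hc3'.trans_le (Nat.mul_le_mul_right _ (min_le_right _ _))
          have := h (g * k + i) c c' (by rw [← e1]; exact hc1) hc2 hc3'
          change b.X (src * μ.B + c) ≤ b.X (src * μ.B + c')
          rw [hS c (by omega), hS c' hcL]
          exact this
    refine wp_mergeGroup P hm hsd h1 hell ?_
    intro c c1 c2 c3 c4 c5 c6
    have e3 : (g + 1) * (k * ell) = s + k * ell := by rw [hsg]; ring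
    have hkl1 : 1 ≤ k * ell := Nat.mul_pos (by omega) hell1
    have hmin : min s L = s := min_eq_left hs.le
    rw [hmin] at h3 h5 h6
    have hold : ∀ x < s * μ.B, c.X (dst * μ.B + x) = b.X (dst * μ.B + x) := by
      intro x hx
      apply c5
      left
      rw [add_mul]; omega
    refine ⟨⟨g + 1, by rw [e3]; exact c1, fun x hx => by rw [c2 x (by omega), h2 x hx], ?_, ?_, ?_,
      ?_⟩, ?_⟩
    · rw [e3, ms_add (b := s * μ.B) (Nat.zero_le _) (Nat.mul_le_mul_right _ (by omega)), c3]
      rw [ms_add (f := fun c => a.X (src * μ.B + c)) (b := s * μ.B) (Nat.zero_le _)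
        (Nat.mul_le_mul_right _ (by omega)), ← h3]
      congr 1
      · exact ms_congr fun x _ hx => hold x hx
      · refine ms_congr fun x _ hx => hS x (hx.trans_le (Nat.mul_le_mul_right _ (min_le_right _ _)))
    · intro r hr x y hx hxy hy
      rcases Nat.lt_succ_iff_lt_or_eq.1 hr with h | rfl
      · have h7 : (r + 1) * (k * ell) ≤ s := Nat.mul_le_mul_right _ h
        have h8 := Nat.mul_le_mul_right μ.B h7
        have h9 := Nat.mul_le_mul_right μ.B (min_le_left ((r + 1) * (k * ell)) L)
        rw [hold x (by omega), hold y (by omega)]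
        exact h4 r h x y hx hxy hy
      · rw [e3] at hy
        exact c4 x y hx hxy hy
    · rw [e3]
      intro x hx
      rw [c5 x, h5 x]
      · rcases hx with hx | hx
        · exact .inl hx
        · right
          exact (Nat.mul_le_mul_right _ (by omega)).trans hx
      · rcases hx with hx | hx
        · left
          exact hx.trans_le (Nat.mul_le_mul_right _ (by omega))
        · exact .inr hx
    · rw [e3]
      omega
    · rw [h1.v6, c1.v6]
      omega
  · rintro b ⟨g, h1, h2, h3, h4, h5, h6⟩ hcond
    have hge : L ≤ g * (k * ell) := by
      rw [eval_lt, eval_var (by norm_num), eval_var (by norm_num), h1.v6, h1.v15] at hcond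
      by_contra h
      simp [not_le.1 h] at hcond
    rw [min_eq_right hge] at h3 h5 h6
    refine wp_seq (wp_assign (by norm_num) (x := src) (by rw [eval_var (by norm_num), h1.v13])
      (by omega) ?_)
    refine wp_seq (wp_assign (by norm_num) (x := dst)
      (by rw [eval_var (by norm_num)]; simpa using h1.v14) (by omega) ?_)
    refine wp_seq (wp_assign (by norm_num) (x := src)
      (by rw [eval_var (by norm_num)]; simp) (by omega) ?_)
    refine wp_assign (by norm_num) (x := ell * k) ?_ (by omega) ?_
    · rw [eval_mul, eval_var (by norm_num), eval_var (by norm_num)]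
      simp [h1.v8, h1.v16]
    refine hQ _ ⟨g * (k * ell), ?_⟩ ?_ h3 ?_ h5 h6
    · constructor
      · simpa using h1.v6
      · simp
      · simp
      · simp
      · simpa using h1.v15
      · simpa using h1.v16
      · simpa using h1.v17
    · intro x hx
      simp only
      rw [Function.update_of_ne (by omega), Function.update_of_ne (by omega),
        Function.update_of_ne (by omega), Function.update_of_ne (by omega), h2 x hx]
    · intro r c c' hc hcc hc'
      rw [mul_comm ell k] at hc hc'
      refine h4 r ?_ c c' hc hcc hc'
      by_contra hr
      have h7 : g * (k * ell) ≤ r * (k * ell) := Nat.mul_le_mul_right _ (not_lt.1 hr)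
      have h8 := Nat.mul_le_mul_right μ.B (hge.trans h7)
      have h9 := Nat.mul_le_mul_right μ.B (min_le_right ((r + 1) * (k * ell)) L)
      omega

/-- The array that is processed and its twin occupy the first `2 * L` blocks. -/
def Twin (L src dst : ℕ) : Prop := (src = 0 ∧ dst = L) ∨ (src = L ∧ dst = 0)

/-- After j passes the runs have length k^j. A further pass happens only if k^j < L, that is j ≤
log_k L, whence at most 1 + log_k L passes of cost 3L. The array may end up in either twin. -/
lemma wp_mergeSort (P : Params μ L k inf) (hsd : Twin L src dst)
    (h13 : a.V 13 = src) (h14 : a.V 14 = dst) (h15 : a.V 15 = L) (h16 : a.V 16 = k)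
    (h17 : a.V 17 = inf) (hX : ∀ c < L * μ.B, a.X (src * μ.B + c) < inf)
    (hQ : ∀ (b : Conf) (src' dst' : ℕ), Twin L src' dst' → b.V 13 = src' → b.V 14 = dst' →
      (∀ x, 15 ≤ x → b.V x = a.V x) →
      ms (fun c => b.X (src' * μ.B + c)) 0 (L * μ.B) =
        ms (fun c => a.X (src * μ.B + c)) 0 (L * μ.B) →
      (∀ c c', c ≤ c' → c' < L * μ.B → b.X (src' * μ.B + c) ≤ b.X (src' * μ.B + c')) →
      b.t ≤ a.t + 3 * L * (1 + Nat.log k L) → Q b) :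
    wp μ mergeSort Q a := by
  have hw := P.word
  have hk := P.k_two
  have hB := P.B_pos
  have hL := P.L_pos
  refine wp_seq (wp_assign (by norm_num) (eval_const _ _) (by omega) ?_)
  have hstep : ∀ (b : Conf) (S T s ell : ℕ), Twin L S T → Vars L k inf S T s ell b → ell ≤ L →
      1 ≤ ell → (ell = 1 ∨ RunsSorted μ.B L ell fun c => b.X (S * μ.B + c)) →
      (∀ x, 15 ≤ x → b.V x = a.V x) →
      ms (fun c => b.X (S * μ.B + c)) 0 (L * μ.B) =
        ms (fun c => a.X (src * μ.B + c)) 0 (L * μ.B) → ∀ R : Conf → Prop,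
      (∀ c : Conf, (∃ S' T' s', Twin L S' T' ∧ Vars L k inf S' T' s' (ell * k) c ∧
        (∀ x, 15 ≤ x → c.V x = a.V x) ∧ RunsSorted μ.B L (ell * k) (fun x => c.X (S' * μ.B + x)) ∧
        ms (fun x => c.X (S' * μ.B + x)) 0 (L * μ.B) =
          ms (fun c => a.X (src * μ.B + c)) 0 (L * μ.B)) → c.t ≤ b.t + 3 * L → R c) →
      wp μ mergePass R b := by
    intro b S T s ell hST hv h1 h2 h3 h4 h5 R hR
    refine wp_mergePass P ?_ ?_ hv h1 h2 h3 ?_ ?_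
    · rcases hST with ⟨rfl, rfl⟩ | ⟨rfl, rfl⟩ <;> omega
    · rcases hST with ⟨rfl, rfl⟩ | ⟨rfl, rfl⟩ <;> omega
    · intro c hc
      have : b.X (S * μ.B + c) ∈ ms (fun c => b.X (S * μ.B + c)) 0 (L * μ.B) :=
        mem_ms.2 ⟨c, Nat.zero_le _, hc, rfl⟩
      rw [h5, mem_ms] at this
      obtain ⟨y, -, hy, hy'⟩ := this
      rw [← hy']
      exact hX y hy
    · rintro c ⟨s', hc⟩ h6 h7 h8 - h10
      refine hR c ⟨T, S, s', ?_, hc, fun x hx => by rw [h6 x hx, h4 x hx], h8, h7.trans h5⟩ h10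
      rcases hST with ⟨rfl, rfl⟩ | ⟨rfl, rfl⟩
      · exact .inr ⟨rfl, rfl⟩
      · exact .inl ⟨rfl, rfl⟩
  have hv0 : Vars L k inf src dst (a.V 6) 1 { a with V := Function.update a.V 8 1 } := by
    constructor
    · simp
    · simp
    · simpa using h13
    · simpa using h14
    · simpa using h15
    · simpa using h16
    · simpa using h17
  -- The first pass is unconditional: even an array of a single block still has to be sorted
  -- internally.
  refine wp_seq (hstep _ src dst (a.V 6) 1 hsd hv0 hL le_rfl (.inl rfl) (fun x hx => ?_) rfl _ ?_)
  · simp only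
    rw [Function.update_of_ne (by omega)]
  rintro b ⟨S, T, s, h1, h2, h3, h4, h5⟩ h6
  refine wp_while (fun b => ∃ j S T s, Twin L S T ∧ Vars L k inf S T s (k ^ j) b ∧
        (∀ x, 15 ≤ x → b.V x = a.V x) ∧ RunsSorted μ.B L (k ^ j) (fun x => b.X (S * μ.B + x)) ∧
        ms (fun x => b.X (S * μ.B + x)) 0 (L * μ.B) =
          ms (fun c => a.X (src * μ.B + c)) 0 (L * μ.B) ∧ j ≤ 1 + Nat.log k L ∧
        b.t ≤ a.t + 3 * L * j) (fun b => L - b.V 8) ?_ ?_ ?_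
  · refine ⟨1, S, T, s, h1, ?_, h3, ?_, h5, by omega, by simpa using h6⟩
    · simpa using h2
    · simpa using h4
  · rintro b ⟨j, S, T, s, h1, h2, h3, h4, h5, h6, h7⟩ hcond
    have hlt : k ^ j < L := by
      rw [eval_lt, eval_var (by norm_num), eval_var (by norm_num), h2.v8, h2.v15] at hcond
      by_contra h
      simp [h] at hcond
    refine hstep b S T s (k ^ j) h1 h2 hlt.le (Nat.pow_pos (by omega)) (.inr h4) h3 h5 _ ?_
    rintro c ⟨S', T', s', g1, g2, g3, g4, g5⟩ g6
    rw [← pow_succ] at g2 g4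
    refine ⟨⟨j + 1, S', T', s', g1, g2, g3, g4, g5, ?_, ?_⟩, ?_⟩
    · have := Nat.le_log_of_pow_le (by omega) hlt.le
      omega
    · rw [mul_add, mul_one]; omega
    · rw [g2.v8, h2.v8]
      have : k ^ j < k ^ (j + 1) := Nat.pow_lt_pow_right (by omega) (by omega)
      omega
  · rintro b ⟨j, S, T, s, h1, h2, h3, h4, h5, h6, h7⟩ hcond
    have hge : L ≤ k ^ j := by
      rw [eval_lt, eval_var (by norm_num), eval_var (by norm_num), h2.v8, h2.v15] at hcond
      by_contra h
      simp [not_le.1 h] at hcond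
    refine hQ b S T h1 h2.v13 h2.v14 h3 h5 ?_ (h7.trans ?_)
    · intro c c' hc hc'
      refine h4 0 c c' (by simp) hc ?_
      rwa [zero_add, one_mul, min_eq_right hge]
    · have := Nat.mul_le_mul_left (3 * L) h6
      omega

end
end ExtMem
namespace ExtMem

/-! ### Scans -/

/-- Apply `body` to all words of the current array.  Variable 11 holds the position and variable 12
the word. -/
def scan (body : Program) : Program :=
  forLoop 9 (var 15)
    (.seq (.read (.const 0) (.add (var 13) (var 9)))
      (.seq (forLoop 10 .blockSize
        (.seq (assign 11 (.add (.mul (var 9) .blockSize) (var 10)))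
          (.seq (assign 12 (cell (var 10))) (.seq body (.store (var 10) (var 12))))))
        (.write (.const 0) (.add (var 13) (var 9)))))

/-- The variables that a scan with the result variables `lo, …, hi - 1` leaves alone. -/
def Fixed (lo hi x : ℕ) : Prop := 13 ≤ x ∧ (x < 20 ∨ 28 ≤ x) ∧ (x < lo ∨ hi ≤ x)

section
variable {μ : Machine} [hμ : Fact (μ.extra = extraWords)] {Q : Conf → Prop} {a : Conf}
  {L k inf src : ℕ}

/-- `G` is the array of new words and `J p` an invariant at position p that depends only on
variables from 20 on, so that it survives the bookkeeping of the loops. The body may use 20 to 27 as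
scratch and `lo` to `hi - 1` for results. Every block is read and written once. -/
lemma wp_scan (P : Params μ L k inf) {body : Program} (lo hi : ℕ) (hlo : 20 ≤ lo)
    (G : ℕ → ℕ) (J : ℕ → (ℕ → ℕ) → Prop)
    (hcongr : ∀ p V V', (∀ x, 20 ≤ x → V' x = V x) → J p V → J p V')
    (h13 : a.V 13 = src) (h15 : a.V 15 = L) (hLW : L * μ.B < μ.W)
    (hA : ∀ c < L * μ.B, a.X (src * μ.B + c) < μ.W) (hJ0 : J 0 a.V)
    (hbody : ∀ p b, p < L * μ.B → b.V 11 = p → b.V 12 = a.X (src * μ.B + p) →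
      (∀ x, Fixed lo hi x → b.V x = a.V x) → J p b.V →
      wp μ body (fun c => c.D = b.D ∧ c.X = b.X ∧ c.t = b.t ∧
        (∀ x, 9 ≤ x → x ≤ 11 → c.V x = b.V x) ∧ (∀ x, Fixed lo hi x → c.V x = b.V x) ∧
        c.V 12 = G p ∧ G p < μ.W ∧ J (p + 1) c.V) b)
    (hQ : ∀ b : Conf, (∀ x, Fixed lo hi x → b.V x = a.V x) → J (L * μ.B) b.V →
      (∀ c < L * μ.B, b.X (src * μ.B + c) = G c) →
      (∀ c, (c < src * μ.B ∨ (src + L) * μ.B ≤ c) → b.X c = a.X c) →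
      b.t = a.t + 2 * L → Q b) :
    wp μ (scan body) Q a := by
  have hw := P.word
  have hB := P.B_pos
  have hk := P.k_two
  have hmem := P.mem
  have hkB : μ.B ≤ k * μ.B := Nat.le_mul_of_pos_left _ (by omega)
  have fix13 : Fixed lo hi 13 := ⟨le_rfl, by norm_num, by omega⟩
  have fix15 : Fixed lo hi 15 := ⟨by norm_num, by norm_num, by omega⟩
  have hfix : ∀ x, Fixed lo hi x → 13 ≤ x := fun x h => h.1
  -- the state before block `j`
  let H : ℕ → Conf → Prop := fun j b => (∀ x, Fixed lo hi x → b.V x = a.V x) ∧ b.V 9 = j ∧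
    (∀ c < j * μ.B, b.X (src * μ.B + c) = G c) ∧
    (∀ c, (c < src * μ.B ∨ (src + j) * μ.B ≤ c) → b.X c = a.X c) ∧ b.t = a.t + 2 * j
  refine wp_for L (fun j b => H j b ∧ J (j * μ.B) b.V) (by norm_num) (by omega) ?_ ?_ ?_ ?_
  · refine ⟨⟨fun x hx => ?_, by simp, by intro c hc; omega, fun _ _ => rfl, rfl⟩, ?_⟩
    · have := hfix x hx
      simp only
      rw [Function.update_of_ne (by omega)]
    · rw [zero_mul]
      exact hcongr 0 _ _ (fun x hx => Function.update_of_ne (by omega) _ _) hJ0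
  · rintro j b - ⟨⟨h1, h2, -⟩, -⟩
    exact ⟨h2, by rw [eval_var (by norm_num), h1 15 fix15, h15]⟩
  · rintro j b hj ⟨⟨h1, h2, h3, h4, h5⟩, h6⟩
    have hjL : j * μ.B + μ.B ≤ L * μ.B := by
      have := Nat.mul_le_mul_right μ.B (Nat.succ_le_of_lt hj)
      rwa [Nat.succ_mul] at this
    have eblk : ∀ c : Conf, c.V 9 = j → c.V 13 = src →
        (Expr.add (var 13) (var 9)).eval μ (c.st μ.M) = src + j := fun c hc hc' => by
      rw [eval_add, eval_var (by norm_num), eval_var (by norm_num), hc, hc']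
    refine wp_seq (wp_read (y := 0) (x := src + j) rfl (eblk b h2 (by rw [h1 13 fix13, h13]))
      (by omega) ?_)
    simp only [zero_le, true_and, zero_add, tsub_zero]
    refine wp_seq (wp_for μ.B (fun i c => (∀ x, Fixed lo hi x → c.V x = a.V x) ∧ c.V 9 = j ∧
      c.V 10 = i ∧ c.X = b.X ∧ c.t = b.t + 1 ∧ J (j * μ.B + i) c.V ∧
      (∀ x < i, c.D x = G (j * μ.B + x)) ∧
      (∀ x, i ≤ x → x < μ.B → c.D x = a.X (src * μ.B + (j * μ.B + x))))
      (by norm_num) (by omega) ?_ ?_ ?_ ?_)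
    · refine ⟨fun x hx => ?_, by simpa using h2, by simp, rfl, rfl, ?_, by intros; omega, ?_⟩
      · have := hfix x hx
        simp only
        rw [Function.update_of_ne (by omega), h1 x hx]
      · exact hcongr _ _ _ (fun x hx => Function.update_of_ne (by omega) _ _) h6
      · intro x _ hx
        simp only
        rw [if_pos hx, h4 _ (.inr (by omega))]
        congr 1; ring
    · rintro i c - ⟨g1, g2, g3, -⟩
      exact ⟨g3, rfl⟩
    · rintro i c hi' ⟨g1, g2, g3, g4, g5, g6, g7, g8⟩
      have hpL : j * μ.B + i < L * μ.B := by omega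
      refine wp_seq (wp_assign (by norm_num) (x := j * μ.B + i) ?_ (by omega) ?_)
      · rw [eval_add, eval_mul, eval_var (by norm_num), eval_var (by norm_num), g2, g3]; rfl
      refine wp_seq (wp_assign (by norm_num) (x := a.X (src * μ.B + (j * μ.B + i))) ?_
        (hA _ hpL) ?_)
      · rw [eval_cell (x := i) _ ?_ (by omega)]
        · exact g8 i le_rfl hi'
        · rw [eval_var (by norm_num)]; simpa using g3
      refine wp_seq (wp_mono (hbody (j * μ.B + i) _ hpL (by simp) (by simp) ?_ ?_) ?_)
      · intro x hx
        have := hfix x hx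
        simp only
        rw [Function.update_of_ne (by omega), Function.update_of_ne (by omega), g1 x hx]
      · refine hcongr _ c.V _ (fun x hx => ?_) g6
        simp only
        rw [Function.update_of_ne (by omega), Function.update_of_ne (by omega)]
      rintro d ⟨d1, d2, d3, d4, d5, d6, d7, d8⟩
      simp only at d1 d2 d3 d4 d5
      have hd9 : d.V 9 = j := by
        rw [d4 9 (by norm_num) (by norm_num)]
        simpa using g2
      have hd10 : d.V 10 = i := by
        rw [d4 10 (by norm_num) (by norm_num)]
        simpa using g3
      refine wp_store (y := i) (x := G (j * μ.B + i)) (by rw [eval_var (by norm_num), hd10])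
        (by rw [eval_var (by norm_num), d6]) (by omega) d7 ?_
      refine ⟨hd10, fun x hx => ?_, by simpa using hd9, by simp, by rw [d2, g4], by rw [d3, g5], ?_,
        ?_, ?_⟩
      · have := hfix x hx
        simp only
        rw [Function.update_of_ne (by omega), d5 x hx, Function.update_of_ne (by omega),
          Function.update_of_ne (by omega), g1 x hx]
      · exact hcongr _ _ _ (fun x hx => Function.update_of_ne (by omega) _ _) d8
      · intro x hx
        simp only [Function.update_apply]
        split_ifs with h
        · rw [h]
        · rw [d1]; exact g7 x (by omega)
      · intro x hx hx'
        simp only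
        rw [Function.update_of_ne (by omega), d1]
        exact g8 x (by omega) hx'
    · rintro c ⟨g1, g2, g3, g4, g5, g6, g7, -⟩
      refine wp_write (y := 0) (x := src + j) rfl (eblk c g2 (by rw [g1 13 fix13, h13]))
        (by omega) ?_
      simp only [zero_add]
      have e1 : (src + j) * μ.B = src * μ.B + j * μ.B := by ring
      have e2 : (j + 1) * μ.B = j * μ.B + μ.B := by ring
      have e3 : (src + (j + 1)) * μ.B = src * μ.B + j * μ.B + μ.B := by ring
      refine ⟨g2, ⟨fun x hx => ?_, by simp, ?_, ?_, by simp only; omega⟩, ?_⟩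
      · have := hfix x hx
        simp only
        rw [Function.update_of_ne (by omega), g1 x hx]
      · intro x hx
        simp only
        rw [e1]
        by_cases h : x < j * μ.B
        · rw [if_neg (by omega), g4, h3 x h]
        · rw [if_pos (by omega), g7 _ (by omega)]
          congr 1; omega
      · intro x hx
        simp only
        rw [e1]
        rw [e3] at hx
        rw [if_neg (by omega), g4, h4 x (by omega)]
      · rw [e2]
        exact hcongr _ _ _ (fun x hx => Function.update_of_ne (by omega) _ _) g6
  · rintro b ⟨⟨h1, h2, h3, h4, h5⟩, h6⟩
    exact hQ b h1 h6 h3 h4 h5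

end

/-! ### Words made of four digits -/

/-- The word with the given digits in base `K`. -/
def enc (K a b c d : ℕ) : ℕ := ((a * K + b) * K + c) * K + d

lemma digit_inj {K x y a b : ℕ} (hx : x < K) (hy : y < K) (h : a * K + x = b * K + y) :
    a = b ∧ x = y := by
  have hK : 0 < K := by omega
  have h1 := congrArg (· / K) h
  have h2 := congrArg (· % K) h
  simp only [Nat.mul_add_mod_of_lt hx, Nat.mul_add_mod_of_lt hy] at h2
  simp only [Nat.add_div_of_dvd_right (dvd_mul_left K _), Nat.mul_div_cancel _ hK,
    Nat.div_eq_of_lt hx, Nat.div_eq_of_lt hy, add_zero] at h1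
  exact ⟨h1, h2⟩

lemma digit_le {K x y a b : ℕ} (hx : x < K) (hy : y < K) :
    a * K + x ≤ b * K + y ↔ a < b ∨ (a = b ∧ x ≤ y) := by
  constructor
  · intro h
    rcases lt_trichotomy a b with h1 | h1 | h1
    · exact .inl h1
    · subst h1
      exact .inr ⟨rfl, by omega⟩
    · have := Nat.mul_le_mul_right K (Nat.succ_le_of_lt h1)
      rw [Nat.succ_mul] at this
      omega
  · rintro (h | ⟨rfl, h⟩)
    · have := Nat.mul_le_mul_right K (Nat.succ_le_of_lt h)
      rw [Nat.succ_mul] at this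
      omega
    · omega

lemma enc_inj {K a b c d a' b' c' d' : ℕ} (hb : b < K) (hc : c < K) (hd : d < K) (hb' : b' < K)
    (hc' : c' < K) (hd' : d' < K) (h : enc K a b c d = enc K a' b' c' d') :
    a = a' ∧ b = b' ∧ c = c' ∧ d = d' := by
  obtain ⟨h1, h2⟩ := digit_inj hd hd' h
  obtain ⟨h3, h4⟩ := digit_inj hc hc' h1
  obtain ⟨h5, h6⟩ := digit_inj hb hb' h3
  exact ⟨h5, h6, h4, h2⟩

/-- Positional notation: the order of words is the lexicographic order of their digits. The leading
digit needs no bound. -/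
lemma enc_le {K a b c d a' b' c' d' : ℕ} (hb : b < K) (hc : c < K) (hd : d < K) (hb' : b' < K)
    (hc' : c' < K) (hd' : d' < K) : enc K a b c d ≤ enc K a' b' c' d' ↔
      a < a' ∨ a = a' ∧ (b < b' ∨ b = b' ∧ (c < c' ∨ c = c' ∧ d ≤ d')) := by
  rw [enc, enc, digit_le hd hd']
  have h1 := digit_le (a := a) (b := a') hb hb'
  have h2 := digit_le (a := a * K + b) (b := a' * K + b') hc hc'
  constructor
  · rintro (h | ⟨h, h'⟩)
    · have h3 := h.le
      rw [h2] at h3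
      rcases h3 with h3 | ⟨h3, h4⟩
      · have h5 := h3.le
        rw [h1] at h5
        rcases h5 with h5 | ⟨rfl, h5⟩ <;> omega
      · obtain ⟨rfl, rfl⟩ := digit_inj hb hb' h3
        omega
    · obtain ⟨h3, rfl⟩ := digit_inj hc hc' h
      obtain ⟨rfl, rfl⟩ := digit_inj hb hb' h3
      omega
  · intro h
    by_cases h3 : a = a' ∧ b = b' ∧ c = c'
    · obtain ⟨rfl, rfl, rfl⟩ := h3
      right; omega
    · left
      refine lt_of_le_of_ne ?_ ?_
      · rw [h2]
        by_cases h4 : a = a' ∧ b = b'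
        · obtain ⟨rfl, rfl⟩ := h4
          right; omega
        · left
          refine lt_of_le_of_ne ?_ ?_
          · rw [h1]; omega
          · intro h5
            exact h4 (digit_inj hb hb' h5)
      · intro h5
        obtain ⟨h6, rfl⟩ := digit_inj hc hc' h5
        obtain ⟨rfl, rfl⟩ := digit_inj hb hb' h6
        exact h3 ⟨rfl, rfl, rfl⟩

lemma enc_lt {K a b c d : ℕ} (ha : a < K) (hb : b < K) (hc : c < K) (hd : d < K) :
    enc K a b c d < K * K * K * K := by
  have h1 : a * K + b < K * K := mul_add_lt_mul ha hb
  have h2 : (a * K + b) * K + c < K * K * K := mul_add_lt_mul h1 hc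
  exact mul_add_lt_mul h2 hd

/-- The expression for a word with given digits. -/
def encE (a b c d : Expr) : Expr :=
  .add (.mul (.add (.mul (.add (.mul a (var 18)) b) (var 18)) c) (var 18)) d

/-- Put the digits of the current word into the variables 20, 21, 22 and 23. -/
def decode : Program :=
  .seq (assign 23 (.mod (var 12) (var 18))) (.seq (assign 20 (.div (var 12) (var 18)))
    (.seq (assign 22 (.mod (var 20) (var 18))) (.seq (assign 20 (.div (var 20) (var 18)))
      (.seq (assign 21 (.mod (var 20) (var 18))) (assign 20 (.div (var 20) (var 18)))))))

section
variable {μ : Machine} [hμ : Fact (μ.extra = extraWords)] {Q : Conf → Prop} {a : Conf}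

lemma eval_encE {K x y z w : ℕ} {e f g h : Expr} (hK : a.V 18 = K)
    (he : e.eval μ (a.st μ.M) = x) (hf : f.eval μ (a.st μ.M) = y) (hg : g.eval μ (a.st μ.M) = z)
    (hh : h.eval μ (a.st μ.M) = w) : (encE e f g h).eval μ (a.st μ.M) = enc K x y z w := by
  simp only [encE, eval_add, eval_mul, he, hf, hg, hh]
  rw [eval_var (by norm_num), hK, enc]

/-- Digits are split off from the right. All intermediate quotients are bounded by the word itself,
so none of them overflows. -/
lemma wp_decode {K x y z w : ℕ} (hK : a.V 18 = K) (ha : a.V 12 = enc K x y z w) (hy : y < K)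
    (hz : z < K) (hw : w < K) (hW : enc K x y z w < μ.W)
    (hQ : ∀ b : Conf, b.D = a.D → b.X = a.X → b.t = a.t →
      (∀ i, i < 20 ∨ 24 ≤ i → b.V i = a.V i) → b.V 20 = x → b.V 21 = y → b.V 22 = z → b.V 23 = w →
      Q b) : wp μ decode Q a := by
  have hK0 : 0 < K := by omega
  have hle1 : (x * K + y) * K + z ≤ enc K x y z w :=
    (Nat.le_mul_of_pos_right _ hK0).trans (Nat.le_add_right _ _)
  have hle2 : x * K + y ≤ (x * K + y) * K + z :=
    (Nat.le_mul_of_pos_right _ hK0).trans (Nat.le_add_right _ _)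
  have hle3 : x ≤ x * K + y := (Nat.le_mul_of_pos_right _ hK0).trans (Nat.le_add_right _ _)
  have hd : ∀ s r, r < K → (s * K + r) / K = s ∧ (s * K + r) % K = r := fun s r hr =>
    ⟨by rw [Nat.add_div_of_dvd_right (dvd_mul_left K _), Nat.mul_div_cancel _ hK0,
      Nat.div_eq_of_lt hr, add_zero], Nat.mul_add_mod_of_lt hr⟩
  obtain ⟨p1, p2⟩ := hd ((x * K + y) * K + z) w hw
  obtain ⟨p3, p4⟩ := hd (x * K + y) z hz
  obtain ⟨p5, p6⟩ := hd x y hy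
  have hlow : w ≤ enc K x y z w := Nat.le_add_left _ _
  have hlow2 : z ≤ (x * K + y) * K + z := Nat.le_add_left _ _
  have hlow3 : y ≤ x * K + y := Nat.le_add_left _ _
  refine wp_seq (wp_assign (by norm_num) (x := w) ?_ (by omega) ?_)
  · rw [eval_mod, eval_var (by norm_num), eval_var (by norm_num), hK, ha]; exact p2
  refine wp_seq (wp_assign (by norm_num) (x := (x * K + y) * K + z) ?_ (by omega) ?_)
  · rw [eval_div, eval_var (by norm_num), eval_var (by norm_num)]
    simp only [Function.update_apply, Nat.reduceEqDiff, if_false]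
    rw [hK, ha]; exact p1
  refine wp_seq (wp_assign (by norm_num) (x := z) ?_ (by omega) ?_)
  · rw [eval_mod, eval_var (by norm_num), eval_var (by norm_num)]
    simp only [Function.update_apply, Nat.reduceEqDiff, if_false, if_true]
    rw [hK]; exact p4
  refine wp_seq (wp_assign (by norm_num) (x := x * K + y) ?_ (by omega) ?_)
  · rw [eval_div, eval_var (by norm_num), eval_var (by norm_num)]
    simp only [Function.update_apply, Nat.reduceEqDiff, if_false, if_true]
    rw [hK]; exact p3
  refine wp_seq (wp_assign (by norm_num) (x := y) ?_ (by omega) ?_)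
  · rw [eval_mod, eval_var (by norm_num), eval_var (by norm_num)]
    simp only [Function.update_apply, Nat.reduceEqDiff, if_false, if_true]
    rw [hK]; exact p6
  refine wp_assign (by norm_num) (x := x) ?_ (by omega) ?_
  · rw [eval_div, eval_var (by norm_num), eval_var (by norm_num)]
    simp only [Function.update_apply, Nat.reduceEqDiff, if_false, if_true]
    rw [hK]; exact p5
  refine hQ _ rfl rfl rfl ?_ (by simp) (by simp) (by simp) (by simp)
  intro i hi
  simp only
  rw [Function.update_of_ne (by omega), Function.update_of_ne (by omega),
    Function.update_of_ne (by omega), Function.update_of_ne (by omega),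
    Function.update_of_ne (by omega), Function.update_of_ne (by omega)]

end
end ExtMem
namespace ExtMem

/-! ### Arrays that hold the edges of a graph -/

/-- The nonzero words of the array `A` of length `N` are the words `φ u v` for edges `u v`. -/
structure Holds (adj : ℕ → ℕ → Prop) (N : ℕ) (A : ℕ → ℕ) (φ : ℕ → ℕ → ℕ) : Prop where
  sound : ∀ p < N, A p ≠ 0 → ∃ u v, adj u v ∧ A p = φ u v
  complete : ∀ u v, adj u v → ∃ p < N, A p = φ u v

/-- `A` is sorted. -/
def SortedArr (N : ℕ) (A : ℕ → ℕ) : Prop := ∀ c c', c ≤ c' → c' < N → A c ≤ A c'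

/-- A word function for edges that has its digits in base `K`. -/
structure Digits (adj : ℕ → ℕ → Prop) (K : ℕ) (φ d0 d1 d2 d3 : ℕ → ℕ → ℕ) : Prop where
  eq : ∀ u v, φ u v = enc K (d0 u v) (d1 u v) (d2 u v) (d3 u v)
  lt0 : ∀ u v, adj u v → d0 u v < K
  lt1 : ∀ u v, adj u v → d1 u v < K
  lt2 : ∀ u v, adj u v → d2 u v < K
  lt3 : ∀ u v, adj u v → d3 u v < K
  pos : ∀ u v, adj u v → 0 < φ u v
  inj : ∀ u v u' v', adj u v → adj u' v' → φ u v = φ u' v' → u = u' ∧ v = v'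

lemma Digits.lt {adj : ℕ → ℕ → Prop} {K : ℕ} {φ d0 d1 d2 d3 : ℕ → ℕ → ℕ}
    (h : Digits adj K φ d0 d1 d2 d3) {u v : ℕ} (huv : adj u v) : φ u v < K * K * K * K := by
  rw [h.eq]
  exact enc_lt (h.lt0 u v huv) (h.lt1 u v huv) (h.lt2 u v huv) (h.lt3 u v huv)

/-- A nonzero word determines its edge, so re-encoding edges is a well-defined operation on words;
positivity keeps edge words apart from the padding by zeros. -/
lemma Holds.map {adj : ℕ → ℕ → Prop} {N : ℕ} {A : ℕ → ℕ} {φ φ' : ℕ → ℕ → ℕ}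
    (h : Holds adj N A φ) (hpos : ∀ u v, adj u v → 0 < φ u v)
    (hinj : ∀ u v u' v', adj u v → adj u' v' → φ u v = φ u' v' → u = u' ∧ v = v') :
    ∃ G : ℕ → ℕ, (∀ p < N, A p = 0 → G p = 0) ∧
      (∀ p < N, ∀ u v, adj u v → A p = φ u v → G p = φ' u v) ∧ Holds adj N G φ' := by
  classical
  have h1 : ∀ p, ∃ y, (p < N → A p = 0 → y = 0) ∧
      (p < N → ∀ u v, adj u v → A p = φ u v → y = φ' u v) := by
    intro p
    by_cases hp : p < N ∧ A p ≠ 0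
    · obtain ⟨u, v, huv, he⟩ := h.sound p hp.1 hp.2
      refine ⟨φ' u v, fun _ h0 => absurd h0 hp.2, fun _ u' v' huv' he' => ?_⟩
      obtain ⟨rfl, rfl⟩ := hinj u v u' v' huv huv' (he.symm.trans he')
      rfl
    · refine ⟨0, fun _ _ => rfl, fun hp1 u v huv he => ?_⟩
      have := hpos u v huv
      exact absurd ⟨hp1, by omega⟩ hp
  choose G hG1 hG2 using h1
  refine ⟨G, hG1, hG2, ⟨?_, ?_⟩⟩
  · intro p hp hne
    have : A p ≠ 0 := fun h0 => hne (hG1 p hp h0)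
    obtain ⟨u, v, huv, he⟩ := h.sound p hp this
    exact ⟨u, v, huv, hG2 p hp u v huv he⟩
  · intro u v huv
    obtain ⟨p, hp, he⟩ := h.complete u v huv
    exact ⟨p, hp, hG2 p hp u v huv he⟩

/-- Only the set of words matters. Multiplicities are not recorded, so the later passes must
tolerate repeated words. -/
lemma Holds.congr {adj : ℕ → ℕ → Prop} {N : ℕ} {A A' : ℕ → ℕ} {φ : ℕ → ℕ → ℕ}
    (h : Holds adj N A φ) (hA : ∀ y, (∃ p < N, A' p = y) ↔ ∃ p < N, A p = y) :
    Holds adj N A' φ := by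
  constructor
  · intro p hp hne
    obtain ⟨q, hq, he⟩ := (hA (A' p)).1 ⟨p, hp, rfl⟩
    obtain ⟨u, v, huv, h1⟩ := h.sound q hq (by omega)
    exact ⟨u, v, huv, by omega⟩
  · intro u v huv
    exact (hA _).2 (h.complete u v huv)

/-- The configuration `c` arises from `b` in the body of a scan. -/
structure Kept (lo hi : ℕ) (b c : Conf) : Prop where
  D : c.D = b.D
  X : c.X = b.X
  t : c.t = b.t
  V : ∀ x, 9 ≤ x ∧ x ≤ 11 ∨ Fixed lo hi x → c.V x = b.V x

lemma Kept.refl (lo hi : ℕ) (b : Conf) : Kept lo hi b b := ⟨rfl, rfl, rfl, fun _ _ => rfl⟩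

/-- The variables that the program keeps at all times, with array and twin at `src` and `dst`. -/
structure Ready (L k inf K n src dst : ℕ) (b : Conf) : Prop where
  twin : Twin L src dst
  v13 : b.V 13 = src
  v14 : b.V 14 = dst
  v15 : b.V 15 = L
  v16 : b.V 16 = k
  v17 : b.V 17 = inf
  v18 : b.V 18 = K
  v19 : b.V 19 = n

/-- Scan an array of edges: the body is applied to all nonzero words after their digits have been
put into the variables 20, 21, 22 and 23. -/
def edgeScan (body : Program) : Program :=
  scan (.ite (.lt (.const 0) (var 12)) (.seq decode body) .skip)

/-- The cells of the array that starts at block `src`. -/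
def arr (μ : Machine) (src : ℕ) (b : Conf) (c : ℕ) : ℕ := b.X (src * μ.B + c)

section
variable {μ : Machine} [hμ : Fact (μ.extra = extraWords)] {Q : Conf → Prop} {a : Conf}
  {L k inf K n src dst : ℕ} {adj : ℕ → ℕ → Prop}

lemma Ready.of_eq {b : Conf} (h : Ready L k inf K n src dst a)
    (hb : ∀ x, 13 ≤ x → x < 20 → b.V x = a.V x) : Ready L k inf K n src dst b := by
  refine ⟨h.twin, ?_, ?_, ?_, ?_, ?_, ?_, ?_⟩ <;> rw [hb _ (by norm_num) (by norm_num)]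
  exacts [h.v13, h.v14, h.v15, h.v16, h.v17, h.v18, h.v19]

/-- The invariant `J` may depend on the variables from 24 on only, since decoding overwrites 20 to
23. The last fact passed to `hQ` lets a scan that leaves the words alone be followed by another scan
without sorting again. -/
lemma wp_edgeScan (P : Params μ L k inf) (hinf : K * K * K * K = inf) (hLW : L * μ.B < μ.W)
    {body : Program} (lo hi : ℕ) (hlo : 20 ≤ lo)
    {φ d0 d1 d2 d3 φ' e0 e1 e2 e3 : ℕ → ℕ → ℕ}
    (hφ : Digits adj K φ d0 d1 d2 d3) (hφ' : Digits adj K φ' e0 e1 e2 e3)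
    (hr : Ready L k inf K n src dst a) (hh : Holds adj (L * μ.B) (arr μ src a) φ)
    (J : ℕ → (ℕ → ℕ) → Prop)
    (hcongr : ∀ p V V', (∀ x, 24 ≤ x → V' x = V x) → J p V → J p V')
    (hJ0 : J 0 a.V) (hzero : ∀ p V, p < L * μ.B → arr μ src a p = 0 → J p V → J (p + 1) V)
    (hbody : ∀ p b u v, p < L * μ.B → adj u v → arr μ src a p = φ u v → b.V 12 = φ u v →
      b.V 20 = d0 u v → b.V 21 = d1 u v → b.V 22 = d2 u v → b.V 23 = d3 u v →
      (∀ x, Fixed lo hi x → b.V x = a.V x) → J p b.V →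
      wp μ body (fun c => Kept lo hi b c ∧ c.V 12 = φ' u v ∧ J (p + 1) c.V) b)
    (hQ : ∀ b : Conf, Ready L k inf K n src dst b → (∀ x, Fixed lo hi x → b.V x = a.V x) →
      J (L * μ.B) b.V → Holds adj (L * μ.B) (arr μ src b) φ' → b.t = a.t + 2 * L →
      ((∀ u v, φ' u v = φ u v) → SortedArr (L * μ.B) (arr μ src a) →
        SortedArr (L * μ.B) (arr μ src b)) → Q b) :
    wp μ (edgeScan body) Q a := by
  have hw := P.word
  obtain ⟨G, hG0, hG1, hG2⟩ := hh.map (φ' := φ') hφ.pos hφ.inj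
  have hfix : ∀ x, 13 ≤ x → x < 20 → Fixed lo hi x := fun x h1 h2 => ⟨h1, .inl h2, .inl (by omega)⟩
  refine wp_scan P lo hi hlo G J (fun p V V' h => hcongr p V V' fun x hx => h x (by omega))
    hr.v13 hr.v15 hLW ?_ hJ0 ?_ ?_
  · intro c hc
    by_cases h0 : arr μ src a c = 0
    · change arr μ src a c < _
      omega
    · obtain ⟨u, v, huv, he⟩ := hh.sound c hc h0
      have := hφ.lt huv
      change arr μ src a c < _
      omega
  · intro p b hp h11 h12 hfx hJ
    have h12' : b.V 12 = arr μ src a p := h12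
    refine wp_ite_lt (eval_const 0 _) (y := b.V 12) (eval_var (by norm_num) b) ?_ ?_
    · intro hpos
      obtain ⟨u, v, huv, he⟩ := hh.sound p hp (by omega)
      have hlt := hφ.lt huv
      have hlt' := hφ'.lt huv
      refine wp_seq (wp_decode (K := K) (x := d0 u v) (y := d1 u v) (z := d2 u v) (w := d3 u v)
        ?_ ?_ (hφ.lt1 u v huv) (hφ.lt2 u v huv) (hφ.lt3 u v huv) ?_ ?_)
      · rw [hfx 18 (hfix _ (by norm_num) (by norm_num)), hr.v18]
      · rw [h12', he, hφ.eq]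
      · rw [← hφ.eq]; omega
      · intro c c1 c2 c3 c4 c20 c21 c22 c23
        refine wp_mono (hbody p c u v hp huv he ?_ c20 c21 c22 c23 ?_ ?_) ?_
        · rw [c4 _ (by norm_num), h12', he]
        · intro x hx
          rw [c4 x (by have := hx.2.1; omega), hfx x hx]
        · exact hcongr p _ _ (fun x hx => c4 x (by omega)) hJ
        · rintro d ⟨d1, d2, d3⟩
          refine ⟨by rw [d1.D, c1], by rw [d1.X, c2], by rw [d1.t, c3], ?_, ?_, ?_, ?_, d3⟩
          · intro x hx hx'
            rw [d1.V x (.inl ⟨hx, hx'⟩), c4 x (by omega)]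
          · intro x hx
            rw [d1.V x (.inr hx), c4 x (by have := hx.2.1; omega)]
          · rw [d2, hG1 p hp u v huv he]
          · rw [hG1 p hp u v huv he]; omega
    · intro hz
      have h0 : arr μ src a p = 0 := by omega
      refine wp_skip ⟨rfl, rfl, rfl, fun _ _ _ => rfl, fun _ _ => rfl, ?_, ?_,
        hzero p _ hp h0 hJ⟩
      · rw [hG0 p hp h0]; omega
      · rw [hG0 p hp h0]; omega
  · intro b b1 b2 b3 b4 b5
    refine hQ b (hr.of_eq fun x hx hx' => b1 x (hfix x hx hx')) b1 b2 ?_ b5 ?_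
    · constructor
      · intro p hp hne
        change b.X _ ≠ 0 at hne
        rw [b3 p hp] at hne
        obtain ⟨u, v, huv, he⟩ := hG2.sound p hp hne
        exact ⟨u, v, huv, (b3 p hp).trans he⟩
      · intro u v huv
        obtain ⟨p, hp, he⟩ := hG2.complete u v huv
        exact ⟨p, hp, (b3 p hp).trans he⟩
    · intro hsame hs
      have hAG : ∀ p < L * μ.B, arr μ src b p = arr μ src a p := by
        intro p hp
        refine (b3 p hp).trans ?_
        by_cases h0 : arr μ src a p = 0
        · rw [hG0 p hp h0, h0]
        · obtain ⟨u, v, huv, he⟩ := hh.sound p hp h0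
          rw [hG1 p hp u v huv he, he, hsame]
      intro c c' h1 h2
      rw [hAG c (by omega), hAG c' h2]
      exact hs c c' h1 h2

lemma wp_sortArr (P : Params μ L k inf) (hr : Ready L k inf K n src dst a)
    (hA : ∀ c < L * μ.B, arr μ src a c < inf)
    (hQ : ∀ (b : Conf) (src' dst' : ℕ), Ready L k inf K n src' dst' b →
      (∀ x, 15 ≤ x → b.V x = a.V x) → SortedArr (L * μ.B) (arr μ src' b) →
      (∀ y, (∃ p < L * μ.B, arr μ src' b p = y) ↔ ∃ p < L * μ.B, arr μ src a p = y) →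
      b.t ≤ a.t + 3 * L * (1 + Nat.log k L) → Q b) :
    wp μ mergeSort Q a := by
  refine wp_mergeSort P hr.twin hr.v13 hr.v14 hr.v15 hr.v16 hr.v17 hA ?_
  intro b src' dst' h1 h2 h3 h4 h5 h6 h7
  refine hQ b src' dst' ⟨h1, h2, h3, ?_, ?_, ?_, ?_, ?_⟩ h4 h6 ?_ h7
  · rw [h4 _ (by norm_num), hr.v15]
  · rw [h4 _ (by norm_num), hr.v16]
  · rw [h4 _ (by norm_num), hr.v17]
  · rw [h4 _ (by norm_num), hr.v18]
  · rw [h4 _ (by norm_num), hr.v19]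
  · intro y
    have h8 := congrArg (y ∈ ·) h5
    simp only [mem_ms, Nat.zero_le, true_and, eq_iff_iff] at h8
    exact h8

lemma wp_sortHolds (P : Params μ L k inf) (hinf : K * K * K * K = inf) (hpos : 0 < K)
    (hr : Ready L k inf K n src dst a)
    {φ d0 d1 d2 d3 : ℕ → ℕ → ℕ} (hφ : Digits adj K φ d0 d1 d2 d3)
    (hh : Holds adj (L * μ.B) (arr μ src a) φ)
    (hQ : ∀ (b : Conf) (src' dst' : ℕ), Ready L k inf K n src' dst' b →
      (∀ x, 15 ≤ x → b.V x = a.V x) → SortedArr (L * μ.B) (arr μ src' b) →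
      Holds adj (L * μ.B) (arr μ src' b) φ →
      b.t ≤ a.t + 3 * L * (1 + Nat.log k L) → Q b) :
    wp μ mergeSort Q a := by
  refine wp_sortArr P hr ?_ ?_
  · intro c hc
    by_cases h0 : arr μ src a c = 0
    · rw [h0, ← hinf]; positivity
    · obtain ⟨u, v, huv, he⟩ := hh.sound c hc h0
      rw [he, ← hinf]
      exact hφ.lt huv
  · intro b src' dst' h1 h2 h3 h4 h5
    exact hQ b src' dst' h1 h2 h3 (hh.congr h4) h5

end
end ExtMem
namespace ExtMem

/-! ### Ranking the neighbours of a vertex by descending degree -/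

/-- Adjacency on natural numbers below `n`, with complementary degrees `cod`. -/
structure Graphic (adj : ℕ → ℕ → Prop) (cod : ℕ → ℕ) (K n : ℕ) : Prop where
  lt : ∀ u v, adj u v → u < n
  symm : ∀ u v, adj u v → adj v u
  irrefl : ∀ u, ¬adj u u
  cod_pos : ∀ u v, adj u v → 0 < cod u
  cod_lt : ∀ u v, adj u v → cod u < K
  n_lt : n + 2 < K
  missing : ∀ b b' v, cod b' ≤ cod b → adj b v → ¬adj b' v → ∃ u, adj b' u ∧ ¬adj b u

/-- The sort key of a vertex: by descending degree. -/
def key (cod : ℕ → ℕ) (K u : ℕ) : ℕ := cod u * K + u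

open Classical in
/-- The number of neighbours of `z` whose key is less than `κ`. -/
noncomputable def keyCount (adj : ℕ → ℕ → Prop) (cod : ℕ → ℕ) (K n z κ : ℕ) : ℕ :=
  ((Finset.range n).filter fun u => adj u z ∧ key cod K u < κ).card

open Classical in
/-- The rank of `u` among the neighbours of `z`, counted from one. -/
noncomputable def rank (adj : ℕ → ℕ → Prop) (cod : ℕ → ℕ) (K n z u : ℕ) : ℕ :=
  if adj u z then keyCount adj cod K n z (key cod K u + 1) else 0

section
variable {adj : ℕ → ℕ → Prop} {cod : ℕ → ℕ} {K n z u v u' v' : ℕ}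

lemma key_inj (hu : u < K) (hv : v < K) (h : key cod K u = key cod K v) : u = v :=
  (digit_inj hu hv h).2

lemma key_le (hu : u < K) (hv : v < K) :
    key cod K u ≤ key cod K v ↔ cod u < cod v ∨ cod u = cod v ∧ u ≤ v := digit_le hu hv

lemma keyCount_congr {κ κ' : ℕ} (h : ∀ u, adj u z → (key cod K u < κ ↔ key cod K u < κ')) :
    keyCount adj cod K n z κ = keyCount adj cod K n z κ' := by
  classical
  unfold keyCount
  congr 1
  refine Finset.filter_congr fun u _ => ?_
  exact and_congr_right fun hu => h u hu

lemma keyCount_le {κ : ℕ} : keyCount adj cod K n z κ ≤ n := by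
  classical
  exact (Finset.card_filter_le _ _).trans (by rw [Finset.card_range])

lemma keyCount_mono {κ κ' : ℕ} (h : κ ≤ κ') :
    keyCount adj cod K n z κ ≤ keyCount adj cod K n z κ' := by
  classical
  refine Finset.card_le_card fun u hu => ?_
  simp only [Finset.mem_filter] at hu ⊢
  exact ⟨hu.1, hu.2.1, by omega⟩

lemma rank_le : rank adj cod K n z u ≤ n := by
  unfold rank
  split_ifs
  · exact keyCount_le
  · omega

lemma rank_of_adj (h : adj u z) : rank adj cod K n z u = keyCount adj cod K n z (key cod K u + 1) :=
  if_pos h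

lemma rank_of_not_adj (h : ¬adj u z) : rank adj cod K n z u = 0 := if_neg h

lemma adj_of_rank_pos (h : 0 < rank adj cod K n z u) : adj u z := by
  by_contra h1
  rw [rank_of_not_adj h1] at h
  omega

variable (hG : Graphic adj cod K n)
include hG

lemma Graphic.lt_K (h : adj u v) : u < K := by
  have := hG.lt u v h
  have := hG.n_lt
  omega

/-- Keys are distinct, so u is the only neighbour of z that enters when the threshold moves past its
key. -/
lemma keyCount_succ (h : adj u z) :
    keyCount adj cod K n z (key cod K u + 1) = keyCount adj cod K n z (key cod K u) + 1 := by
  classical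
  unfold keyCount
  rw [← Finset.card_insert_of_notMem (a := u)]
  · congr 1
    ext w
    simp only [Finset.mem_filter, Finset.mem_insert, Finset.mem_range]
    constructor
    · rintro ⟨h1, h2, h3⟩
      by_cases h4 : key cod K w = key cod K u
      · exact .inl (key_inj (hG.lt_K h2) (hG.lt_K h) h4)
      · exact .inr ⟨h1, h2, by omega⟩
    · rintro (rfl | ⟨h1, h2, h3⟩)
      · exact ⟨hG.lt _ _ h, h, by omega⟩
      · exact ⟨h1, h2, by omega⟩
  · simp

lemma rank_pos (h : adj u z) : 0 < rank adj cod K n z u := by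
  rw [rank_of_adj h, keyCount_succ hG h]
  omega

/-- Counting is monotone in the threshold, and strictly so across the key of a neighbour of z. Hence
ranks order the neighbours of z exactly as keys do. -/
lemma rank_le_rank (h : adj u z) (h' : adj u' z) :
    rank adj cod K n z u ≤ rank adj cod K n z u' ↔ key cod K u ≤ key cod K u' := by
  rw [rank_of_adj h, rank_of_adj h']
  constructor
  · intro h1
    by_contra h2
    rw [keyCount_succ hG h] at h1
    have := keyCount_mono (adj := adj) (cod := cod) (K := K) (n := n) (z := z)
      (show key cod K u' + 1 ≤ key cod K u by omega)
    omega
  · intro h1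
    exact keyCount_mono (by omega)

lemma rank_inj (h : 0 < rank adj cod K n z u)
    (he : rank adj cod K n z u = rank adj cod K n z u') : u = u' := by
  have h1 := adj_of_rank_pos h
  have h2 := adj_of_rank_pos (he ▸ h)
  refine key_inj (cod := cod) (hG.lt_K h1) (hG.lt_K h2) (le_antisymm ?_ ?_)
  · exact (rank_le_rank hG h1 h2).1 he.le
  · exact (rank_le_rank hG h2 h1).1 he.ge

/-- Among the neighbours of z with smaller key, the one with the largest key has the preceding rank:
no key of a neighbour lies in between. -/
lemma exists_rank_pred (h : 2 ≤ rank adj cod K n z u) :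
    ∃ u', rank adj cod K n z u' + 1 = rank adj cod K n z u := by
  classical
  have hu := adj_of_rank_pos (show 0 < rank adj cod K n z u by omega)
  have h1 := h
  rw [rank_of_adj hu, keyCount_succ hG hu] at h1
  have h2 : 0 < keyCount adj cod K n z (key cod K u) := by omega
  obtain ⟨w, hw, hmax⟩ := Finset.exists_max_image _ (key cod K) (Finset.card_pos.1 h2)
  simp only [Finset.mem_filter, Finset.mem_range] at hw hmax
  refine ⟨w, ?_⟩
  rw [rank_of_adj hw.2.1, rank_of_adj hu, keyCount_succ hG hu]
  congr 1
  refine keyCount_congr fun x hx => ⟨fun h3 => by omega, fun h3 => ?_⟩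
  have := hmax x ⟨hG.lt _ _ hx, hx, h3⟩
  omega

/-- If the neighbours of every vertex that have a rank form an initial segment then the
neighbourhoods are nested. -/
lemma nested_of_rank_pred
    (h : ∀ u v, adj u v → 2 ≤ rank adj cod K n z u →
      ∃ u', adj u' v ∧ rank adj cod K n z u' + 1 = rank adj cod K n z u)
    (hu : adj u z) (hu' : adj u' z) (hle : key cod K u' ≤ key cod K u) (hv : adj u v) :
    adj u' v := by
  rw [← rank_le_rank hG hu' hu] at hle
  have hp := rank_pos hG hu'
  -- Descend from u one rank at a time. Each step stays adjacent to v by `h`, until the rank of u',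
  -- and therefore u' itself, is reached.
  induction hd : rank adj cod K n z u - rank adj cod K n z u' generalizing u with
  | zero =>
    have := rank_inj hG hp (u' := u) (by omega)
    rwa [this]
  | succ d ih =>
    obtain ⟨w, h1, h2⟩ := h u v hv (by omega)
    have hw : adj w z := adj_of_rank_pos (adj := adj) (cod := cod) (K := K) (n := n) (by omega)
    exact ih hw (by omega) h1 (by omega)

end

/-! ### Words for edges -/

/-- The canonical word of an edge. -/
def edgeWord (cod : ℕ → ℕ) (K u v : ℕ) : ℕ := enc K (cod u) u 1 v

open Classical in
/-- The word of an edge that puts `z` first among the neighbours of `u`. -/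
noncomputable def starWord (cod : ℕ → ℕ) (K z u v : ℕ) : ℕ := enc K (cod u) u (if v = z then 0 else 1) v

/-- The word of an edge that begins with the second vertex and the rank of the first. -/
noncomputable def rankWord (adj : ℕ → ℕ → Prop) (cod : ℕ → ℕ) (K n z u v : ℕ) : ℕ :=
  enc K v (rank adj cod K n z u) (cod u) u

lemma enc_pos {K a b c d : ℕ} (hK : 0 < K) (h : 0 < a ∨ 0 < b ∨ 0 < c ∨ 0 < d) :
    0 < enc K a b c d := by
  unfold enc
  rcases h with h | h | h | h <;> positivity

section
variable {adj : ℕ → ℕ → Prop} {cod : ℕ → ℕ} {K n z : ℕ} (hG : Graphic adj cod K n)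
include hG

lemma Graphic.digits_edgeWord : Digits adj K (edgeWord cod K) (fun u _ => cod u) (fun u _ => u)
    (fun _ _ => 1) (fun _ v => v) := by
  have hn := hG.n_lt
  have hv : ∀ {u v}, adj u v → v < K := fun h => hG.lt_K (hG.symm _ _ h)
  refine ⟨fun _ _ => rfl, hG.cod_lt, fun _ _ h => hG.lt_K h, fun _ _ _ => by omega,
    fun _ _ h => hv h, fun _ _ _ => enc_pos (by omega) (by omega), ?_⟩
  intro u v u' v' h h' he
  have := enc_inj (hG.lt_K h) (by omega) (hv h) (hG.lt_K h') (by omega) (hv h') he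
  exact ⟨this.2.1, this.2.2.2⟩

open Classical in
lemma Graphic.digits_starWord : Digits adj K (starWord cod K z) (fun u _ => cod u) (fun u _ => u)
    (fun _ v => if v = z then 0 else 1) (fun _ v => v) := by
  have hn := hG.n_lt
  have hv : ∀ {u v}, adj u v → v < K := fun h => hG.lt_K (hG.symm _ _ h)
  have hf : ∀ v, (if v = z then 0 else 1) < K := fun v => by split_ifs <;> omega
  refine ⟨fun _ _ => rfl, hG.cod_lt, fun _ _ h => hG.lt_K h, fun _ v _ => hf v,
    fun _ _ h => hv h, fun _ _ h => enc_pos (by omega) (.inl (hG.cod_pos _ _ h)), ?_⟩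
  intro u v u' v' h h' he
  have := enc_inj (hG.lt_K h) (hf v) (hv h) (hG.lt_K h') (hf v') (hv h') he
  exact ⟨this.2.1, this.2.2.2⟩

lemma Graphic.digits_rankWord : Digits adj K (rankWord adj cod K n z) (fun _ v => v)
    (fun u _ => rank adj cod K n z u) (fun u _ => cod u) (fun u _ => u) := by
  have hn := hG.n_lt
  have hv : ∀ {u v}, adj u v → v < K := fun h => hG.lt_K (hG.symm _ _ h)
  have hr : ∀ u, rank adj cod K n z u < K := fun u => by
    have := rank_le (adj := adj) (cod := cod) (K := K) (n := n) (z := z) (u := u); omega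
  refine ⟨fun _ _ => rfl, fun _ _ h => hv h, fun u _ _ => hr u, hG.cod_lt,
    fun _ _ h => hG.lt_K h,
    fun _ _ h => enc_pos (by omega) (.inr (.inr (.inl (hG.cod_pos _ _ h)))), ?_⟩
  intro u v u' v' h h' he
  have := enc_inj (hr u) (hG.cod_lt _ _ h) (hG.lt_K h) (hr u') (hG.cod_lt _ _ h') (hG.lt_K h') he
  exact ⟨this.2.2.2, this.1⟩

-- In the sorted array the rows follow the order of keys, and within the row of u the word of the
-- edge uz, if present, comes first.
open Classical in
lemma Graphic.starWord_le {u v u' v' : ℕ} (h : adj u v) (h' : adj u' v') :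
    starWord cod K z u v ≤ starWord cod K z u' v' ↔ key cod K u < key cod K u' ∨ u = u' ∧
      ((if v = z then 0 else 1) < (if v' = z then 0 else 1) ∨
        (if v = z then 0 else 1) = (if v' = z then 0 else 1) ∧ v ≤ v') := by
  have hn := hG.n_lt
  have hv : ∀ {u v}, adj u v → v < K := fun h => hG.lt_K (hG.symm _ _ h)
  have hf : ∀ v, (if v = z then 0 else 1) < K := fun v => by split_ifs <;> omega
  have h1 := key_le (cod := cod) (hG.lt_K h') (hG.lt_K h)
  have h2 := key_inj (cod := cod) (hG.lt_K h) (hG.lt_K h')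
  rw [starWord, starWord, enc_le (hG.lt_K h) (hf v) (hv h) (hG.lt_K h') (hf v') (hv h')]
  rw [← not_le (a := key cod K u'), h1]
  constructor
  · rintro (h3 | ⟨h3, h4 | ⟨h4, h5⟩⟩)
    · left; omega
    · left; omega
    · exact .inr ⟨h4, h5⟩
  · rintro (h3 | ⟨rfl, h4⟩)
    · omega
    · exact .inr ⟨rfl, .inr ⟨rfl, h4⟩⟩

lemma Graphic.rankWord_le {u v u' v' : ℕ} (h : adj u v) (h' : adj u' v')
    (hle : rankWord adj cod K n z u v ≤ rankWord adj cod K n z u' v') :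
    v < v' ∨ v = v' ∧ rank adj cod K n z u ≤ rank adj cod K n z u' := by
  have hn := hG.n_lt
  have hr : ∀ u, rank adj cod K n z u < K := fun u => by
    have := rank_le (adj := adj) (cod := cod) (K := K) (n := n) (z := z) (u := u); omega
  rw [rankWord, rankWord, enc_le (hr u) (hG.cod_lt _ _ h) (hG.lt_K h) (hr u')
    (hG.cod_lt _ _ h') (hG.lt_K h')] at hle
  omega

end
end ExtMem
namespace ExtMem

/-! ### The passes of a check -/

lemma Graphic.le_inf {adj : ℕ → ℕ → Prop} {cod : ℕ → ℕ} {K n inf : ℕ} (hG : Graphic adj cod K n)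
    (hinf : K * K * K * K = inf) : K ≤ inf := by
  have hK : 0 < K := by have := hG.n_lt; omega
  rw [← hinf]
  exact Nat.le_mul_of_pos_left _ (by positivity)

lemma Kept.update {lo hi : ℕ} {b c : Conf} (h : Kept lo hi b c) (i x : ℕ)
    (hi' : i < 9 ∨ 11 < i ∧ i < 13 ∨ 20 ≤ i ∧ i < 28 ∨ 12 ≤ i ∧ lo ≤ i ∧ i < hi) :
    Kept lo hi b { c with V := Function.update c.V i x } := by
  refine ⟨h.D, h.X, h.t, fun y hy => ?_⟩
  rw [← h.V y hy]
  refine Function.update_of_ne ?_ _ _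
  rintro rfl
  simp only [Fixed] at hy
  omega

/-- Rewrite edge words so that the rows of neighbours of `z` can be recognised. -/
def starPass : Program := edgeScan
  (.ite (eqE (var 23) (var 30)) (assign 12 (encE (var 20) (var 21) (.const 0) (var 23)))
    (assign 12 (encE (var 20) (var 21) (.const 1) (var 23))))

/-- Number the rows of neighbours of `z`. -/
def rankPass : Program := edgeScan
  (.seq (.ite (eqE (var 21) (var 24)) .skip
      (.seq (assign 24 (var 21))
        (.ite (eqE (var 22) (.const 0))
          (.seq (assign 25 (.const 1)) (.seq (assign 26 (.add (var 26) (.const 1)))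
            (.ite (eqE (var 26) (.const 1)) (assign 31 (var 21)) .skip)))
          (assign 25 (.const 0)))))
    (assign 12 (encE (var 23) (.mul (var 25) (var 26)) (var 20) (var 21))))

/-- Search for a row entry that is missing in the preceding row. -/
def gapPass : Program := edgeScan
  (.seq (.ite (.lt (.const 1) (var 21))
      (.ite (.mul (eqE (var 20) (var 24)) (.lt (var 21) (.add (var 25) (.const 2)))) .skip
        (.ite (eqE (var 32) (.const 0))
          (.seq (assign 32 (.const 1)) (.seq (assign 33 (var 20)) (.seq (assign 34 (var 21))
            (assign 35 (var 23))))) .skip)) .skip)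
    (.seq (assign 24 (var 20)) (assign 25 (var 21))))

/-- Search for an entry of the preceding row that is missing in the row found. -/
def exchangePass : Program := edgeScan
  (.seq (.ite (eqE (.add (var 21) (.const 1)) (var 34))
      (.seq (assign 36 (var 23)) (.ite (eqE (var 37) (var 19)) (assign 37 (var 20)) .skip))
      (.ite (eqE (var 21) (var 34))
        (.ite (eqE (var 20) (var 37)) (assign 37 (var 19)) .skip) .skip))
    (assign 12 (encE (var 22) (var 23) (.const 1) (var 20))))

section
variable {μ : Machine} [hμ : Fact (μ.extra = extraWords)] {Q : Conf → Prop} {a : Conf}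
  {L k inf K n src dst : ℕ} {adj : ℕ → ℕ → Prop} {cod : ℕ → ℕ}

/-- The third digit, constantly 1 in canonical words, becomes 0 exactly for edges into z. -/
lemma wp_starPass (P : Params μ L k inf) (hinf : K * K * K * K = inf) (hLW : L * μ.B < μ.W)
    (hG : Graphic adj cod K n) {z : ℕ} (hz : a.V 30 = z)
    (hr : Ready L k inf K n src dst a) (hh : Holds adj (L * μ.B) (arr μ src a) (edgeWord cod K))
    (hQ : ∀ b : Conf, Ready L k inf K n src dst b → (∀ x, 28 ≤ x → b.V x = a.V x) →
      Holds adj (L * μ.B) (arr μ src b) (starWord cod K z) → b.t = a.t + 2 * L → Q b) :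
    wp μ starPass Q a := by
  have hW := P.word
  refine wp_edgeScan P hinf hLW 20 20 le_rfl hG.digits_edgeWord (hG.digits_starWord (z := z)) hr hh
    (fun _ _ => True) (fun _ _ _ _ _ => trivial) trivial (fun _ _ _ _ _ => trivial) ?_ ?_
  · intro p b u v hp huv _ h12 h20 h21 h22 h23 hfx _
    have h18 : b.V 18 = K := (hfx 18 ⟨by norm_num, by norm_num, by norm_num⟩).trans hr.v18
    have h30 : b.V 30 = z := (hfx 30 ⟨by norm_num, by norm_num, by norm_num⟩).trans hz
    have hlt := (hG.digits_starWord (z := z)).lt huv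
    refine wp_ite_eq (x := v) (y := z) (by rw [eval_var (by norm_num), h23])
      (by rw [eval_var (by norm_num), h30]) ?_ ?_
    · intro hvz
      refine wp_assign (by norm_num) (x := starWord cod K z u v) ?_ (by omega) ?_
      · rw [eval_encE (K := K) h18 (eval_var (by norm_num) _) (eval_var (by norm_num) _)
          (eval_const _ _) (eval_var (by norm_num) _), starWord, if_pos hvz, h20, h21, h23]
      · exact ⟨(Kept.refl _ _ _).update _ _ (by norm_num), by simp, trivial⟩
    · intro hvz
      refine wp_assign (by norm_num) (x := starWord cod K z u v) ?_ (by omega) ?_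
      · rw [eval_encE (K := K) h18 (eval_var (by norm_num) _) (eval_var (by norm_num) _)
          (eval_const _ _) (eval_var (by norm_num) _), starWord, if_neg hvz, h20, h21, h23]
      · exact ⟨(Kept.refl _ _ _).update _ _ (by norm_num), by simp, trivial⟩
  · intro b b1 b2 _ b3 b4 _
    exact hQ b b1 (fun x hx => b2 x ⟨by omega, by omega, by omega⟩) b3 b4

open Classical in
/-- The invariant of `rankPass` on the sorted array `A`. -/
def RankInv (adj : ℕ → ℕ → Prop) (cod : ℕ → ℕ) (K n z : ℕ) (A : ℕ → ℕ) (p : ℕ) (V : ℕ → ℕ) : Prop :=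
  ((∀ c < p, A c = 0) ∧ V 24 = n ∧ V 25 = 0 ∧ V 26 = 0 ∨
    0 < p ∧ ∃ v, adj (V 24) v ∧ A (p - 1) = starWord cod K z (V 24) v ∧
      V 25 = (if adj (V 24) z then 1 else 0) ∧
      V 26 = keyCount adj cod K n z (key cod K (V 24) + 1)) ∧
  (1 ≤ V 26 → rank adj cod K n z (V 31) = 1)

-- At the beginning of the row of u in the sorted array, exactly the rows with smaller key have been
-- passed, so the counter equals the number of neighbours of z among them. As the edge into z leads
-- its row, the first word of the row already decides whether u is a neighbour of z.
open Classical in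
lemma RankInv.step {N p z u v : ℕ} {A : ℕ → ℕ} {V : ℕ → ℕ} (hG : Graphic adj cod K n)
    (hh : Holds adj N A (starWord cod K z)) (hs : SortedArr N A) (hp : p < N)
    (huv : adj u v) (he : A p = starWord cod K z u v) (h : RankInv adj cod K n z A p V)
    (hne : u ≠ V 24) : V 26 = keyCount adj cod K n z (key cod K u) ∧ (adj u z ↔ v = z) := by
  have hpos := (hG.digits_starWord (z := z)).pos
  obtain ⟨h, -⟩ := h
  have key1 : (∀ c < p, A c = 0) ∧ V 26 = 0 ∨ 0 < p ∧ ∃ v', adj (V 24) v' ∧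
      A (p - 1) = starWord cod K z (V 24) v' ∧ key cod K (V 24) < key cod K u ∧
      V 26 = keyCount adj cod K n z (key cod K (V 24) + 1) := by
    rcases h with ⟨h1, h2, h3, h4⟩ | ⟨h1, v', h2, h3, h4, h5⟩
    · exact .inl ⟨h1, h4⟩
    · refine .inr ⟨h1, v', h2, h3, ?_, h5⟩
      have h6 := hs (p - 1) p (by omega) hp
      rw [h3, he, hG.starWord_le h2 huv] at h6
      rcases h6 with h6 | ⟨h6, -⟩
      · exact h6
      · exact absurd h6.symm hne
  -- a neighbour of `z` occurs before position `p` or not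
  have key2 : ∀ u', adj u' z → (∃ c < p, A c = starWord cod K z u' z) ∨
      starWord cod K z u v ≤ starWord cod K z u' z := by
    intro u' hu'
    obtain ⟨c, hc, hce⟩ := hh.complete u' z hu'
    by_cases hcp : c < p
    · exact .inl ⟨c, hcp, hce⟩
    · right
      rw [← he, ← hce]
      exact hs p c (by omega) hc
  have key3 : ∀ u', adj u' z → (∃ c < p, A c = starWord cod K z u' z) →
      0 < p ∧ key cod K u' < key cod K (V 24) + 1 ∧ key cod K (V 24) < key cod K u ∧
      V 26 = keyCount adj cod K n z (key cod K (V 24) + 1) := by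
    rintro u' hu' ⟨c, hc, hce⟩
    have := hpos u' z hu'
    rcases key1 with ⟨h1, -⟩ | ⟨h1, v', h2, h3, h4, h5⟩
    · have := h1 c hc
      omega
    · refine ⟨h1, ?_, h4, h5⟩
      have h6 := hs c (p - 1) (by omega) (by omega)
      rw [h3, hce, hG.starWord_le hu' h2] at h6
      rcases h6 with h6 | ⟨h6, -⟩
      · omega
      · rw [h6]; omega
  constructor
  · rcases key1 with ⟨h1, h4⟩ | ⟨h1, v', h2, h3, h4, h5⟩
    · rw [h4, keyCount_congr (κ' := 0)]
      · simp [keyCount]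
      · intro u' hu'
        refine ⟨fun hlt => ?_, fun h => by omega⟩
        rcases key2 u' hu' with h6 | h6
        · obtain ⟨c, hc, hce⟩ := h6
          have := hpos u' z hu'
          have := h1 c hc
          omega
        · rw [hG.starWord_le huv hu'] at h6
          rcases h6 with h6 | ⟨rfl, -⟩ <;> omega
    · rw [h5]
      refine keyCount_congr fun u' hu' => ⟨fun hlt => by omega, fun hlt => ?_⟩
      rcases key2 u' hu' with h6 | h6
      · exact (key3 u' hu' h6).2.1
      · rw [hG.starWord_le huv hu'] at h6
        rcases h6 with h6 | ⟨rfl, -⟩ <;> omega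
  · refine ⟨fun hz => ?_, fun hz => hz ▸ huv⟩
    rcases key2 u hz with h6 | h6
    · have := key3 u hz h6
      omega
    · rw [hG.starWord_le huv hz] at h6
      by_contra hvz
      simp [hvz] at h6

/-- Variable 24 holds the current row, 25 whether it belongs to a neighbour of z, 26 the number of
such rows so far, and 31 the neighbour of rank one. The product of 25 and 26 is the rank, with value
0 for rows of other vertices. Initially 24 is n, which is no vertex, so the first edge word opens a
row. -/
lemma wp_rankPass (P : Params μ L k inf) (hinf : K * K * K * K = inf) (hLW : L * μ.B < μ.W)
    (hG : Graphic adj cod K n) {z : ℕ} (h24 : a.V 24 = n) (h25 : a.V 25 = 0) (h26 : a.V 26 = 0)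
    (hr : Ready L k inf K n src dst a) (hh : Holds adj (L * μ.B) (arr μ src a) (starWord cod K z))
    (hs : SortedArr (L * μ.B) (arr μ src a)) (hz : ∃ u, adj u z)
    (hQ : ∀ b : Conf, Ready L k inf K n src dst b →
      (∀ x, 28 ≤ x → x ≠ 31 → b.V x = a.V x) → rank adj cod K n z (b.V 31) = 1 →
      Holds adj (L * μ.B) (arr μ src b) (rankWord adj cod K n z) → b.t = a.t + 2 * L → Q b) :
    wp μ rankPass Q a := by
  classical
  have hW := P.word
  have hn := hG.n_lt
  have hKK : K ≤ inf := hG.le_inf hinf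
  refine wp_edgeScan P hinf hLW 31 32 (by norm_num) (hG.digits_starWord (z := z))
    (hG.digits_rankWord (z := z)) hr hh
    (RankInv adj cod K n z (arr μ src a)) ?_ ?_ ?_ ?_ ?_
  · intro p V V' hV
    rw [RankInv, RankInv, hV 24 (by norm_num), hV 25 (by norm_num), hV 26 (by norm_num),
      hV 31 (by norm_num)]
    exact id
  · exact ⟨.inl ⟨by simp, h24, h25, h26⟩, by omega⟩
  · rintro p V hp h0 ⟨h1 | ⟨h1, v, h2, h3, h4⟩, h5⟩
    · refine ⟨.inl ⟨fun c hc => ?_, h1.2⟩, h5⟩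
      by_cases hcp : c = p
      · rw [hcp, h0]
      · exact h1.1 c (by omega)
    · have h6 := hs (p - 1) p (by omega) hp
      have := (hG.digits_starWord (z := z)).pos _ _ h2
      omega
  · intro p b u v hp huv he h12 h20 h21 h22 h23 hfx hJ
    have h18 : b.V 18 = K := (hfx 18 ⟨by norm_num, by norm_num, by norm_num⟩).trans hr.v18
    have hlt := (hG.digits_rankWord (z := z)).lt huv
    have huK := hG.lt_K huv
    -- the common end of all branches
    have fin : ∀ c : Conf, Kept 31 32 b c → c.V 18 = K → c.V 20 = cod u → c.V 21 = u →
        c.V 23 = v → c.V 24 = u → c.V 25 = (if adj u z then 1 else 0) →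
        c.V 26 = keyCount adj cod K n z (key cod K u + 1) →
        (1 ≤ c.V 26 → rank adj cod K n z (c.V 31) = 1) →
        wp μ (assign 12 (encE (var 23) (.mul (var 25) (var 26)) (var 20) (var 21)))
          (fun c => Kept 31 32 b c ∧ c.V 12 = rankWord adj cod K n z u v ∧
            RankInv adj cod K n z (arr μ src a) (p + 1) c.V) c := by
      intro c hc c18 c20 c21 c23 c24 c25 c26 c31
      refine wp_assign (by norm_num) (x := rankWord adj cod K n z u v) ?_ (by omega) ?_
      · rw [eval_encE (K := K) (y := rank adj cod K n z u) c18 (eval_var (by norm_num) _) ?_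
          (eval_var (by norm_num) _) (eval_var (by norm_num) _), rankWord, c20, c21, c23]
        rw [eval_mul, eval_var (by norm_num), eval_var (by norm_num), c25, c26]
        unfold rank
        split_ifs <;> omega
      · refine ⟨hc.update _ _ (by norm_num), by simp, .inr ⟨by omega, v, ?_, ?_, ?_, ?_⟩, ?_⟩
        · simpa [c24] using huv
        · simpa [c24] using he
        · simpa [c24] using c25
        · simpa [c24] using c26
        · simpa using c31
    refine wp_seq (wp_ite_eq (x := u) (y := b.V 24) (by rw [eval_var (by norm_num), h21])
      (eval_var (by norm_num) _) ?_ ?_)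
    · intro hu
      refine wp_skip (fin b (Kept.refl _ _ _) h18 h20 h21 h23 hu.symm ?_ ?_ hJ.2)
      all_goals
        rcases hJ.1 with h1 | ⟨h1, v', h2, h3, h4, h5⟩
        · have := hG.lt _ _ huv
          omega
      · rw [h4, hu]
      · rw [h5, hu]
    · intro hu
      obtain ⟨e1, e2⟩ := RankInv.step hG hh hs hp huv he hJ hu
      refine wp_seq (wp_assign (by norm_num) (x := u) (by rw [eval_var (by norm_num), h21])
        (by omega) ?_)
      refine wp_ite_eq (x := if v = z then 0 else 1) (y := 0) ?_ (eval_const _ _) ?_ ?_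
      · rw [eval_var (by norm_num)]; simpa using h22
      · intro hv
        have hvz : v = z := by by_contra h; simp [h] at hv
        have huz := e2.2 hvz
        have hcnt := keyCount_le (adj := adj) (cod := cod) (K := K) (n := n) (z := z)
          (κ := key cod K u)
        refine wp_seq (wp_assign (by norm_num) (x := 1) (eval_const _ _) (by omega) ?_)
        refine wp_seq (wp_assign (by norm_num) (x := b.V 26 + 1) ?_ (by omega) ?_)
        · rw [eval_add, eval_var (by norm_num), eval_const]; simp
        refine wp_ite_eq (x := b.V 26 + 1) (y := 1) ?_ (eval_const _ _) ?_ ?_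
        · rw [eval_var (by norm_num)]; simp
        · intro h1
          refine wp_assign (by norm_num) (x := u) ?_ (by omega) ?_
          · rw [eval_var (by norm_num)]; simpa using h21
          refine fin _ (((((Kept.refl _ _ _).update _ _ (by norm_num)).update _ _
            (by norm_num)).update _ _ (by norm_num)).update _ _ (by norm_num)) (by simpa using h18)
            (by simpa using h20) (by simpa using h21) (by simpa using h23) (by simp) ?_ ?_ ?_
          · simp [huz]
          · simp [e1, keyCount_succ hG huz]
          · intro _
            simp only [Function.update_self]
            rw [rank_of_adj huz, keyCount_succ hG huz]
            omega
        · intro h1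
          refine wp_skip (fin _ ((((Kept.refl _ _ _).update _ _ (by norm_num)).update _ _
            (by norm_num)).update _ _ (by norm_num)) (by simpa using h18)
            (by simpa using h20) (by simpa using h21) (by simpa using h23) (by simp) ?_ ?_ ?_)
          · simp [huz]
          · simp [e1, keyCount_succ hG huz]
          · intro _
            simpa using hJ.2 (by omega)
      · intro hv
        have hvz : v ≠ z := by intro h; simp [h] at hv
        have huz : ¬adj u z := fun h => hvz (e2.1 h)
        refine wp_assign (by norm_num) (x := 0) (eval_const _ _) (by omega) ?_
        refine fin _ (((Kept.refl _ _ _).update _ _ (by norm_num)).update _ _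
            (by norm_num)) (by simpa using h18)
            (by simpa using h20) (by simpa using h21) (by simpa using h23) (by simp) ?_ ?_ ?_
        · simp [huz]
        · simp only [ne_eq, Nat.reduceEqDiff, not_false_eq_true, Function.update_of_ne, e1]
          refine keyCount_congr fun w hw => ?_
          have : key cod K w ≠ key cod K u := fun h =>
            huz (key_inj (hG.lt_K hw) huK h ▸ hw)
          omega
        · simpa using hJ.2
  · intro b b1 b2 hJ b3 b4 _
    refine hQ b b1 (fun x hx hx' => b2 x ⟨by omega, by omega, by omega⟩) (hJ.2 ?_) b3 b4
    obtain ⟨u, hu⟩ := hz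
    -- Some neighbour of z exists and its row has been passed, so the counter is positive and
    -- variable 31 has been set.
    obtain ⟨c, hc, hce⟩ := hh.complete u z hu
    have hp := (hG.digits_starWord (z := z)).pos _ _ hu
    rcases hJ.1 with ⟨h1, -⟩ | ⟨h1, v, h2, h3, h4, h5⟩
    · have := h1 c hc
      omega
    · have h6 := hs c (L * μ.B - 1) (by omega) (by omega)
      rw [h3, hce, hG.starWord_le hu h2] at h6
      rw [h5]
      have h7 := rank_pos hG hu
      rw [rank_of_adj hu] at h7
      refine h7.trans_le (keyCount_mono ?_)
      rcases h6 with h6 | ⟨rfl, -⟩ <;> omega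

end
end ExtMem
-- Finding a gap in the ranks and the missing private neighbour
namespace ExtMem

section
variable {μ : Machine} [hμ : Fact (μ.extra = extraWords)] {Q : Conf → Prop} {a : Conf}
  {L k inf K n src dst : ℕ} {adj : ℕ → ℕ → Prop} {cod : ℕ → ℕ}

/-- The invariant of `gapPass` on the sorted array `A`. -/
def GapInv (adj : ℕ → ℕ → Prop) (cod : ℕ → ℕ) (K n z : ℕ) (A : ℕ → ℕ) (p : ℕ) (V : ℕ → ℕ) : Prop :=
  ((∀ c < p, A c = 0) ∧ V 24 = n ∧ V 25 = 0 ∨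
    0 < p ∧ ∃ u, adj u (V 24) ∧ A (p - 1) = rankWord adj cod K n z u (V 24) ∧
      V 25 = rank adj cod K n z u) ∧
  (V 32 = 0 ∧ V 34 = 0 ∧ (∀ c < p, ∀ u v, adj u v → A c = rankWord adj cod K n z u v →
      2 ≤ rank adj cod K n z u →
      ∃ u', adj u' v ∧ rank adj cod K n z u' + 1 = rank adj cod K n z u) ∨
    V 32 = 1 ∧ adj (V 35) (V 33) ∧ V 34 = rank adj cod K n z (V 35) ∧ 2 ≤ V 34 ∧
      ∀ u', adj u' (V 33) → rank adj cod K n z u' + 1 ≠ V 34)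

/-- Words are grouped by v with ascending ranks, so it suffices to compare neighbouring words: a
rank r ≥ 2 has a gap below it unless the preceding word belongs to the same v and has rank at least
r - 1. Variables 33, 34 and 35 record v, the rank and b for the first gap. -/
lemma wp_gapPass (P : Params μ L k inf) (hinf : K * K * K * K = inf) (hLW : L * μ.B < μ.W)
    (hG : Graphic adj cod K n) {z : ℕ} (h24 : a.V 24 = n) (h25 : a.V 25 = 0) (h32 : a.V 32 = 0)
    (h34 : a.V 34 = 0)
    (hr : Ready L k inf K n src dst a)
    (hh : Holds adj (L * μ.B) (arr μ src a) (rankWord adj cod K n z))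
    (hs : SortedArr (L * μ.B) (arr μ src a))
    (hQ : ∀ b : Conf, Ready L k inf K n src dst b →
      (∀ x, 28 ≤ x → x < 32 ∨ 36 ≤ x → b.V x = a.V x) →
      (b.V 32 = 0 ∧ b.V 34 = 0 ∧ (∀ u v, adj u v → 2 ≤ rank adj cod K n z u →
          ∃ u', adj u' v ∧ rank adj cod K n z u' + 1 = rank adj cod K n z u) ∨
        b.V 32 = 1 ∧ adj (b.V 35) (b.V 33) ∧ b.V 34 = rank adj cod K n z (b.V 35) ∧ 2 ≤ b.V 34 ∧
          ∀ u', adj u' (b.V 33) → rank adj cod K n z u' + 1 ≠ b.V 34) →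
      SortedArr (L * μ.B) (arr μ src b) →
      Holds adj (L * μ.B) (arr μ src b) (rankWord adj cod K n z) → b.t = a.t + 2 * L → Q b) :
    wp μ gapPass Q a := by
  have hW := P.word
  have hn := hG.n_lt
  have hKK : K ≤ inf := hG.le_inf hinf
  have hD := hG.digits_rankWord (z := z)
  refine wp_edgeScan P hinf hLW 32 36 (by norm_num) hD hD hr hh
    (GapInv adj cod K n z (arr μ src a)) ?_ ?_ ?_ ?_ ?_
  · intro p V V' hV
    rw [GapInv, GapInv, hV 24 (by norm_num), hV 25 (by norm_num), hV 32 (by norm_num),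
      hV 33 (by norm_num), hV 34 (by norm_num), hV 35 (by norm_num)]
    exact id
  · exact ⟨.inl ⟨by simp, h24, h25⟩, .inl ⟨h32, h34, by simp⟩⟩
  · rintro p V hp h0 ⟨h1, h2⟩
    refine ⟨?_, ?_⟩
    · rcases h1 with h1 | ⟨h1, v, h2, h3, h4⟩
      · refine .inl ⟨fun c hc => ?_, h1.2⟩
        by_cases hcp : c = p
        · rw [hcp, h0]
        · exact h1.1 c (by omega)
      · have h6 := hs (p - 1) p (by omega) hp
        have := hD.pos _ _ h2
        omega
    · refine h2.imp_left fun h2 => ⟨h2.1, h2.2.1, fun c hc u v huv he => ?_⟩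
      by_cases hcp : c = p
      · have := hD.pos _ _ huv
        rw [hcp] at he
        omega
      · exact h2.2.2 c (by omega) u v huv he
  · intro p b u v hp huv he h12 h20 h21 h22 h23 hfx hJ
    have hrk := rank_le (adj := adj) (cod := cod) (K := K) (n := n) (z := z) (u := u)
    have huK := hG.lt_K huv
    have hvK := hG.lt_K (hG.symm _ _ huv)
    have hvn := hG.lt _ _ (hG.symm _ _ huv)
    -- the common end of all branches
    have fin : ∀ c : Conf, Kept 32 36 b c → c.V 12 = rankWord adj cod K n z u v →
        c.V 20 = v → c.V 21 = rank adj cod K n z u →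
        (c.V 32 = 0 ∧ c.V 34 = 0 ∧ (∀ i < p + 1, ∀ u v, adj u v →
            arr μ src a i = rankWord adj cod K n z u v → 2 ≤ rank adj cod K n z u →
            ∃ u', adj u' v ∧ rank adj cod K n z u' + 1 = rank adj cod K n z u) ∨
          c.V 32 = 1 ∧ adj (c.V 35) (c.V 33) ∧ c.V 34 = rank adj cod K n z (c.V 35) ∧ 2 ≤ c.V 34 ∧
            ∀ u', adj u' (c.V 33) → rank adj cod K n z u' + 1 ≠ c.V 34) →
        wp μ (.seq (assign 24 (var 20)) (assign 25 (var 21)))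
          (fun c => Kept 32 36 b c ∧ c.V 12 = rankWord adj cod K n z u v ∧
            GapInv adj cod K n z (arr μ src a) (p + 1) c.V) c := by
      intro c hc c12 c20 c21 hJ
      refine wp_seq (wp_assign (by norm_num) (x := v) ?_ (by omega) ?_)
      · rw [eval_var (by norm_num), c20]
      refine wp_assign (by norm_num) (x := rank adj cod K n z u) ?_ (by omega) ?_
      · rw [eval_var (by norm_num)]; simpa using c21
      refine ⟨(hc.update _ _ (by norm_num)).update _ _ (by norm_num), by simpa using c12,
        .inr ⟨by omega, u, ?_, ?_, ?_⟩, ?_⟩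
      · simpa using huv
      · simpa using he
      · simp
      · simpa using hJ
    -- extending the search by one word
    have ext : ∀ c : Conf, (∀ x, 32 ≤ x → c.V x = b.V x) →
        (b.V 32 = 0 → 2 ≤ rank adj cod K n z u →
          ∃ u', adj u' v ∧ rank adj cod K n z u' + 1 = rank adj cod K n z u) →
        (c.V 32 = 0 ∧ c.V 34 = 0 ∧ (∀ i < p + 1, ∀ u v, adj u v →
            arr μ src a i = rankWord adj cod K n z u v → 2 ≤ rank adj cod K n z u →
            ∃ u', adj u' v ∧ rank adj cod K n z u' + 1 = rank adj cod K n z u) ∨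
          c.V 32 = 1 ∧ adj (c.V 35) (c.V 33) ∧ c.V 34 = rank adj cod K n z (c.V 35) ∧ 2 ≤ c.V 34 ∧
            ∀ u', adj u' (c.V 33) → rank adj cod K n z u' + 1 ≠ c.V 34) := by
      intro c hc hnew
      rw [hc 32 (by norm_num), hc 33 (by norm_num), hc 34 (by norm_num), hc 35 (by norm_num)]
      refine hJ.2.imp_left fun h2 => ⟨h2.1, h2.2.1, fun i hi u' v' huv' he' hrk' => ?_⟩
      by_cases hip : i = p
      · rw [hip, he] at he'
        obtain ⟨rfl, rfl⟩ := hD.inj _ _ _ _ huv huv' he'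
        exact hnew h2.1 hrk'
      · exact h2.2.2 i (by omega) u' v' huv' he' hrk'
    refine wp_seq (wp_ite_lt (x := 1) (y := rank adj cod K n z u) (eval_const _ _)
      (by rw [eval_var (by norm_num), h21]) ?_ ?_)
    · intro hr1
      have hc : (Expr.mul (eqE (var 20) (var 24)) (.lt (var 21) (.add (var 25) (.const 2)))).eval
          μ (b.st μ.M) ≠ 0 ↔ v = b.V 24 ∧ rank adj cod K n z u < b.V 25 + 2 := by
        rw [eval_mul, eval_eqE, eval_lt, eval_add, eval_const, eval_var (by norm_num),
          eval_var (by norm_num), eval_var (by norm_num), eval_var (by norm_num), h20, h21]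
        split_ifs with h1 h2 h2
        · simp [← h1, h2]
        · simp [h2]
        · simp [h1]
        · simp [h1]
      refine wp_ite (fun h => ?_) (fun h => ?_)
      · rw [hc] at h
        refine wp_skip (fin b (Kept.refl _ _ _) h12 h20 h21
          (ext b (fun _ _ => rfl) fun h32 _ => ?_))
        rcases hJ.1 with ⟨-, h3, -⟩ | ⟨h0, u0, h3, h4, h5⟩
        · omega
        · rw [← h.1] at h3 h4
          have h6 := hs (p - 1) p (by omega) hp
          rw [h4, he] at h6
          rcases hG.rankWord_le h3 huv h6 with h7 | ⟨-, h7⟩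
          · omega
          -- Equal ranks mean that the same word is repeated; its earlier copy has been dealt with.
          · by_cases h8 : rank adj cod K n z u0 = rank adj cod K n z u
            · have h9 := rank_inj hG (by omega) h8
              subst h9
              rcases hJ.2 with ⟨-, -, h9⟩ | ⟨h9, -⟩
              · exact h9 (p - 1) (by omega) _ _ h3 h4 (by omega)
              · omega
            · exact ⟨u0, h3, by omega⟩
      · have h' : ¬(v = b.V 24 ∧ rank adj cod K n z u < b.V 25 + 2) := by
          rw [← hc]; simpa using h
        refine wp_ite_eq (x := b.V 32) (y := 0) (eval_var (by norm_num) _) (eval_const _ _) ?_ ?_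
        · intro h32
          refine wp_seq (wp_assign (by norm_num) (x := 1) (eval_const _ _) (by omega) ?_)
          refine wp_seq (wp_assign (by norm_num) (x := v) ?_ (by omega) ?_)
          · rw [eval_var (by norm_num)]; simpa using h20
          refine wp_seq (wp_assign (by norm_num) (x := rank adj cod K n z u) ?_ (by omega) ?_)
          · rw [eval_var (by norm_num)]; simpa using h21
          refine wp_assign (by norm_num) (x := u) ?_ (by omega) ?_
          · rw [eval_var (by norm_num)]; simpa using h23
          refine fin _ (((((Kept.refl _ _ _).update _ _ (by norm_num)).update _ _
            (by norm_num)).update _ _ (by norm_num)).update _ _ (by norm_num)) (by simpa using h12)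
            (by simpa using h20) (by simpa using h21) (.inr ⟨by simp, by simpa using huv,
              by simp, by simpa using (show 2 ≤ rank adj cod K n z u from hr1), ?_⟩)
          simp only [Function.update_self, ne_eq, Nat.reduceEqDiff, not_false_eq_true,
            Function.update_of_ne]
          intro u' hu' hru
          obtain ⟨c, hcN, hce⟩ := hh.complete u' v hu'
          have hu'p := hD.pos _ _ hu'
          -- An edge into v whose rank is one less would have its word before position p. It would
          -- be at most the preceding word, which then had the same v and a rank of at least r - 1,
          -- so that no gap would have been reported.
          have hcp : c < p := by
            by_contra hcp
            have h6 := hs p c (by omega) hcN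
            rw [he, hce] at h6
            rcases hG.rankWord_le huv hu' h6 with h7 | ⟨-, h7⟩ <;> omega
          rcases hJ.1 with ⟨h3, -⟩ | ⟨h0, u0, h3, h4, h5⟩
          · have := h3 c hcp
            omega
          · have h6 := hs c (p - 1) (by omega) (by omega)
            rw [h4, hce] at h6
            have h7 := hs (p - 1) p (by omega) hp
            rw [h4, he] at h7
            have h8 := hG.rankWord_le hu' h3 h6
            have h9 := hG.rankWord_le h3 huv h7
            omega
        · intro h32
          exact wp_skip (fin b (Kept.refl _ _ _) h12 h20 h21
            (ext b (fun _ _ => rfl) fun h32' => absurd h32' h32))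
    · intro hr1
      exact wp_skip (fin b (Kept.refl _ _ _) h12 h20 h21
        (ext b (fun _ _ => rfl) fun _ h => by omega))
  · intro b b1 b2 hJ b3 b4 b5
    refine hQ b b1 (fun x hx hx' => b2 x ⟨by omega, by omega, by omega⟩) ?_
      (b5 (fun _ _ => rfl) hs) b3 b4
    refine hJ.2.imp_left fun h => ⟨h.1, h.2.1, fun u v huv hru => ?_⟩
    obtain ⟨c, hc, hce⟩ := hh.complete u v huv
    exact h.2.2 c hc u v huv hce hru

/-- The invariant of `exchangePass` on the sorted array `A` for a row `b` of rank `fr`. -/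
def ExchangeInv (adj : ℕ → ℕ → Prop) (cod : ℕ → ℕ) (K n z b fr : ℕ) (A : ℕ → ℕ) (p : ℕ)
    (V : ℕ → ℕ) : Prop :=
  V 37 = n ∧ (∀ c < p, ∀ u v, adj u v → A c = rankWord adj cod K n z u v →
      rank adj cod K n z u + 1 = fr → adj b v) ∨
  (∃ c < p, A c = rankWord adj cod K n z (V 36) (V 37)) ∧ adj (V 36) (V 37) ∧
    rank adj cod K n z (V 36) + 1 = fr ∧
    (∀ c < p, A c ≠ rankWord adj cod K n z b (V 37)) ∧
    (∀ c < p, ∀ u v, adj u v → A c = rankWord adj cod K n z u v →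
      rank adj cod K n z u + 1 = fr → v < V 37 → adj b v)

/-- In the group of each vertex the word of the row of rank `fr - 1` comes before that of the row b
of rank `fr`. The first one proposes the vertex as a candidate in variable 37, the second one
withdraws it; a candidate that is never withdrawn is adjacent to b' but not to b. The value n stands
for no candidate. The pass also restores canonical words, so it is run with `fr = 0` as well, in
which case nothing is claimed about the search. -/
lemma wp_exchangePass (P : Params μ L k inf) (hinf : K * K * K * K = inf) (hLW : L * μ.B < μ.W)
    (hG : Graphic adj cod K n) {z b fr : ℕ} (h37 : a.V 37 = n) (h34 : a.V 34 = fr)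
    (hfr : fr ≠ 0 → fr = rank adj cod K n z b ∧ 2 ≤ fr)
    (hr : Ready L k inf K n src dst a)
    (hh : Holds adj (L * μ.B) (arr μ src a) (rankWord adj cod K n z))
    (hs : SortedArr (L * μ.B) (arr μ src a))
    (hQ : ∀ c : Conf, Ready L k inf K n src dst c →
      (∀ x, 28 ≤ x → x < 36 ∨ 38 ≤ x → c.V x = a.V x) →
      (fr ≠ 0 → (∀ u v, adj u v → rank adj cod K n z u + 1 = fr → adj b v) ∨
        adj (c.V 36) (c.V 37) ∧ rank adj cod K n z (c.V 36) + 1 = fr ∧ ¬adj b (c.V 37)) →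
      Holds adj (L * μ.B) (arr μ src c) (edgeWord cod K) → c.t = a.t + 2 * L → Q c) :
    wp μ exchangePass Q a := by
  have hW := P.word
  have hn := hG.n_lt
  have hKK : K ≤ inf := hG.le_inf hinf
  have hD := hG.digits_rankWord (z := z)
  refine wp_edgeScan P hinf hLW 36 38 (by norm_num) hD hG.digits_edgeWord hr hh
    (fun p V => fr ≠ 0 → ExchangeInv adj cod K n z b fr (arr μ src a) p V) ?_ ?_ ?_ ?_ ?_
  · intro p V V' hV h hf
    rw [ExchangeInv, hV 36 (by norm_num), hV 37 (by norm_num)]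
    exact h hf
  · exact fun _ => .inl ⟨h37, by simp⟩
  · intro p V hp h0 h hf
    have h0' : ∀ u v, adj u v → arr μ src a p ≠ rankWord adj cod K n z u v := fun u v huv he => by
      have := hD.pos _ _ huv
      omega
    rcases h hf with ⟨h1, h2⟩ | ⟨⟨c, h1, h2⟩, h3, h4, h5, h6⟩
    · refine .inl ⟨h1, fun c hc u v huv he => ?_⟩
      by_cases hcp : c = p
      · exact absurd (hcp ▸ he) (h0' u v huv)
      · exact h2 c (by omega) u v huv he
    · have h7 := hs c p (by omega) hp
      have := hD.pos _ _ h3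
      omega
  · intro p d u v hp huv he h12 h20 h21 h22 h23 hfx hJ
    have hrk := rank_le (adj := adj) (cod := cod) (K := K) (n := n) (z := z) (u := u)
    have huK := hG.lt_K huv
    have hvK := hG.lt_K (hG.symm _ _ huv)
    have hvn := hG.lt _ _ (hG.symm _ _ huv)
    have hlt := hG.digits_edgeWord.lt huv
    have h18 : d.V 18 = K := (hfx 18 ⟨by norm_num, by norm_num, by norm_num⟩).trans hr.v18
    have h19 : d.V 19 = n := (hfx 19 ⟨by norm_num, by norm_num, by norm_num⟩).trans hr.v19
    have h34' : d.V 34 = fr := (hfx 34 ⟨by norm_num, by norm_num, by norm_num⟩).trans h34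
    have fin : ∀ c : Conf, Kept 36 38 d c → c.V 18 = K → c.V 20 = v → c.V 22 = cod u →
        c.V 23 = u → (fr ≠ 0 → ExchangeInv adj cod K n z b fr (arr μ src a) (p + 1) c.V) →
        wp μ (assign 12 (encE (var 22) (var 23) (.const 1) (var 20)))
          (fun c => Kept 36 38 d c ∧ c.V 12 = edgeWord cod K u v ∧
            (fr ≠ 0 → ExchangeInv adj cod K n z b fr (arr μ src a) (p + 1) c.V)) c := by
      intro c hc c18 c20 c22 c23 hJ
      refine wp_assign (by norm_num) (x := edgeWord cod K u v) ?_ (by omega) ?_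
      · rw [eval_encE (K := K) c18 (eval_var (by norm_num) _) (eval_var (by norm_num) _)
          (eval_const _ _) (eval_var (by norm_num) _), edgeWord, c20, c22, c23]
      · refine ⟨hc.update _ _ (by norm_num), by simp, fun hf => ?_⟩
        simpa [ExchangeInv] using hJ hf
    -- the earlier words are in place
    have hle : ∀ c < p, ∀ u' v', adj u' v' → arr μ src a c = rankWord adj cod K n z u' v' →
        v' < v ∨ v' = v ∧ rank adj cod K n z u' ≤ rank adj cod K n z u := by
      intro c hc u' v' huv' he'
      have := hs c p (by omega) hp
      rw [he, he'] at this
      exact hG.rankWord_le huv' huv this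
    have uniq : ∀ u' v', adj u' v' → arr μ src a p = rankWord adj cod K n z u' v' →
        u' = u ∧ v' = v := fun u' v' huv' he' =>
      hD.inj _ _ _ _ huv' huv (he'.symm.trans he)
    refine wp_seq (wp_ite_eq (x := rank adj cod K n z u + 1) (y := fr) ?_ ?_ ?_ ?_)
    · rw [eval_add, eval_var (by norm_num), h21, eval_const]
    · rw [eval_var (by norm_num), h34']
    · intro hru
      refine wp_seq (wp_assign (by norm_num) (x := u) ?_ (by omega) ?_)
      · rw [eval_var (by norm_num), h23]
      refine wp_ite_eq (x := d.V 37) (y := n) ?_ ?_ ?_ ?_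
      · rw [eval_var (by norm_num)]; simp
      · rw [eval_var (by norm_num)]; simpa using h19
      · intro h37n
        refine wp_assign (by norm_num) (x := v) ?_ (by omega) ?_
        · rw [eval_var (by norm_num)]; simpa using h20
        refine fin _ (((Kept.refl _ _ _).update _ _ (by norm_num)).update _ _
            (by norm_num)) (by simpa using h18) (by simpa using h20) (by simpa using h22)
            (by simpa using h23) fun hf => .inr ?_
        obtain ⟨hf1, hf2⟩ := hfr hf
        simp only [Function.update_self, ne_eq, Nat.reduceEqDiff, not_false_eq_true,
            Function.update_of_ne]
        refine ⟨⟨p, by omega, he⟩, huv, hru, fun c hc hce => ?_, fun c hc u' v' huv' he' hru' hv' => ?_⟩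
        -- A word of b in this group has a larger rank digit, so it cannot precede position p.
        · have h6 := hs c p (by omega) hp
          have hbz : adj b z := adj_of_rank_pos (adj := adj) (cod := cod) (K := K) (n := n)
            (by omega)
          have hrb := rank_le (adj := adj) (cod := cod) (K := K) (n := n) (z := z) (u := b)
          rw [he, hce, rankWord, rankWord, enc_le (by omega) (hG.cod_lt _ _ hbz) (hG.lt_K hbz)
            (by omega) (hG.cod_lt _ _ huv) huK] at h6
          omega
        · by_cases hcp : c = p
          · have := (uniq u' v' huv' (hcp ▸ he')).2
            omega
          · rcases hJ hf with ⟨h1, h2⟩ | ⟨-, h3, -⟩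
            · exact h2 c (by omega) u' v' huv' he' hru'
            · have := hG.lt _ _ (hG.symm _ _ h3)
              omega
      · intro h37n
        refine wp_skip (fin _ ((Kept.refl _ _ _).update _ _ (by norm_num)) (by simpa using h18)
          (by simpa using h20) (by simpa using h22) (by simpa using h23) fun hf => .inr ?_)
        obtain ⟨hf1, hf2⟩ := hfr hf
        simp only [Function.update_self, ne_eq, Nat.reduceEqDiff, not_false_eq_true,
            Function.update_of_ne]
        rcases hJ hf with ⟨h1, h2⟩ | ⟨⟨c, h1, h2⟩, h3, h4, h5, h6⟩
        · exact absurd h1 h37n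
        -- Only one vertex has rank `fr - 1`, so overwriting variable 36 changes nothing.
        have hu36 := rank_inj hG (adj := adj) (cod := cod) (K := K) (n := n) (z := z) (u := u)
          (u' := d.V 36) (by omega) (by omega)
        have hle36 := hle c h1 _ _ h3 h2
        rw [hu36]
        refine ⟨⟨c, by omega, h2⟩, h3, h4, fun i hi hie => ?_, fun i hi u' v' huv' he' hru' hv' => ?_⟩
        · by_cases hip : i = p
          · rw [hip, he, rankWord, rankWord] at hie
            have hbz : adj b z := adj_of_rank_pos (adj := adj) (cod := cod) (K := K) (n := n)
              (by omega)
            have hrb := rank_le (adj := adj) (cod := cod) (K := K) (n := n) (z := z) (u := b)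
            have := enc_inj (K := K) (by omega) (hG.cod_lt _ _ huv) huK (by omega)
              (hG.cod_lt _ _ hbz) (hG.lt_K hbz) hie
            omega
          · exact h5 i (by omega) hie
        · by_cases hip : i = p
          · have := (uniq u' v' huv' (hip ▸ he')).2
            omega
          · exact h6 i (by omega) u' v' huv' he' hru' hv'
    · intro hru
      -- a word of another row extends the invariant
      have other : (fr ≠ 0 → d.V 37 = n ∨ ¬(rank adj cod K n z u = fr ∧ v = d.V 37)) → fr ≠ 0 →
          ExchangeInv adj cod K n z b fr (arr μ src a) (p + 1) d.V := by
        intro hno hf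
        obtain ⟨hf1, hf2⟩ := hfr hf
        rcases hJ hf with ⟨h1, h2⟩ | ⟨⟨c, h1, h2⟩, h3, h4, h5, h6⟩
        · refine .inl ⟨h1, fun c hc u' v' huv' he' hru' => ?_⟩
          by_cases hcp : c = p
          · have := (uniq u' v' huv' (hcp ▸ he')).1
            rw [this] at hru'
            exact absurd hru' hru
          · exact h2 c (by omega) u' v' huv' he' hru'
        · have hlt37 := hG.lt _ _ (hG.symm _ _ h3)
          refine .inr ⟨⟨c, by omega, h2⟩, h3, h4, fun i hi hie => ?_,
            fun i hi u' v' huv' he' hru' hv' => ?_⟩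
          · by_cases hip : i = p
            · rw [hip, he, rankWord, rankWord] at hie
              have hbz : adj b z := adj_of_rank_pos (adj := adj) (cod := cod) (K := K) (n := n)
                (by omega)
              have hrb := rank_le (adj := adj) (cod := cod) (K := K) (n := n) (z := z) (u := b)
              have := enc_inj (K := K) (by omega) (hG.cod_lt _ _ huv) huK (by omega)
                (hG.cod_lt _ _ hbz) (hG.lt_K hbz) hie
              have := hno hf
              omega
            · exact h5 i (by omega) hie
          · by_cases hip : i = p
            · have := (uniq u' v' huv' (hip ▸ he')).1
              rw [this] at hru'
              exact absurd hru' hru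
            · exact h6 i (by omega) u' v' huv' he' hru' hv'
      refine wp_ite_eq (x := rank adj cod K n z u) (y := fr) ?_ ?_ ?_ ?_
      · rw [eval_var (by norm_num), h21]
      · rw [eval_var (by norm_num), h34']
      · intro hru2
        refine wp_ite_eq (x := v) (y := d.V 37) ?_ (eval_var (by norm_num) _) ?_ ?_
        · rw [eval_var (by norm_num), h20]
        · intro hv37
          refine wp_assign (by norm_num) (x := n) ?_ (by omega) ?_
          · rw [eval_var (by norm_num), h19]
          refine fin _ ((Kept.refl _ _ _).update _ _ (by norm_num)) (by simpa using h18)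
            (by simpa using h20) (by simpa using h22) (by simpa using h23) fun hf => .inl ?_
          obtain ⟨hf1, hf2⟩ := hfr hf
          -- Only b has rank `fr`, so this word shows that b is adjacent to the candidate. No word
          -- belongs to a later vertex yet, so the state without candidate is correct again.
          have hub := rank_inj hG (adj := adj) (cod := cod) (K := K) (n := n) (z := z) (u := u)
            (u' := b) (by omega) (by omega)
          refine ⟨by simp, fun c hc u' v' huv' he' hru' => ?_⟩
          by_cases hcp : c = p
          · have := (uniq u' v' huv' (hcp ▸ he')).2
            rw [this, ← hub]
            exact huv
          · rcases hJ hf with ⟨h1, h2⟩ | ⟨-, h3, h4, h5, h6⟩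
            · omega
            · rcases hle c (by omega) u' v' huv' he' with h7 | ⟨h7, -⟩
              · exact h6 c (by omega) u' v' huv' he' hru' (by omega)
              · rw [h7, ← hub]
                exact huv
        · intro hv37
          exact wp_skip (fin _ (Kept.refl _ _ _) h18 h20 h22 h23
            (other fun _ => .inr fun h => hv37 h.2))
      · intro hru2
        exact wp_skip (fin _ (Kept.refl _ _ _) h18 h20 h22 h23
          (other fun _ => .inr fun h => hru2 h.1))
  · intro c c1 c2 hJ c3 c4 _
    refine hQ c c1 (fun x hx hx' => c2 x ⟨by omega, by omega, by omega⟩) (fun hf => ?_) c3 c4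
    rcases hJ hf with ⟨h1, h2⟩ | ⟨-, h3, h4, h5, h6⟩
    · left
      intro u v huv hru
      obtain ⟨i, hi, hie⟩ := hh.complete u v huv
      exact h2 i hi u v huv hie hru
    · refine .inr ⟨h3, h4, fun h => ?_⟩
      obtain ⟨i, hi, hie⟩ := hh.complete _ _ h
      exact h5 i hi hie

end
end ExtMem
-- One complete check at a vertex: nested neighbourhoods or a conflict
namespace ExtMem

/-- Check whether the neighbourhoods of the neighbours of `z` are nested. -/
def check : Program :=
  .seq starPass (.seq mergeSort
    (.seq (.seq (assign 24 (var 19)) (.seq (assign 25 (.const 0)) (assign 26 (.const 0))))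
    (.seq rankPass (.seq mergeSort
    (.seq (.seq (assign 24 (var 19)) (.seq (assign 25 (.const 0)) (.seq (assign 32 (.const 0))
      (assign 34 (.const 0)))))
    (.seq gapPass (.seq (assign 37 (var 19)) exchangePass)))))))

/-- The rows of the neighbours of `z` are nested, and `y` is the first of them. -/
def Nested (adj : ℕ → ℕ → Prop) (cod : ℕ → ℕ) (K z y : ℕ) : Prop :=
  adj y z ∧ (∀ u, adj u z → key cod K y ≤ key cod K u) ∧
    ∀ u u' v, adj u z → adj u' z → key cod K u' ≤ key cod K u → adj u v → adj u' v

/-- Two neighbours `b` and `b'` of `z` with private neighbours `v` and `u`. -/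
def Conflict (adj : ℕ → ℕ → Prop) (z b b' v u : ℕ) : Prop :=
  adj b z ∧ adj b' z ∧ adj b v ∧ ¬adj b' v ∧ adj b' u ∧ ¬adj b u

section
variable {μ : Machine} [hμ : Fact (μ.extra = extraWords)] {Q : Conf → Prop} {a : Conf}
  {L k inf K n src dst : ℕ} {adj : ℕ → ℕ → Prop} {cod : ℕ → ℕ}

lemma nested_of_gap {z y : ℕ} (hG : Graphic adj cod K n) (hy : rank adj cod K n z y = 1)
    (h : ∀ u v, adj u v → 2 ≤ rank adj cod K n z u →
      ∃ u', adj u' v ∧ rank adj cod K n z u' + 1 = rank adj cod K n z u) :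
    Nested adj cod K z y := by
  have hyz : adj y z := adj_of_rank_pos (adj := adj) (cod := cod) (K := K) (n := n) (by omega)
  refine ⟨hyz, fun u hu => ?_, fun u u' v hu hu' hle hv => nested_of_rank_pred hG h hu hu' hle hv⟩
  rw [← rank_le_rank hG hyz hu, hy]
  exact rank_pos hG hu

/-- A vertex b' one rank before b is not adjacent to v because of the gap. The first alternative of
`h`, where the search for u failed, is impossible: that vertex has at least the degree of b and
lacks v, hence it has a neighbour that b lacks. -/
lemma conflict_of_gap {z b v b' u : ℕ} (hG : Graphic adj cod K n) (hbv : adj b v)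
    (hb : 2 ≤ rank adj cod K n z b)
    (hgap : ∀ u', adj u' v → rank adj cod K n z u' + 1 ≠ rank adj cod K n z b)
    (h : (∀ w x, adj w x → rank adj cod K n z w + 1 = rank adj cod K n z b → adj b x) ∨
      adj b' u ∧ rank adj cod K n z b' + 1 = rank adj cod K n z b ∧ ¬adj b u) :
    Conflict adj z b b' v u := by
  have hbz : adj b z := adj_of_rank_pos (adj := adj) (cod := cod) (K := K) (n := n) (by omega)
  rcases h with h | ⟨h1, h2, h3⟩
  · exfalso
    obtain ⟨w, hw⟩ := exists_rank_pred hG hb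
    have hwz : adj w z := adj_of_rank_pos (adj := adj) (cod := cod) (K := K) (n := n) (by omega)
    have hwv : ¬adj w v := fun h => hgap w h hw
    have hle := (rank_le_rank hG hwz hbz).1 (by omega)
    rw [key_le (hG.lt_K hwz) (hG.lt_K hbz)] at hle
    obtain ⟨x, hx1, hx2⟩ := hG.missing b w v (by omega) hbv hwv
    exact hx2 (h w x hx1 hw)
  · exact ⟨hbz, adj_of_rank_pos (adj := adj) (cod := cod) (K := K) (n := n) (by omega), hbv,
      fun h => hgap b' h h2, h1, h3⟩

/-- Four scans account for 8L and two sorts for the logarithmic term. No sort is needed between the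
last two scans, because the search for gaps leaves the words alone. The array is again in canonical
form at the end, so a second check can follow. -/
lemma wp_check (P : Params μ L k inf) (hinf : K * K * K * K = inf) (hLW : L * μ.B < μ.W)
    (hG : Graphic adj cod K n) {z : ℕ} (hz : a.V 30 = z) (hz' : ∃ u, adj u z)
    (hr : Ready L k inf K n src dst a) (hh : Holds adj (L * μ.B) (arr μ src a) (edgeWord cod K))
    (hQ : ∀ (b : Conf) (src' dst' : ℕ), Ready L k inf K n src' dst' b → b.V 30 = z →
      (b.V 32 = 0 ∧ Nested adj cod K z (b.V 31) ∨
        b.V 32 = 1 ∧ Conflict adj z (b.V 35) (b.V 36) (b.V 33) (b.V 37)) →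
      Holds adj (L * μ.B) (arr μ src' b) (edgeWord cod K) →
      b.t ≤ a.t + 8 * L + 6 * L * (1 + Nat.log k L) → Q b) :
    wp μ check Q a := by
  have hW := P.word
  have hn := hG.n_lt
  have hKK : K ≤ inf := hG.le_inf hinf
  have hK0 : 0 < K := by omega
  refine wp_seq (wp_starPass P hinf hLW hG hz hr hh fun b1 r1 f1 h1 t1 => ?_)
  refine wp_seq (wp_sortHolds P hinf hK0 r1 hG.digits_starWord h1 fun b2 s2 d2 r2 f2 o2 h2 t2 => ?_)
  refine wp_seq (wp_seq (wp_assign (by norm_num) (x := n) (by rw [eval_var (by norm_num), r2.v19])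
    (by omega) (wp_seq (wp_assign (by norm_num) (x := 0) (eval_const _ _) (by omega)
    (wp_assign (by norm_num) (x := 0) (eval_const _ _) (by omega) ?_)))))
  refine wp_seq (wp_rankPass P hinf hLW hG (src := s2) (dst := d2) (by simp) (by simp) (by simp)
    ⟨r2.twin, by simpa using r2.v13, by simpa using r2.v14, by simpa using r2.v15,
      by simpa using r2.v16, by simpa using r2.v17, by simpa using r2.v18, by simpa using r2.v19⟩
    h2 o2 hz' ?_)
  intro b3 r3 f3 top3 h3 t3
  refine wp_seq (wp_sortHolds P hinf hK0 r3 hG.digits_rankWord h3 fun b4 s4 d4 r4 f4 o4 h4 t4 => ?_)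
  refine wp_seq (wp_seq (wp_assign (by norm_num) (x := n) (by rw [eval_var (by norm_num), r4.v19])
    (by omega) (wp_seq (wp_assign (by norm_num) (x := 0) (eval_const _ _) (by omega)
    (wp_seq (wp_assign (by norm_num) (x := 0) (eval_const _ _) (by omega)
    (wp_assign (by norm_num) (x := 0) (eval_const _ _) (by omega) ?_)))))))
  refine wp_seq (wp_gapPass P hinf hLW hG (src := s4) (dst := d4) (by simp) (by simp) (by simp)
    (by simp)
    ⟨r4.twin, by simpa using r4.v13, by simpa using r4.v14, by simpa using r4.v15,
      by simpa using r4.v16, by simpa using r4.v17, by simpa using r4.v18, by simpa using r4.v19⟩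
    h4 o4 ?_)
  intro b5 r5 f5 g5 o5 h5 t5
  refine wp_seq (wp_assign (by norm_num) (x := n) (by rw [eval_var (by norm_num), r5.v19])
    (by omega) ?_)
  refine wp_exchangePass P hinf hLW hG (src := s4) (dst := d4) (z := z) (b := b5.V 35) (by simp)
    rfl ?_
    ⟨r5.twin, by simpa using r5.v13, by simpa using r5.v14, by simpa using r5.v15,
      by simpa using r5.v16, by simpa using r5.v17, by simpa using r5.v18, by simpa using r5.v19⟩
    h5 o5 ?_
  · simp only [ne_eq, Nat.reduceEqDiff, not_false_eq_true, Function.update_of_ne]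
    intro hf
    rcases g5 with ⟨-, g5, -⟩ | ⟨-, -, g5, g6, -⟩
    · exact absurd g5 hf
    · exact ⟨g5, g6⟩
  · simp only [ne_eq, Nat.reduceEqDiff, not_false_eq_true, Function.update_of_ne] at t3 t5 f3 f5 ⊢
    intro c r6 f6 g6 h6 t6
    have e5 : ∀ x, 28 ≤ x → x < 36 → c.V x = b5.V x := fun x hx hx' => by
      rw [f6 x hx (.inl hx')]
      exact Function.update_of_ne (by omega) _ _
    have e4 : ∀ x, 28 ≤ x → x < 32 ∨ 38 ≤ x → b5.V x = b4.V x := fun x hx hx' => by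
      rw [f5 x hx (by omega), Function.update_of_ne (by omega), Function.update_of_ne (by omega),
        Function.update_of_ne (by omega), Function.update_of_ne (by omega)]
    have e2 : ∀ x, 28 ≤ x → x ≠ 31 → b4.V x = a.V x := fun x hx hx' => by
      rw [f4 x (by omega), f3 x hx hx', Function.update_of_ne (by omega),
        Function.update_of_ne (by omega), Function.update_of_ne (by omega), f2 x (by omega),
        f1 x hx]
    refine hQ c s4 d4 r6 ?_ ?_ h6 ?_
    · rw [e5 30 (by norm_num) (by norm_num), e4 30 (by norm_num) (by norm_num),
        e2 30 (by norm_num) (by norm_num), hz]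
    · rw [e5 32 (by norm_num) (by norm_num), e5 31 (by norm_num) (by norm_num),
        e5 35 (by norm_num) (by norm_num), e5 33 (by norm_num) (by norm_num)]
      rcases g5 with ⟨g7, -, g8⟩ | ⟨g7, g8, g9, g10, g11⟩
      · refine .inl ⟨g7, nested_of_gap hG ?_ g8⟩
        rw [e4 31 (by norm_num) (by norm_num), f4 31 (by norm_num)]
        exact top3
      · refine .inr ⟨g7, conflict_of_gap hG g8 (by omega) (fun u' hu' => g9 ▸ g11 u' hu') ?_⟩
        rw [← g9]
        exact g6 (by omega)
    · have e : 6 * L * (1 + Nat.log k L) = 2 * (3 * L * (1 + Nat.log k L)) := by ring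
      omega

end
end ExtMem
namespace ExtMem

/-! ### Reporting the subgraph -/

/-- Record in variable `i` that the current edge joins the vertices in the variables `x`, `y`. -/
def flag (i x y : ℕ) : Program :=
  .ite (.mul (eqE (var 21) (var x)) (eqE (var 23) (var y))) (assign i (.const 1)) .skip

/-- Look up four adjacencies. -/
def lookupPass : Program := edgeScan
  (.seq (flag 40 35 36) (.seq (flag 41 30 33) (.seq (flag 42 30 37) (flag 43 33 37))))

/-- Prepare an answer of length `k`. -/
def setAnswer (k x₁ x₂ x₃ x₄ x₅ : ℕ) : Program :=
  .seq (assign 44 (.const k)) (.seq (assign 45 (var x₁)) (.seq (assign 46 (var x₂))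
    (.seq (assign 47 (var x₃)) (.seq (assign 48 (var x₄)) (assign 49 (var x₅))))))

/-- Choose the subgraph according to the adjacencies found. -/
def resolve : Program :=
  .ite (var 40) (setAnswer 3 30 35 36 30 30)
    (.ite (var 41) (setAnswer 3 30 35 33 30 30)
      (.ite (var 42) (setAnswer 3 30 36 37 30 30)
        (.ite (var 43) (setAnswer 5 30 35 33 37 36) (setAnswer 4 35 33 36 37 30))))

/-- Write the answer to external memory. -/
def output : Program :=
  .seq (.seq (.store (.const 0) (var 44)) (.seq (.store (.const 1) (var 45))
    (.seq (.store (.const 2) (var 46)) (.seq (.store (.const 3) (var 47))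
    (.seq (.store (.const 4) (var 48)) (.store (.const 5) (var 49)))))))
  (forLoop 9 (.div (.add (.const 5) .blockSize) .blockSize)
    (.write (.mul (var 9) .blockSize) (var 9)))

/-- Determine and write the answer from a conflict. -/
def report : Program :=
  .seq (.seq (assign 40 (.const 0)) (.seq (assign 41 (.const 0)) (.seq (assign 42 (.const 0))
    (assign 43 (.const 0))))) (.seq lookupPass (.seq resolve output))

/-- `X` starts with a triangle, a chordless pentagon or a pair of independent edges. -/
def Answer (adj : ℕ → ℕ → Prop) (X : ℕ → ℕ) : Prop :=
  X 0 = 3 ∧ adj (X 1) (X 2) ∧ adj (X 2) (X 3) ∧ adj (X 1) (X 3) ∨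
  X 0 = 5 ∧ (adj (X 1) (X 2) ∧ adj (X 2) (X 3) ∧ adj (X 3) (X 4) ∧ adj (X 4) (X 5) ∧
      adj (X 1) (X 5)) ∧
    ¬adj (X 1) (X 3) ∧ ¬adj (X 1) (X 4) ∧ ¬adj (X 2) (X 4) ∧ ¬adj (X 2) (X 5) ∧
      ¬adj (X 3) (X 5) ∨
  X 0 = 4 ∧ (adj (X 1) (X 2) ∧ adj (X 3) (X 4)) ∧
    ¬adj (X 1) (X 3) ∧ ¬adj (X 1) (X 4) ∧ ¬adj (X 2) (X 3) ∧ ¬adj (X 2) (X 4)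

lemma Answer.congr {adj : ℕ → ℕ → Prop} {X Y : ℕ → ℕ} (h : Answer adj X)
    (hXY : ∀ i < 6, Y i = X i) : Answer adj Y := by
  unfold Answer
  rw [hXY 0 (by norm_num), hXY 1 (by norm_num), hXY 2 (by norm_num), hXY 3 (by norm_num),
    hXY 4 (by norm_num), hXY 5 (by norm_num)]
  exact h

section
variable {μ : Machine} [hμ : Fact (μ.extra = extraWords)] {Q : Conf → Prop} {a : Conf}
  {L k inf K n src dst : ℕ} {adj : ℕ → ℕ → Prop} {cod : ℕ → ℕ}

lemma wp_flag {i x y u v x' y' : ℕ} (hi : i < 60) (hx : x < 60) (hy : y < 60) (hW : 1 < μ.W)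
    (h21 : a.V 21 = u) (h23 : a.V 23 = v) (hx' : a.V x = x') (hy' : a.V y = y')
    (hQ : ∀ V' : ℕ → ℕ, (∀ j, j ≠ i → V' j = a.V j) →
      (u = x' ∧ v = y' → V' i = 1) → (¬(u = x' ∧ v = y') → V' i = a.V i) →
      Q { a with V := V' }) : wp μ (flag i x y) Q a := by
  have hc : (Expr.mul (eqE (var 21) (var x)) (eqE (var 23) (var y))).eval μ (a.st μ.M) ≠ 0 ↔
      u = x' ∧ v = y' := by
    rw [eval_mul, eval_eqE, eval_eqE, eval_var (i := 21) (by norm_num),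
      eval_var (i := 23) (by norm_num), eval_var hx, eval_var hy, h21, h23, hx', hy']
    split_ifs <;> simp [*]
  refine wp_ite (fun h => ?_) (fun h => ?_)
  · rw [hc] at h
    refine wp_assign hi (x := 1) (eval_const _ _) hW (hQ _ (fun j hj => ?_) (fun _ => ?_) ?_)
    · exact Function.update_of_ne hj _ _
    · exact Function.update_self _ _ _
    · exact fun h' => absurd h h'
  · have h' : ¬(u = x' ∧ v = y') := by rw [← hc]; simpa using h
    exact wp_skip (hQ _ (fun _ _ => rfl) (fun h => absurd h h') fun _ => rfl)

/-- A flag tells whether `x` and `y` are joined by one of the edges seen so far. -/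
def FlagInv (adj : ℕ → ℕ → Prop) (cod : ℕ → ℕ) (K x y : ℕ) (A : ℕ → ℕ) (p f : ℕ) : Prop :=
  f = 1 ∧ adj x y ∨ f = 0 ∧ ∀ c < p, A c ≠ edgeWord cod K x y

lemma FlagInv.step {x y u v p f f' : ℕ} {A : ℕ → ℕ} (hG : Graphic adj cod K n)
    (h : FlagInv adj cod K x y A p f) (huv : adj u v) (he : A p = edgeWord cod K u v)
    (hxy : y < K) (hx : x < K)
    (h1 : u = x ∧ v = y → f' = 1) (h2 : ¬(u = x ∧ v = y) → f' = f) :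
    FlagInv adj cod K x y A (p + 1) f' := by
  have hn := hG.n_lt
  by_cases hc : u = x ∧ v = y
  · obtain ⟨rfl, rfl⟩ := hc
    exact .inl ⟨h1 ⟨rfl, rfl⟩, huv⟩
  · rw [h2 hc]
    refine h.imp_right fun h => ⟨h.1, fun c hcp hce => ?_⟩
    by_cases hcp' : c = p
    · rw [hcp', he] at hce
      have := enc_inj (hG.lt_K huv) (by omega) (hG.lt_K (hG.symm _ _ huv)) hx (by omega) hxy hce
      exact hc ⟨this.2.1, this.2.2.2⟩
    · exact h.2 c (by omega) hce

lemma FlagInv.zero {x y p f : ℕ} {A : ℕ → ℕ} (hG : Graphic adj cod K n)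
    (h : FlagInv adj cod K x y A p f) (h0 : A p = 0) : FlagInv adj cod K x y A (p + 1) f := by
  have hn := hG.n_lt
  refine h.imp_right fun h => ⟨h.1, fun c hcp hce => ?_⟩
  by_cases hcp' : c = p
  · have : 0 < edgeWord cod K x y := enc_pos (by omega) (by omega)
    rw [hcp'] at hce
    omega
  · exact h.2 c (by omega) hce

lemma FlagInv.adj_iff {x y N f : ℕ} {A : ℕ → ℕ} (h : FlagInv adj cod K x y A N f)
    (hh : Holds adj N A (edgeWord cod K)) :
    f = 1 ∧ adj x y ∨ f = 0 ∧ ¬adj x y := by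
  refine h.imp_right fun h => ⟨h.1, fun hxy => ?_⟩
  obtain ⟨c, hc, hce⟩ := hh.complete x y hxy
  exact h.2 c hc hce

/-- Both orientations of every edge are stored, so for each pair it suffices to watch for a single
word; its absence from the whole array proves nonadjacency. -/
lemma wp_lookupPass (P : Params μ L k inf) (hinf : K * K * K * K = inf) (hLW : L * μ.B < μ.W)
    (hG : Graphic adj cod K n) {z b b' v u : ℕ} (hz : a.V 30 = z) (hb : a.V 35 = b)
    (hb' : a.V 36 = b') (hv : a.V 33 = v) (hu : a.V 37 = u)
    (lz : z < K) (lb : b < K) (lb' : b' < K) (lv : v < K) (lu : u < K)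
    (h40 : a.V 40 = 0) (h41 : a.V 41 = 0) (h42 : a.V 42 = 0) (h43 : a.V 43 = 0)
    (hr : Ready L k inf K n src dst a) (hh : Holds adj (L * μ.B) (arr μ src a) (edgeWord cod K))
    (hQ : ∀ c : Conf, (∀ x, 28 ≤ x → x < 40 → c.V x = a.V x) →
      (c.V 40 = 1 ∧ adj b b' ∨ c.V 40 = 0 ∧ ¬adj b b') →
      (c.V 41 = 1 ∧ adj z v ∨ c.V 41 = 0 ∧ ¬adj z v) →
      (c.V 42 = 1 ∧ adj z u ∨ c.V 42 = 0 ∧ ¬adj z u) →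
      (c.V 43 = 1 ∧ adj v u ∨ c.V 43 = 0 ∧ ¬adj v u) → c.t = a.t + 2 * L → Q c) :
    wp μ lookupPass Q a := by
  have hW := P.word
  have hD := hG.digits_edgeWord
  refine wp_edgeScan P hinf hLW 40 44 (by norm_num) hD hD hr hh
    (fun p V => FlagInv adj cod K b b' (arr μ src a) p (V 40) ∧
      FlagInv adj cod K z v (arr μ src a) p (V 41) ∧
      FlagInv adj cod K z u (arr μ src a) p (V 42) ∧
      FlagInv adj cod K v u (arr μ src a) p (V 43)) ?_ ?_ ?_ ?_ ?_
  · intro p V V' hV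
    rw [hV 40 (by norm_num), hV 41 (by norm_num), hV 42 (by norm_num), hV 43 (by norm_num)]
    exact id
  · exact ⟨.inr ⟨h40, by simp⟩, .inr ⟨h41, by simp⟩, .inr ⟨h42, by simp⟩, .inr ⟨h43, by simp⟩⟩
  · rintro p V hp h0 ⟨h1, h2, h3, h4⟩
    exact ⟨h1.zero hG h0, h2.zero hG h0, h3.zero hG h0, h4.zero hG h0⟩
  · rintro p d x y hp hxy he h12 h20 h21 h22 h23 hfx ⟨h1, h2, h3, h4⟩
    have f30 : d.V 30 = z := (hfx 30 ⟨by norm_num, by norm_num, by norm_num⟩).trans hz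
    have f35 : d.V 35 = b := (hfx 35 ⟨by norm_num, by norm_num, by norm_num⟩).trans hb
    have f36 : d.V 36 = b' := (hfx 36 ⟨by norm_num, by norm_num, by norm_num⟩).trans hb'
    have f33 : d.V 33 = v := (hfx 33 ⟨by norm_num, by norm_num, by norm_num⟩).trans hv
    have f37 : d.V 37 = u := (hfx 37 ⟨by norm_num, by norm_num, by norm_num⟩).trans hu
    refine wp_seq (wp_flag (by norm_num) (by norm_num) (by norm_num) (by omega) h21 h23 f35 f36 ?_)
    intro V1 e1 g1 g1'
    refine wp_seq (wp_flag (by norm_num) (by norm_num) (by norm_num) (by omega)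
      ((e1 _ (by norm_num)).trans h21) ((e1 _ (by norm_num)).trans h23)
      ((e1 _ (by norm_num)).trans f30) ((e1 _ (by norm_num)).trans f33) ?_)
    intro V2 e2 g2 g2'
    simp only at e2 g2'
    refine wp_seq (wp_flag (by norm_num) (by norm_num) (by norm_num) (by omega)
      (((e2 _ (by norm_num)).trans (e1 _ (by norm_num))).trans h21)
      (((e2 _ (by norm_num)).trans (e1 _ (by norm_num))).trans h23)
      (((e2 _ (by norm_num)).trans (e1 _ (by norm_num))).trans f30)
      (((e2 _ (by norm_num)).trans (e1 _ (by norm_num))).trans f37) ?_)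
    intro V3 e3 g3 g3'
    simp only at e3 g3'
    have e31 : ∀ j, j < 40 → V3 j = d.V j := fun j hj => by
      rw [e3 j (by omega), e2 j (by omega), e1 j (by omega)]
    refine wp_flag (by norm_num) (by norm_num) (by norm_num) (by omega)
      ((e31 _ (by norm_num)).trans h21) ((e31 _ (by norm_num)).trans h23)
      ((e31 _ (by norm_num)).trans f33) ((e31 _ (by norm_num)).trans f37) ?_
    intro V4 e4 g4 g4'
    simp only at e4 g4'
    refine ⟨⟨rfl, rfl, rfl, fun j hj => ?_⟩, ?_, ?_, ?_, ?_, ?_⟩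
    · have : j < 40 ∨ 44 ≤ j := by
        rcases hj with hj | hj
        · omega
        · exact hj.2.2
      simp only
      rw [e4 j (by omega), e3 j (by omega), e2 j (by omega), e1 j (by omega)]
    · simp only
      rw [e4 _ (by norm_num), e31 _ (by norm_num), h12]
    · simp only
      rw [e4 _ (by norm_num), e3 _ (by norm_num), e2 _ (by norm_num)]
      exact h1.step hG hxy he lb' lb g1 g1'
    · simp only
      rw [e4 _ (by norm_num), e3 _ (by norm_num)]
      exact h2.step hG hxy he lv lz g2 fun h => (g2' h).trans (e1 _ (by norm_num))
    · simp only
      rw [e4 _ (by norm_num)]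
      exact h3.step hG hxy he lu lz g3 fun h =>
        (g3' h).trans ((e2 _ (by norm_num)).trans (e1 _ (by norm_num)))
    · exact h4.step hG hxy he lu lv g4 fun h =>
        (g4' h).trans ((e3 _ (by norm_num)).trans ((e2 _ (by norm_num)).trans (e1 _ (by norm_num))))
  · rintro c c1 c2 ⟨h1, h2, h3, h4⟩ c3 c4 -
    exact hQ c (fun x hx hx' => c2 x ⟨by omega, by omega, by omega⟩) (h1.adj_iff hh) (h2.adj_iff hh)
      (h3.adj_iff hh) (h4.adj_iff hh) c4

lemma wp_setAnswer {k x₁ x₂ x₃ x₄ x₅ : ℕ} (hk : k < μ.W)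
    (l1 : x₁ < 44 ∧ a.V x₁ < μ.W) (l2 : x₂ < 44 ∧ a.V x₂ < μ.W) (l3 : x₃ < 44 ∧ a.V x₃ < μ.W)
    (l4 : x₄ < 44 ∧ a.V x₄ < μ.W) (l5 : x₅ < 44 ∧ a.V x₅ < μ.W)
    (hQ : ∀ b : Conf, b.t = a.t → b.V 44 = k → b.V 45 = a.V x₁ → b.V 46 = a.V x₂ →
      b.V 47 = a.V x₃ → b.V 48 = a.V x₄ → b.V 49 = a.V x₅ → Q b) :
    wp μ (setAnswer k x₁ x₂ x₃ x₄ x₅) Q a := by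
  refine wp_seq (wp_assign (by norm_num) (x := k) (eval_const _ _) hk ?_)
  refine wp_seq (wp_assign (by norm_num) (x := a.V x₁) ?_ l1.2 ?_)
  · rw [eval_var (by omega)]
    exact Function.update_of_ne (by omega) _ _
  refine wp_seq (wp_assign (by norm_num) (x := a.V x₂) ?_ l2.2 ?_)
  · rw [eval_var (by omega)]
    simp only
    rw [Function.update_of_ne (by omega), Function.update_of_ne (by omega)]
  refine wp_seq (wp_assign (by norm_num) (x := a.V x₃) ?_ l3.2 ?_)
  · rw [eval_var (by omega)]
    simp only
    rw [Function.update_of_ne (by omega), Function.update_of_ne (by omega),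
      Function.update_of_ne (by omega)]
  refine wp_seq (wp_assign (by norm_num) (x := a.V x₄) ?_ l4.2 ?_)
  · rw [eval_var (by omega)]
    simp only
    rw [Function.update_of_ne (by omega), Function.update_of_ne (by omega),
      Function.update_of_ne (by omega), Function.update_of_ne (by omega)]
  refine wp_assign (by norm_num) (x := a.V x₅) ?_ l5.2 ?_
  · rw [eval_var (by omega)]
    simp only
    rw [Function.update_of_ne (by omega), Function.update_of_ne (by omega),
      Function.update_of_ne (by omega), Function.update_of_ne (by omega),
      Function.update_of_ne (by omega)]
  refine hQ _ rfl ?_ ?_ ?_ ?_ ?_ ?_ <;> simp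

/-- Six words are written whatever the length of the answer. They occupy ⌈6/B⌉ ≤ 6 blocks; for large
blocks the remaining words of the block are arbitrary. -/
lemma wp_output (hB : 1 ≤ μ.B) (hM : 2 * μ.B ≤ μ.M) (hMW : μ.M + 8 < μ.W)
    (hW : ∀ i < 6, a.V (44 + i) < μ.W)
    (hQ : ∀ b : Conf, (∀ i < 6, b.X i = a.V (44 + i)) → b.t ≤ a.t + 6 → Q b) :
    wp μ output Q a := by
  have w0 := hW 0 (by norm_num)
  have w1 := hW 1 (by norm_num)
  have w2 := hW 2 (by norm_num)
  have w3 := hW 3 (by norm_num)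
  have w4 := hW 4 (by norm_num)
  have w5 := hW 5 (by norm_num)
  simp only [Nat.reduceAdd] at w0 w1 w2 w3 w4 w5
  have hN : (5 + μ.B) / μ.B ≤ 6 := by
    rw [Nat.div_le_iff_le_mul_add_pred (by omega)]
    omega
  have hN' : 5 < (5 + μ.B) / μ.B * μ.B := by
    have := Nat.lt_div_mul_add (a := 5 + μ.B) (b := μ.B) (by omega)
    omega
  have hN'' : ∀ j < (5 + μ.B) / μ.B, j * μ.B ≤ 5 := by
    intro j hj
    have h1 := (Nat.le_div_iff_mul_le (by omega)).1 (show j + 1 ≤ (5 + μ.B) / μ.B from hj)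
    rw [Nat.succ_mul] at h1
    omega
  refine wp_seq (wp_seq (wp_store (y := 0) (eval_const _ _) (eval_var (by norm_num) _) (by omega)
    w0 ?_))
  refine wp_seq (wp_store (y := 1) (eval_const _ _) (eval_var (by norm_num) _) (by omega) w1 ?_)
  refine wp_seq (wp_store (y := 2) (eval_const _ _) (eval_var (by norm_num) _) (by omega) w2 ?_)
  refine wp_seq (wp_store (y := 3) (eval_const _ _) (eval_var (by norm_num) _) (by omega) w3 ?_)
  refine wp_seq (wp_store (y := 4) (eval_const _ _) (eval_var (by norm_num) _) (by omega) w4 ?_)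
  refine wp_store (y := 5) (eval_const _ _) (eval_var (by norm_num) _) (by omega) w5 ?_
  refine wp_for ((5 + μ.B) / μ.B) (fun j c => c.V 9 = j ∧ c.t = a.t + j ∧
    (∀ i < 6, c.D i = a.V (44 + i)) ∧ ∀ i < 6, i < j * μ.B → c.X i = a.V (44 + i))
    (by norm_num) (by omega) ?_ ?_ ?_ ?_
  · refine ⟨by simp, rfl, fun i hi => ?_, by intros; omega⟩
    simp only [Function.update_apply]
    interval_cases i <;> rfl
  · rintro j b - ⟨h1, -⟩
    exact ⟨h1, rfl⟩
  · rintro j b hj ⟨h1, h2, h3, h4⟩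
    have := hN'' j hj
    refine wp_write (y := j * μ.B) (x := j) ?_ ?_ (by omega) ?_
    · rw [eval_mul, eval_var (by norm_num), h1]; rfl
    · rw [eval_var (by norm_num), h1]
    refine ⟨h1, by simp, by simp only; omega, h3, fun i hi hij => ?_⟩
    simp only
    rw [Nat.succ_mul] at hij
    split_ifs with h
    · rw [← h3 i hi]
      congr 1
      omega
    · exact h4 i hi (by omega)
  · rintro b ⟨h1, h2, h3, h4⟩
    exact hQ b (fun i hi => h4 i hi (by omega)) (by omega)

/-- The conflict fixes the edges zb, zb', bv, b'u and the nonedges b'v, bu. The remaining pairs are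
bb', zv, zu and vu: an edge among the first three closes a triangle through z, and otherwise vu
distinguishes the pentagon from 2K₂. -/
lemma wp_report (P : Params μ L k inf) (hinf : K * K * K * K = inf) (hLW : L * μ.B < μ.W)
    (hM : 2 * μ.B ≤ μ.M)
    (hG : Graphic adj cod K n) {z b b' v u : ℕ} (hz : a.V 30 = z) (hb : a.V 35 = b)
    (hb' : a.V 36 = b') (hv : a.V 33 = v) (hu : a.V 37 = u) (hc : Conflict adj z b b' v u)
    (hr : Ready L k inf K n src dst a) (hh : Holds adj (L * μ.B) (arr μ src a) (edgeWord cod K))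
    (hQ : ∀ c : Conf, Answer adj c.X → c.t ≤ a.t + 2 * L + 6 → Q c) :
    wp μ report Q a := by
  have hW := P.word
  have hKK : K ≤ inf := hG.le_inf hinf
  obtain ⟨c1, c2, c3, c4, c5, c6⟩ := hc
  have lz := hG.lt_K (hG.symm _ _ c1)
  have lb := hG.lt_K c1
  have lb' := hG.lt_K c2
  have lv := hG.lt_K (hG.symm _ _ c3)
  have lu := hG.lt_K (hG.symm _ _ c5)
  refine wp_seq (wp_seq (wp_assign (by norm_num) (x := 0) (eval_const _ _) (by omega)
    (wp_seq (wp_assign (by norm_num) (x := 0) (eval_const _ _) (by omega)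
    (wp_seq (wp_assign (by norm_num) (x := 0) (eval_const _ _) (by omega)
    (wp_assign (by norm_num) (x := 0) (eval_const _ _) (by omega) ?_)))))))
  refine wp_seq (wp_lookupPass P hinf hLW hG (src := src) (dst := dst) (z := z) (b := b) (b' := b')
    (v := v) (u := u) (by simpa using hz) (by simpa using hb) (by simpa using hb')
    (by simpa using hv) (by simpa using hu) lz lb lb' lv lu (by simp) (by simp) (by simp) (by simp)
    ⟨hr.twin, by simpa using hr.v13, by simpa using hr.v14, by simpa using hr.v15,
      by simpa using hr.v16, by simpa using hr.v17, by simpa using hr.v18, by simpa using hr.v19⟩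
    hh ?_)
  intro c hc h40 h41 h42 h43 ht
  simp only at ht
  have e : ∀ x, 28 ≤ x → x < 40 → c.V x = a.V x := fun x hx hx' => by
    rw [hc x hx hx']
    simp only
    rw [Function.update_of_ne (by omega), Function.update_of_ne (by omega),
      Function.update_of_ne (by omega), Function.update_of_ne (by omega)]
  have e30 := (e 30 (by norm_num) (by norm_num)).trans hz
  have e33 := (e 33 (by norm_num) (by norm_num)).trans hv
  have e35 := (e 35 (by norm_num) (by norm_num)).trans hb
  have e36 := (e 36 (by norm_num) (by norm_num)).trans hb'
  have e37 := (e 37 (by norm_num) (by norm_num)).trans hu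
  have w30 : (30 < 44 ∧ c.V 30 < μ.W) := ⟨by norm_num, by omega⟩
  have w33 : (33 < 44 ∧ c.V 33 < μ.W) := ⟨by norm_num, by omega⟩
  have w35 : (35 < 44 ∧ c.V 35 < μ.W) := ⟨by norm_num, by omega⟩
  have w36 : (36 < 44 ∧ c.V 36 < μ.W) := ⟨by norm_num, by omega⟩
  have w37 : (37 < 44 ∧ c.V 37 < μ.W) := ⟨by norm_num, by omega⟩
  have fin : ∀ d : Conf, d.t = c.t → (∀ i < 6, d.V (44 + i) < μ.W) →
      Answer adj (fun i => d.V (44 + i)) → wp μ output Q d := by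
    intro d hd hdW hA
    exact wp_output P.B_pos hM (by omega) hdW fun e he het => hQ e (hA.congr he) (by omega)
  have s1 := hG.symm _ _ c1
  have s2 := hG.symm _ _ c2
  refine wp_seq (wp_ite (fun h => ?_) fun h => ?_)
  · rw [eval_var (by norm_num)] at h
    refine wp_setAnswer (by omega) w30 w35 w36 w30 w30 fun d dt d0 d1 d2 d3 d4 d5 =>
      fin d dt (fun i hi => ?_) (.inl ?_)
    · interval_cases i <;> simp only [Nat.reduceAdd] <;> omega
    · simp only [Nat.reduceAdd, d0, d1, d2, d3, e30, e35, e36]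
      exact ⟨trivial, s1, by tauto, s2⟩
  rw [eval_var (by norm_num)] at h
  refine wp_ite (fun h' => ?_) fun h' => ?_
  · rw [eval_var (by norm_num)] at h'
    refine wp_setAnswer (by omega) w30 w35 w33 w30 w30 fun d dt d0 d1 d2 d3 d4 d5 =>
      fin d dt (fun i hi => ?_) (.inl ?_)
    · interval_cases i <;> simp only [Nat.reduceAdd] <;> omega
    · simp only [Nat.reduceAdd, d0, d1, d2, d3, e30, e35, e33]
      exact ⟨trivial, s1, c3, by tauto⟩
  rw [eval_var (by norm_num)] at h'
  refine wp_ite (fun h'' => ?_) fun h'' => ?_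
  · rw [eval_var (by norm_num)] at h''
    refine wp_setAnswer (by omega) w30 w36 w37 w30 w30 fun d dt d0 d1 d2 d3 d4 d5 =>
      fin d dt (fun i hi => ?_) (.inl ?_)
    · interval_cases i <;> simp only [Nat.reduceAdd] <;> omega
    · simp only [Nat.reduceAdd, d0, d1, d2, d3, e30, e36, e37]
      exact ⟨trivial, s2, c5, by tauto⟩
  rw [eval_var (by norm_num)] at h''
  have n40 : ¬adj b b' := by
    rcases h40 with h | h
    exacts [by omega, h.2]
  have n41 : ¬adj z v := by
    rcases h41 with h | h
    exacts [by omega, h.2]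
  have n42 : ¬adj z u := by
    rcases h42 with h | h
    exacts [by omega, h.2]
  have flip : ∀ x y, ¬adj x y → ¬adj y x := fun x y h h' => h (hG.symm _ _ h')
  refine wp_ite (fun h3 => ?_) fun h3 => ?_
  · rw [eval_var (by norm_num)] at h3
    have n43 : adj v u := by
      rcases h43 with h | h
      exacts [h.2, by omega]
    refine wp_setAnswer (by omega) w30 w35 w33 w37 w36 fun d dt d0 d1 d2 d3 d4 d5 =>
      fin d dt (fun i hi => ?_) (.inr (.inl ?_))
    · interval_cases i <;> simp only [Nat.reduceAdd] <;> omega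
    · simp only [Nat.reduceAdd, d0, d1, d2, d3, d4, d5, e30, e33, e35, e36, e37]
      exact ⟨trivial, ⟨s1, c3, n43, hG.symm _ _ c5, s2⟩, n41, n42, c6, n40, flip _ _ c4⟩
  · rw [eval_var (by norm_num)] at h3
    have n43 : ¬adj v u := by
      rcases h43 with h | h
      exacts [by omega, h.2]
    refine wp_setAnswer (by omega) w35 w33 w36 w37 w30 fun d dt d0 d1 d2 d3 d4 d5 =>
      fin d dt (fun i hi => ?_) (.inr (.inr ?_))
    · interval_cases i <;> simp only [Nat.reduceAdd] <;> omega
    · simp only [Nat.reduceAdd, d0, d1, d2, d3, d4, e33, e35, e36, e37]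
      exact ⟨trivial, ⟨c3, c5⟩, n40, c6, flip _ _ c4, n43⟩

end
end ExtMem
namespace ExtMem

/-! ### Reading the adjacency row representation -/

/-- The array `X` holds the number `n`, the row starts `P 0, …, P n` and `e` row entries. -/
structure InputArray (adj : ℕ → ℕ → Prop) (deg : ℕ → ℕ) (n e : ℕ) (P X : ℕ → ℕ) : Prop where
  size : X 0 = n
  start : ∀ v ≤ n, X (v + 1) = P v
  P_zero : P 0 = 0
  P_succ : ∀ v < n, P (v + 1) = P v + deg v
  P_last : P n = e
  entry : ∀ v < n, ∀ j, P v ≤ j → j < P (v + 1) → adj v (X (n + 2 + j))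
  complete : ∀ v w, adj v w → ∃ j, P v ≤ j ∧ j < P (v + 1) ∧ X (n + 2 + j) = w
  lt : ∀ v w, adj v w → v < n ∧ w < n
  bound : ∀ c, X c ≤ n + e

/-- The word of the row of `u`. -/
def rowWord (cod P : ℕ → ℕ) (K u : ℕ) : ℕ := enc K (2 * P u + 1) u (cod u) 0

/-- The word of the row entry `w` at position `j`. -/
def entryWord (K j w : ℕ) : ℕ := enc K (2 * j + 2) w 0 0

/-- The nonzero words of `A` are the words of the rows and of the row entries. -/
structure RowArray (cod P E : ℕ → ℕ) (K n N : ℕ) (A : ℕ → ℕ) : Prop where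
  cases : ∀ p < N, A p = 0 ∨ (∃ u < n, A p = rowWord cod P K u) ∨
    ∃ v < n, ∃ j, P v ≤ j ∧ j < P (v + 1) ∧ A p = entryWord K j (E j)
  rows : ∀ u < n, ∃ p < N, A p = rowWord cod P K u
  entries : ∀ v < n, ∀ j, P v ≤ j → j < P (v + 1) → ∃ p < N, A p = entryWord K j (E j)

section
variable {adj : ℕ → ℕ → Prop} {deg cod P X : ℕ → ℕ} {n e : ℕ} (h : InputArray adj deg n e P X)
include h

lemma InputArray.mono {u v : ℕ} (huv : u ≤ v) (hv : v ≤ n) : P u ≤ P v := by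
  induction v with
  | zero => rw [Nat.le_zero.1 huv]
  | succ v ih =>
    by_cases huv' : u = v + 1
    · rw [huv']
    · rw [h.P_succ v hv]
      exact (ih (by omega) (by omega)).trans (Nat.le_add_right _ _)

lemma InputArray.le {u : ℕ} (hu : u ≤ n) : P u ≤ e := h.P_last ▸ h.mono hu le_rfl

lemma InputArray.deg_le {u : ℕ} (hu : u < n) : deg u ≤ e := by
  have h1 := h.P_succ u hu
  have h2 := h.le (u := u + 1) hu
  omega

/-- Take the least index whose start exceeds j and step back by one. This picks the right row even
if empty rows share the same start. -/
lemma InputArray.owner {j : ℕ} (hj : j < e) : ∃ v < n, P v ≤ j ∧ j < P (v + 1) := by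
  have h1 : ∃ v, j < P v := ⟨n, by rw [h.P_last]; exact hj⟩
  classical
  have h2 := Nat.find_spec h1
  have h3 : Nat.find h1 ≤ n := Nat.find_min' h1 (by rw [h.P_last]; exact hj)
  have h4 : Nat.find h1 ≠ 0 := fun h5 => by
    rw [h5, h.P_zero] at h2
    omega
  have h5 := Nat.find_min h1 (m := Nat.find h1 - 1) (by omega)
  refine ⟨Nat.find h1 - 1, by omega, by omega, ?_⟩
  rwa [Nat.sub_add_cancel (by omega)]

lemma InputArray.deg_pos {v w : ℕ} (hvw : adj v w) : 0 < deg v := by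
  obtain ⟨j, h1, h2, -⟩ := h.complete v w hvw
  have := h.P_succ v (h.lt v w hvw).1
  omega

lemma InputArray.exists_adj {v : ℕ} (hv : v < n) (hd : 0 < deg v) : ∃ w, adj v w := by
  have := h.P_succ v hv
  exact ⟨_, h.entry v hv (P v) le_rfl (by omega)⟩

end

/-- Turn the adjacency row representation into words, and find a vertex of maximum degree. -/
def rowPass : Program := scan
  (.ite (.lt (var 11) (.const 2)) (assign 12 (.const 0))
    (.ite (.lt (var 11) (.add (var 19) (.const 2)))
      (.seq (assign 26 (.sub (var 12) (var 24)))
        (.seq (.ite (.lt (var 25) (var 26))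
            (.seq (assign 25 (var 26)) (assign 30 (.sub (var 11) (.const 2)))) .skip)
          (.seq (assign 27 (var 12))
            (.seq (assign 12 (encE (.add (.mul (.const 2) (var 24)) (.const 1))
                (.sub (var 11) (.const 2)) (.sub (.sub (var 18) (.const 1)) (var 26)) (.const 0)))
              (assign 24 (var 27))))))
      (.ite (.lt (var 11) (var 38))
        (assign 12 (encE (.add (.mul (.const 2) (.sub (.sub (var 11) (var 19)) (.const 2)))
          (.const 2)) (var 12) (.const 0) (.const 0)))
        (assign 12 (.const 0)))))

/-- Join the row entries with their rows. -/
def joinPass : Program := scan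
  (.ite (.lt (.const 0) (var 12)) (.seq decode
    (.ite (.mod (var 20) (.const 2))
      (.seq (assign 24 (var 21)) (.seq (assign 25 (var 22)) (assign 12 (.const 0))))
      (assign 12 (encE (var 25) (var 24) (.const 1) (var 21))))) .skip)

/-- The words produced by `rowPass`. -/
def rowPassWord (cod P X : ℕ → ℕ) (K n e p : ℕ) : ℕ :=
  if p < 2 then 0 else if p < n + 2 then rowWord cod P K (p - 2)
    else if p < n + 2 + e then entryWord K (p - n - 2) (X p) else 0

section
variable {μ : Machine} [hμ : Fact (μ.extra = extraWords)] {Q : Conf → Prop} {a : Conf}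
  {L k inf K n e dst : ℕ} {adj : ℕ → ℕ → Prop} {deg cod P X : ℕ → ℕ}

lemma InputArray.rowWord_lt (h : InputArray adj deg n e P X) (hK : 4 * (n + 2 + e) = K)
    (hcod : ∀ u, cod u = K - 1 - deg u) {u : ℕ} (hu : u < n) :
    rowWord cod P K u < K * K * K * K := by
  have h1 := h.le hu.le
  exact enc_lt (by omega) (by omega) (by rw [hcod]; omega) (by omega)

lemma InputArray.entryWord_lt (h : InputArray adj deg n e P X) (hK : 4 * (n + 2 + e) = K)
    {j : ℕ} (hj : j < e) (c : ℕ) : entryWord K j (X c) < K * K * K * K := by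
  have h1 := h.bound c
  exact enc_lt (by omega) (by omega) (by omega) (by omega)

lemma InputArray.rowPassWord_lt (h : InputArray adj deg n e P X) (hK : 4 * (n + 2 + e) = K)
    (hcod : ∀ u, cod u = K - 1 - deg u) (p : ℕ) :
    rowPassWord cod P X K n e p < K * K * K * K := by
  have hK0 : 0 < K := by omega
  unfold rowPassWord
  split_ifs
  · positivity
  · exact h.rowWord_lt hK hcod (by omega)
  · exact h.entryWord_lt hK (by omega) _
  · positivity

/-- Any rearrangement of the words of `rowPass` qualifies; in particular, the array after sorting
does. -/
lemma InputArray.rowArray (h : InputArray adj deg n e P X) {N : ℕ} (hN : n + 2 + e ≤ N) {A : ℕ → ℕ}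
    (hA : ∀ y, (∃ p < N, A p = y) ↔ ∃ p < N, rowPassWord cod P X K n e p = y) :
    RowArray cod P (fun j => X (n + 2 + j)) K n N A := by
  constructor
  · intro p hp
    obtain ⟨q, hq, he⟩ := (hA (A p)).1 ⟨p, hp, rfl⟩
    rw [← he]
    unfold rowPassWord
    split_ifs with h1 h2 h3
    · exact .inl rfl
    · exact .inr (.inl ⟨q - 2, by omega, rfl⟩)
    · right; right
      obtain ⟨v, hv, hv1, hv2⟩ := h.owner (j := q - n - 2) (by omega)
      refine ⟨v, hv, q - n - 2, hv1, hv2, ?_⟩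
      congr 2
      omega
    · exact .inl rfl
  · intro u hu
    refine (hA _).2 ⟨u + 2, by omega, ?_⟩
    rw [rowPassWord, if_neg (by omega), if_pos (by omega), Nat.add_sub_cancel]
  · intro v hv j h1 h2
    have := h.le (u := v + 1) hv
    refine (hA _).2 ⟨n + 2 + j, by omega, ?_⟩
    rw [rowPassWord, if_neg (by omega), if_neg (by omega), if_pos (by omega)]
    congr 1
    omega

/-- A degree is the difference of two consecutive row starts, of which the earlier one is kept in
variable 24. Variable 30 is the first vertex to attain the largest degree in 25; while all degrees
are zero it keeps its initial value 0. Everything beyond the row entries is erased. -/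
lemma wp_rowPass (Pa : Params μ L k inf) (hinf : K * K * K * K = inf) (hLW : L * μ.B < μ.W)
    (h : InputArray adj deg n e P a.X) (hK : 4 * (n + 2 + e) = K)
    (hcod : ∀ u, cod u = K - 1 - deg u) (hr : Ready L k inf K n 0 dst a)
    (h24 : a.V 24 = 0) (h25 : a.V 25 = 0) (h30 : a.V 30 = 0) (h38 : a.V 38 = n + 2 + e) (hn : 0 < n)
    (hL : n + 2 + e ≤ L * μ.B)
    (hQ : ∀ b : Conf, Ready L k inf K n 0 dst b → b.V 30 < n → (∀ u < n, deg u ≤ deg (b.V 30)) →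
      (∀ c < L * μ.B, arr μ 0 b c = rowPassWord cod P a.X K n e c) → b.t = a.t + 2 * L → Q b) :
    wp μ rowPass Q a := by
  have hW := Pa.word
  have hKK : K ≤ inf := by
    rw [← hinf]
    have hK0 : 0 < K := by omega
    exact Nat.le_mul_of_pos_left _ (by positivity)
  refine wp_scan Pa 30 31 (by norm_num) (src := 0) (rowPassWord cod P a.X K n e)
    (fun p V => V 24 = P (min (p - 2) n) ∧ (∀ u < n, u + 2 < p → deg u ≤ V 25) ∧
      (V 25 = 0 ∧ V 30 = 0 ∨ V 30 < n ∧ V 25 = deg (V 30))) ?_ hr.v13 hr.v15 hLW ?_ ?_ ?_ ?_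
  · intro p V V' hV
    rw [hV 24 (by norm_num), hV 25 (by norm_num), hV 30 (by norm_num)]
    exact id
  · intro c _
    have := h.bound (0 * μ.B + c)
    omega
  · refine ⟨?_, fun u _ hu => by omega, .inl ⟨h25, h30⟩⟩
    rw [h24, Nat.zero_sub, Nat.zero_min, h.P_zero]
  · rintro p b hp h11 h12 hfx ⟨j1, j2, j3⟩
    have hfix : ∀ x, 13 ≤ x → x < 20 ∨ 31 ≤ x → b.V x = a.V x := fun x hx hx' =>
      hfx x ⟨hx, by omega, by omega⟩
    have h18 : b.V 18 = K := (hfix 18 (by norm_num) (by norm_num)).trans hr.v18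
    have h19 : b.V 19 = n := (hfix 19 (by norm_num) (by norm_num)).trans hr.v19
    have h38' : b.V 38 = n + 2 + e := (hfix 38 (by norm_num) (by norm_num)).trans h38
    rw [zero_mul, zero_add] at h12
    have hWp := h.rowPassWord_lt hK hcod p
    have hkept : ∀ c : Conf, Kept 30 31 b c → c.V 12 = rowPassWord cod P a.X K n e p →
        (c.V 24 = P (min (p + 1 - 2) n) ∧ (∀ u < n, u + 2 < p + 1 → deg u ≤ c.V 25) ∧
        (c.V 25 = 0 ∧ c.V 30 = 0 ∨ c.V 30 < n ∧ c.V 25 = deg (c.V 30))) →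
        c.D = b.D ∧ c.X = b.X ∧ c.t = b.t ∧
        (∀ x, 9 ≤ x → x ≤ 11 → c.V x = b.V x) ∧ (∀ x, Fixed 30 31 x → c.V x = b.V x) ∧
        c.V 12 = rowPassWord cod P a.X K n e p ∧ rowPassWord cod P a.X K n e p < μ.W ∧
        (c.V 24 = P (min (p + 1 - 2) n) ∧ (∀ u < n, u + 2 < p + 1 → deg u ≤ c.V 25) ∧
        (c.V 25 = 0 ∧ c.V 30 = 0 ∨ c.V 30 < n ∧ c.V 25 = deg (c.V 30))) :=
      fun c hc hc12 hJ => ⟨hc.D, hc.X, hc.t, fun x hx hx' => hc.V x (.inl ⟨hx, hx'⟩),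
        fun x hx => hc.V x (.inr hx), hc12, by omega, hJ⟩
    refine wp_ite_lt (x := p) (y := 2) (by rw [eval_var (by norm_num), h11]) (eval_const _ _) ?_ ?_
    · intro hp2
      refine wp_assign (by norm_num) (x := 0) (eval_const _ _) (by omega) (hkept _
        ((Kept.refl _ _ _).update _ _ (by norm_num)) ?_ ?_)
      · simp [rowPassWord, hp2]
      -- Truncated subtraction: at positions 0 and 1 the recorded start is still P 0 = 0.
      · have e1 : p + 1 - 2 = p - 2 := by omega
        simp only [ne_eq, Nat.reduceEqDiff, not_false_eq_true, Function.update_of_ne, e1]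
        exact ⟨j1, fun u hu hup => by omega, j3⟩
    intro hp2
    refine wp_ite_lt (x := p) (y := n + 2) (by rw [eval_var (by norm_num), h11])
      (by rw [eval_add, eval_var (by norm_num), h19, eval_const]) ?_ ?_
    · intro hpn
      have hu : p - 2 < n := by omega
      have hX : a.X p = P (p - 2 + 1) := by
        rw [← h.start (p - 2 + 1) (by omega)]
        congr 1; omega
      have hPd := h.P_succ (p - 2) hu
      have hPe := h.le (u := p - 2 + 1) (by omega)
      have hde := h.deg_le hu
      have hdW : deg (p - 2) < μ.W := by omega
      rw [min_eq_left hu.le] at j1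
      refine wp_seq (wp_assign (by norm_num) (x := deg (p - 2)) ?_ hdW ?_)
      · rw [eval_sub, eval_var (by norm_num), eval_var (by norm_num), h12, j1, hX]
        omega
      -- the common end
      have fin : ∀ c : Conf, Kept 30 31 b c → c.V 11 = p → c.V 12 = a.X p → c.V 18 = K →
          c.V 24 = P (p - 2) → c.V 26 = deg (p - 2) →
          (∀ u < n, u + 2 < p + 1 → deg u ≤ c.V 25) →
          (c.V 25 = 0 ∧ c.V 30 = 0 ∨ c.V 30 < n ∧ c.V 25 = deg (c.V 30)) →
          wp μ (.seq (assign 27 (var 12))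
            (.seq (assign 12 (encE (.add (.mul (.const 2) (var 24)) (.const 1))
                (.sub (var 11) (.const 2)) (.sub (.sub (var 18) (.const 1)) (var 26)) (.const 0)))
              (assign 24 (var 27)))) (fun c => c.D = b.D ∧ c.X = b.X ∧ c.t = b.t ∧
            (∀ x, 9 ≤ x → x ≤ 11 → c.V x = b.V x) ∧ (∀ x, Fixed 30 31 x → c.V x = b.V x) ∧
            c.V 12 = rowPassWord cod P a.X K n e p ∧ rowPassWord cod P a.X K n e p < μ.W ∧
            (c.V 24 = P (min (p + 1 - 2) n) ∧ (∀ u < n, u + 2 < p + 1 → deg u ≤ c.V 25) ∧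
            (c.V 25 = 0 ∧ c.V 30 = 0 ∨ c.V 30 < n ∧ c.V 25 = deg (c.V 30)))) c := by
        intro c hc c11 c12 c18 c24 c26 i1 i2
        have hbd := h.bound p
        refine wp_seq (wp_assign (by norm_num) (x := a.X p) ?_ (by omega) ?_)
        · rw [eval_var (by norm_num), c12]
        refine wp_seq (wp_assign (by norm_num) (x := rowPassWord cod P a.X K n e p) ?_
          (by omega) ?_)
        · rw [eval_encE (K := K) (x := 2 * P (p - 2) + 1) (y := p - 2) (z := cod (p - 2)) (w := 0)
            (by simpa using c18) ?_ ?_ ?_ (eval_const _ _)]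
          · rw [rowPassWord, if_neg (by omega), if_pos hpn, rowWord]
          · rw [eval_add, eval_mul, eval_const, eval_const, eval_var (by norm_num)]
            simp [c24]
          · rw [eval_sub, eval_const, eval_var (by norm_num)]
            simp [c11]
          · rw [eval_sub, eval_sub, eval_const, eval_var (by norm_num), eval_var (by norm_num),
              hcod]
            simp [c18, c26]
        refine wp_assign (by norm_num) (x := a.X p) ?_ (by omega) (hkept _
          (((hc.update _ _ (by norm_num)).update _ _ (by norm_num)).update _ _ (by norm_num))
          (by simp) ?_)
        · rw [eval_var (by norm_num)]; simp
        · have e1 : min (p + 1 - 2) n = p - 2 + 1 := by omega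
          simp only [ne_eq, Nat.reduceEqDiff, not_false_eq_true, Function.update_of_ne, e1,
            Function.update_self]
          exact ⟨hX, i1, i2⟩
      refine wp_seq (wp_ite_lt (x := b.V 25) (y := deg (p - 2)) ?_ ?_ ?_ ?_)
      · rw [eval_var (by norm_num)]; simp
      · rw [eval_var (by norm_num)]; simp
      · intro hlt
        refine wp_seq (wp_assign (by norm_num) (x := deg (p - 2)) ?_ hdW ?_)
        · rw [eval_var (by norm_num)]; simp
        refine wp_assign (by norm_num) (x := p - 2) ?_ (by omega) ?_
        · rw [eval_sub, eval_var (by norm_num), eval_const]; simp [h11]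
        refine fin _ ((((Kept.refl _ _ _).update _ _ (by norm_num)).update _ _
          (by norm_num)).update _ _ (by norm_num)) (by simpa using h11) (by simpa using h12)
          (by simpa using h18) (by simpa using j1) (by simp) ?_ ?_
        · simp only [ne_eq, Nat.reduceEqDiff, not_false_eq_true, Function.update_of_ne,
            Function.update_self]
          intro u hu hup
          by_cases hup' : u = p - 2
          · rw [hup']
          · exact (j2 u hu (by omega)).trans hlt.le
        · right; simpa using hu
      · intro hge
        refine wp_skip (fin _ ((Kept.refl _ _ _).update _ _ (by norm_num)) (by simpa using h11)
          (by simpa using h12) (by simpa using h18) (by simpa using j1) (by simp) ?_ ?_)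
        · simp only [ne_eq, Nat.reduceEqDiff, not_false_eq_true, Function.update_of_ne]
          intro u hu hup
          by_cases hup' : u = p - 2
          · rw [hup']; exact hge
          · exact j2 u hu (by omega)
        · simpa using j3
    intro hpn
    have hJ : ∀ x, (fun V : ℕ → ℕ => V 24 = P (min (p + 1 - 2) n) ∧
        (∀ u < n, u + 2 < p + 1 → deg u ≤ V 25) ∧
        (V 25 = 0 ∧ V 30 = 0 ∨ V 30 < n ∧ V 25 = deg (V 30))) (Function.update b.V 12 x) := by
      intro x
      have e1 : min (p + 1 - 2) n = min (p - 2) n := by omega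
      simp only [ne_eq, Nat.reduceEqDiff, not_false_eq_true, Function.update_of_ne, e1]
      exact ⟨j1, fun u hu hup => j2 u hu (by omega), j3⟩
    refine wp_ite_lt (x := p) (y := n + 2 + e) (by rw [eval_var (by norm_num), h11])
      (by rw [eval_var (by norm_num), h38']) ?_ ?_
    · intro hpe
      refine wp_assign (by norm_num) (x := rowPassWord cod P a.X K n e p) ?_ (by omega) (hkept _
        ((Kept.refl _ _ _).update _ _ (by norm_num)) (by simp) (hJ 0))
      rw [eval_encE (K := K) (x := 2 * (p - n - 2) + 2) (y := a.X p) (z := 0) (w := 0) h18 ?_ ?_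
        (eval_const _ _) (eval_const _ _)]
      · rw [rowPassWord, if_neg (by omega), if_neg (by omega), if_pos hpe, entryWord]
      · rw [eval_add, eval_mul, eval_sub, eval_sub, eval_const, eval_var (by norm_num),
          eval_var (by norm_num), h11, h19]
      · rw [eval_var (by norm_num), h12]
    · intro hpe
      refine wp_assign (by norm_num) (x := 0) (eval_const _ _) (by omega) (hkept _
        ((Kept.refl _ _ _).update _ _ (by norm_num)) ?_ (hJ 0))
      rw [rowPassWord, if_neg (by omega), if_neg (by omega), if_neg (by omega)]
      simp
  · rintro b b1 ⟨b2, b3, b4⟩ b5 b6 b7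
    refine hQ b (hr.of_eq fun x hx hx' => b1 x ⟨hx, .inl hx', by omega⟩) ?_ (fun u hu => ?_) b5 b7
    · rcases b4 with ⟨-, b4⟩ | ⟨b4, -⟩ <;> omega
    · have := b3 u hu (by omega)
      rcases b4 with ⟨b4, -⟩ | ⟨-, b4⟩ <;> omega

/-- The leading digits 2P(u) + 1 of rows and 2j + 2 of entries have different parity and interleave:
the row of u precedes precisely the entries at positions j ≥ P(u). In sorted order, the last row met
before an entry is therefore its owner, and the number and complementary degree of that row are at
hand in variables 24 and 25. -/
lemma wp_joinPass {src : ℕ} (Pa : Params μ L k inf) (hinf : K * K * K * K = inf)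
    (hLW : L * μ.B < μ.W)
    (h : InputArray adj deg n e P X) (hK : 4 * (n + 2 + e) = K)
    (hcod : ∀ u, cod u = K - 1 - deg u) (hr : Ready L k inf K n src dst a)
    (hh : RowArray cod P (fun j => X (n + 2 + j)) K n (L * μ.B) (arr μ src a))
    (hs : SortedArr (L * μ.B) (arr μ src a))
    (hQ : ∀ b : Conf, Ready L k inf K n src dst b → b.V 30 = a.V 30 →
      Holds adj (L * μ.B) (arr μ src b) (edgeWord cod K) → b.t = a.t + 2 * L → Q b) :
    wp μ joinPass Q a := by
  have hW := Pa.word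
  have hK0 : 0 < K := by omega
  have hKK : K ≤ inf := by
    rw [← hinf]
    exact Nat.le_mul_of_pos_left _ (by positivity)
  have hPK : ∀ u < n, 2 * P u + 1 < K := fun u hu => by have := h.le hu.le; omega
  have hcK : ∀ u, cod u < K := fun u => by rw [hcod]; omega
  have hrow0 : ∀ u, 0 < rowWord cod P K u := fun u => enc_pos hK0 (by omega)
  have hent0 : ∀ j w, 0 < entryWord K j w := fun j w => enc_pos hK0 (by omega)
  have hXK : ∀ c, X c < K := fun c => by have := h.bound c; omega
  -- Empty rows share their start with the next row; the second digit then orders them by vertex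
  -- number.
  have row_le : ∀ u < n, ∀ u' < n, rowWord cod P K u' ≤ rowWord cod P K u → u' ≤ u := by
    intro u hu u' hu' hle
    rw [rowWord, rowWord, enc_le (by omega) (hcK _) hK0 (by omega) (hcK _) hK0] at hle
    by_contra hlt
    have := h.mono (u := u) (v := u') (by omega) hu'.le
    omega
  have row_le_ent : ∀ u < n, ∀ j w, w < K → (rowWord cod P K u ≤ entryWord K j w ↔ P u ≤ j) := by
    intro u hu j w hw
    rw [rowWord, entryWord, enc_le (by omega) (hcK _) hK0 hw hK0 hK0]
    omega
  have row_ne_ent : ∀ u < n, ∀ j w, w < K → rowWord cod P K u ≠ entryWord K j w := by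
    intro u hu j w hw he
    have := enc_inj (by omega) (hcK _) hK0 hw hK0 hK0 he
    omega
  have ent_inj : ∀ j w j' w', w < K → w' < K → entryWord K j w = entryWord K j' w' →
      j = j' ∧ w = w' := by
    intro j w j' w' hw hw' he
    have := enc_inj hw hK0 hK0 hw' hK0 hK0 he
    omega
  have own_inj : ∀ v < n, ∀ v' < n, ∀ j, P v ≤ j → j < P (v + 1) → P v' ≤ j → j < P (v' + 1) →
      v = v' := by
    intro v hv v' hv' j h1 h2 h3 h4
    rcases lt_trichotomy v v' with h5 | h5 | h5
    · have := h.mono (u := v + 1) (v := v') h5 hv'.le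
      omega
    · exact h5
    · have := h.mono (u := v' + 1) (v := v) h5 hv.le
      omega
  -- the new words
  have hG : ∀ p, ∃ y, p < L * μ.B →
      (arr μ src a p = 0 → y = 0) ∧ (∀ u < n, arr μ src a p = rowWord cod P K u → y = 0) ∧
      ∀ v < n, ∀ j, P v ≤ j → j < P (v + 1) → arr μ src a p = entryWord K j (X (n + 2 + j)) →
        y = edgeWord cod K v (X (n + 2 + j)) := by
    intro p
    by_cases hp : p < L * μ.B
    swap
    · exact ⟨0, fun h => absurd h hp⟩
    rcases hh.cases p hp with h0 | ⟨u, hu, hw⟩ | ⟨v, hv, j, h1, h2, hw⟩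
    · refine ⟨0, fun _ => ⟨fun _ => rfl, fun _ _ _ => rfl, fun v hv j h1 h2 he => ?_⟩⟩
      have := hent0 j (X (n + 2 + j))
      omega
    · refine ⟨0, fun _ => ⟨fun _ => rfl, fun _ _ _ => rfl, fun v hv j h1 h2 he => ?_⟩⟩
      exact absurd (hw.symm.trans he) (row_ne_ent u hu _ _ (hXK _))
    · refine ⟨edgeWord cod K v (X (n + 2 + j)), fun _ => ⟨fun h0 => ?_, fun u hu he => ?_,
        fun v' hv' j' h1' h2' he => ?_⟩⟩
      · have := hent0 j (X (n + 2 + j))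
        omega
      · exact absurd (he.symm.trans hw) (row_ne_ent u hu _ _ (hXK _))
      · have h3 := (ent_inj _ _ _ _ (hXK _) (hXK _) (hw.symm.trans he)).1
        subst h3
        rw [own_inj v hv v' hv' j h1 h2 h1' h2']
  choose G hG using hG
  have hGW : ∀ p < L * μ.B, G p < μ.W := by
    intro p hp
    obtain ⟨g1, g2, g3⟩ := hG p hp
    rcases hh.cases p hp with h0 | ⟨u, hu, hw⟩ | ⟨v, hv, j, h1, h2, hw⟩
    · rw [g1 h0]; omega
    · rw [g2 u hu hw]; omega
    · rw [g3 v hv j h1 h2 hw]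
      have : edgeWord cod K v (X (n + 2 + j)) < K * K * K * K :=
        enc_lt (hcK _) (by omega) (by omega) (hXK _)
      omega
  refine wp_scan Pa 20 20 le_rfl (src := src) G
    (fun p V => (∀ u < n, (∃ c < p, arr μ src a c = rowWord cod P K u) → u ≤ V 24) ∧
      ((∃ c < p, arr μ src a c = rowWord cod P K (V 24)) ∧ V 24 < n ∧ V 25 = cod (V 24) ∨
        ∀ u < n, ∀ c < p, arr μ src a c ≠ rowWord cod P K u)) ?_ hr.v13 hr.v15 hLW ?_ ?_ ?_ ?_
  · intro p V V' hV
    rw [hV 24 (by norm_num), hV 25 (by norm_num)]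
    exact id
  · intro c hc
    change arr μ src a c < _
    rcases hh.cases c hc with h0 | ⟨u, hu, hw⟩ | ⟨v, hv, j, h1, h2, hw⟩
    · omega
    · have := h.rowWord_lt hK hcod hu
      omega
    · have h3 := h.le (u := v + 1) hv
      have := h.entryWord_lt hK (j := j) (by omega) (n + 2 + j)
      omega
  · exact ⟨fun u _ ⟨c, hc, _⟩ => by omega, .inr fun _ _ c hc => by omega⟩
  · rintro p b hp h11 h12 hfx ⟨j1, j2⟩
    have h18 : b.V 18 = K := (hfx 18 ⟨by norm_num, by norm_num, by norm_num⟩).trans hr.v18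
    replace h12 : b.V 12 = arr μ src a p := h12
    obtain ⟨g1, g2, g3⟩ := hG p hp
    have hGp := hGW p hp
    -- a word that is not a row word leaves the invariant
    have keep : ∀ V : ℕ → ℕ, V 24 = b.V 24 → V 25 = b.V 25 →
        (∀ u < n, arr μ src a p ≠ rowWord cod P K u) →
        (∀ u < n, (∃ c < p + 1, arr μ src a c = rowWord cod P K u) → u ≤ V 24) ∧
        ((∃ c < p + 1, arr μ src a c = rowWord cod P K (V 24)) ∧ V 24 < n ∧ V 25 = cod (V 24) ∨
          ∀ u < n, ∀ c < p + 1, arr μ src a c ≠ rowWord cod P K u) := by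
      intro V v24 v25 hno
      rw [v24, v25]
      refine ⟨fun u hu ⟨c, hc, hce⟩ => ?_, ?_⟩
      · by_cases hcp : c = p
        · exact absurd (hcp ▸ hce) (hno u hu)
        · exact j1 u hu ⟨c, by omega, hce⟩
      · refine j2.imp (fun ⟨⟨c, hc, hce⟩, h4⟩ => ⟨⟨c, by omega, hce⟩, h4⟩) fun h5 u hu c hc => ?_
        by_cases hcp : c = p
        · rw [hcp]; exact hno u hu
        · exact h5 u hu c (by omega)
    have hkept : ∀ c : Conf, Kept 20 20 b c → c.V 12 = G p →
        ((∀ u < n, (∃ i < p + 1, arr μ src a i = rowWord cod P K u) → u ≤ c.V 24) ∧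
        ((∃ i < p + 1, arr μ src a i = rowWord cod P K (c.V 24)) ∧ c.V 24 < n ∧
          c.V 25 = cod (c.V 24) ∨ ∀ u < n, ∀ i < p + 1, arr μ src a i ≠ rowWord cod P K u)) →
        c.D = b.D ∧ c.X = b.X ∧ c.t = b.t ∧
        (∀ x, 9 ≤ x → x ≤ 11 → c.V x = b.V x) ∧ (∀ x, Fixed 20 20 x → c.V x = b.V x) ∧
        c.V 12 = G p ∧ G p < μ.W ∧
        ((∀ u < n, (∃ i < p + 1, arr μ src a i = rowWord cod P K u) → u ≤ c.V 24) ∧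
        ((∃ i < p + 1, arr μ src a i = rowWord cod P K (c.V 24)) ∧ c.V 24 < n ∧
          c.V 25 = cod (c.V 24) ∨ ∀ u < n, ∀ i < p + 1, arr μ src a i ≠ rowWord cod P K u)) :=
      fun c hc hc12 hJ => ⟨hc.D, hc.X, hc.t, fun x hx hx' => hc.V x (.inl ⟨hx, hx'⟩),
        fun x hx => hc.V x (.inr hx), hc12, hGp, hJ⟩
    have hdec : ∀ c : Conf, c.D = b.D → c.X = b.X → c.t = b.t →
        (∀ i, i < 20 ∨ 24 ≤ i → c.V i = b.V i) → Kept 20 20 b c := by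
      intro c c1 c2 c3 c4
      refine ⟨c1, c2, c3, fun x hx => c4 x ?_⟩
      rcases hx with hx | hx
      · omega
      · have := hx.2.1
        omega
    rcases hh.cases p hp with h0 | ⟨u, hu, hw⟩ | ⟨v, hv, j, h1, h2, hw⟩
    · refine wp_ite_lt (x := 0) (y := 0) (eval_const _ _) (by rw [eval_var (by norm_num), h12, h0])
        (fun h => by omega) fun _ => wp_skip ?_
      refine hkept b (Kept.refl _ _ _) ?_ (keep _ rfl rfl fun u hu he => ?_)
      · rw [h12, h0, g1 h0]
      · have := hrow0 u
        omega
    · have hlt := h.rowWord_lt hK hcod hu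
      refine wp_ite_lt (x := 0) (y := rowWord cod P K u) (eval_const _ _)
        (by rw [eval_var (by norm_num), h12, hw]) (fun _ => ?_)
        fun h => by have := hrow0 u; omega
      refine wp_seq (wp_decode (K := K) (x := 2 * P u + 1) (y := u) (z := cod u) (w := 0) h18
        (by rw [h12, hw, rowWord]) (by omega) (hcK _) hK0 (by rw [← rowWord]; omega) ?_)
      intro c c1 c2 c3 c4 c20 c21 c22 c23
      have hmod : (Expr.mod (var 20) (.const 2)).eval μ (c.st μ.M) = 1 := by
        rw [eval_mod, eval_var (by norm_num), c20, eval_const]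
        omega
      refine wp_ite (fun _ => ?_) fun h => by omega
      have hcW := hcK u
      refine wp_seq (wp_assign (by norm_num) (x := u) (by rw [eval_var (by norm_num), c21])
        (by omega) ?_)
      refine wp_seq (wp_assign (by norm_num) (x := cod u) ?_ (by omega) ?_)
      · rw [eval_var (by norm_num)]; simpa using c22
      refine wp_assign (by norm_num) (x := 0) (eval_const _ _) (by omega) (hkept _
        ((((hdec c c1 c2 c3 c4).update _ _ (by norm_num)).update _ _ (by norm_num)).update _ _
          (by norm_num)) ?_ ?_)
      · simp [g2 u hu hw]
      · simp only [ne_eq, Nat.reduceEqDiff, not_false_eq_true, Function.update_of_ne,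
          Function.update_self]
        refine ⟨fun u' hu' ⟨i, hi, hie⟩ => row_le u hu u' hu' ?_, .inl ⟨⟨p, by omega, hw⟩, hu, trivial⟩⟩
        rw [← hie, ← hw]
        exact hs i p (by omega) hp
    · have h3 := h.le (u := v + 1) hv
      have hlt := h.entryWord_lt hK (j := j) (by omega) (n + 2 + j)
      refine wp_ite_lt (x := 0) (y := entryWord K j (X (n + 2 + j))) (eval_const _ _)
        (by rw [eval_var (by norm_num), h12, hw]) (fun _ => ?_)
        fun h => by have := hent0 j (X (n + 2 + j)); omega
      refine wp_seq (wp_decode (K := K) (x := 2 * j + 2) (y := X (n + 2 + j)) (z := 0) (w := 0) h18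
        (by rw [h12, hw, entryWord]) (hXK _) hK0 hK0 (by rw [← entryWord]; omega) ?_)
      intro c c1 c2 c3 c4 c20 c21 c22 c23
      have hmod : (Expr.mod (var 20) (.const 2)).eval μ (c.st μ.M) = 0 := by
        rw [eval_mod, eval_var (by norm_num), c20, eval_const]
        omega
      refine wp_ite (fun h => absurd hmod h) fun _ => ?_
      obtain ⟨i, hi, hie⟩ := hh.rows v hv
      -- The word of the owner is smaller than the entry, so it has been read.
      have hip : i < p := by
        by_contra hip
        have h4 := hs p i (by omega) hi
        rw [hie, hw] at h4
        have h5 := (row_le_ent v hv j (X (n + 2 + j)) (hXK _)).2 h1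
        exact row_ne_ent v hv _ _ (hXK _) (le_antisymm h5 h4)
      -- The current row is at least v, since row v has been read. If it were larger, its start
      -- would be at least P(v + 1) > j, and its word would come after this entry.
      have hcur : b.V 24 = v ∧ b.V 25 = cod v := by
        rcases j2 with ⟨⟨q, hq, hqe⟩, h4, h5⟩ | h4
        · have h6 := j1 v hv ⟨i, hip, hie⟩
          have h7 := hs q p (by omega) hp
          rw [hqe, hw, row_le_ent _ h4 _ _ (hXK _)] at h7
          have h8 : b.V 24 = v := by
            by_contra hne
            have := h.mono (u := v + 1) (v := b.V 24) (by omega) h4.le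
            omega
          exact ⟨h8, by rw [h5, h8]⟩
        · exact absurd hie (h4 v hv i hip)
      refine wp_assign (by norm_num) (x := G p) ?_ hGp (hkept _
        ((hdec c c1 c2 c3 c4).update _ _ (by norm_num)) (by simp) (keep _ ?_ ?_ fun u hu he => ?_))
      · rw [eval_encE (K := K) (x := cod v) (y := v) (z := 1) (w := X (n + 2 + j)) ?_ ?_ ?_
          (eval_const _ _) ?_, g3 v hv j h1 h2 hw, edgeWord]
        · rw [c4 18 (by norm_num), h18]
        · rw [eval_var (by norm_num), c4 25 (by norm_num), hcur.2]
        · rw [eval_var (by norm_num), c4 24 (by norm_num), hcur.1]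
        · rw [eval_var (by norm_num), c21]
      · simpa using c4 24 (by norm_num)
      · simpa using c4 25 (by norm_num)
      · exact row_ne_ent u hu _ _ (hXK _) (he.symm.trans hw)
  · rintro b b1 - b5 b6 b7
    refine hQ b (hr.of_eq fun x hx hx' => b1 x ⟨hx, .inl hx', by omega⟩)
      (b1 30 ⟨by norm_num, by norm_num, by norm_num⟩) ⟨fun p hp hne => ?_, fun v w hvw => ?_⟩ b7
    · have hb : arr μ src b p = G p := b5 p hp
      obtain ⟨g1, g2, g3⟩ := hG p hp
      rcases hh.cases p hp with h0 | ⟨u, hu, hw⟩ | ⟨v, hv, j, h1, h2, hw⟩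
      · rw [hb, g1 h0] at hne
        exact absurd rfl hne
      · rw [hb, g2 u hu hw] at hne
        exact absurd rfl hne
      · exact ⟨v, _, h.entry v hv j h1 h2, hb.trans (g3 v hv j h1 h2 hw)⟩
    · have hv := (h.lt v w hvw).1
      obtain ⟨j, h1, h2, h3⟩ := h.complete v w hvw
      obtain ⟨p, hp, hw⟩ := hh.entries v hv j h1 h2
      refine ⟨p, hp, (b5 p hp).trans ?_⟩
      rw [(hG p hp).2.2 v hv j h1 h2 hw, h3]

end
end ExtMem
namespace ExtMem

/-! ### The program -/

/-- Read the sizes and initialise the variables. -/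
def setup : Program :=
  .seq (.read (.const 0) (.const 0)) (.seq (assign 19 (.load (.const 0)))
  (.seq (.read (.const 0) (.div (.add (var 19) (.const 1)) .blockSize))
  (.seq (assign 38 (.load (.mod (.add (var 19) (.const 1)) .blockSize)))
  (.seq (assign 38 (.add (.add (var 19) (.const 2)) (var 38)))
  (.seq (assign 13 (.const 0))
  (.seq (assign 15 (.div (.sub (.add (var 38) .blockSize) (.const 1)) .blockSize))
  (.seq (assign 14 (var 15))
  (.seq (assign 16 (.div .memSize (.mul (.const 4) .blockSize)))
  (.seq (.ite (.lt (.const 2) (var 16)) .skip (assign 16 (.const 2)))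
  (.seq (assign 18 (.mul (.const 4) (var 38)))
  (.seq (assign 17 (.mul (.mul (.mul (var 18) (var 18)) (var 18)) (var 18)))
  (.seq (assign 24 (.const 0)) (.seq (assign 25 (.const 0)) (assign 30 (.const 0)))))))))))))))

/-- Find an induced `C₃`, `C₅` or `2K₂`. -/
def findSubgraph : Program :=
  .seq setup (.seq rowPass (.seq mergeSort (.seq joinPass (.seq check
    (.seq (.ite (eqE (var 32) (.const 0)) (.seq (assign 30 (var 31)) check) .skip) report)))))

section
variable {μ : Machine} [hμ : Fact (μ.extra = extraWords)] {Q : Conf → Prop} {a : Conf}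
  {L k inf K n e : ℕ} {adj : ℕ → ℕ → Prop} {deg cod P : ℕ → ℕ}

/-- Two reads suffice: cell 0 holds n, and cell n + 1 holds the sentinel P[n], which is the number
of row entries. -/
lemma wp_setup (Pa : Params μ L k inf) (hinf : K * K * K * K = inf)
    (h : InputArray adj deg n e P a.X) (hK : 4 * (n + 2 + e) = K)
    (hL : (n + 2 + e + μ.B - 1) / μ.B = L) (hk : max 2 (μ.M / (4 * μ.B)) = k)
    (hM : 2 * μ.B ≤ μ.M) (hBW : μ.B < μ.W)
    (hQ : ∀ b : Conf, Ready L k inf K n 0 L b → b.V 24 = 0 → b.V 25 = 0 → b.V 30 = 0 →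
      b.V 38 = n + 2 + e → b.X = a.X → b.t = a.t + 2 → Q b) :
    wp μ setup Q a := by
  have hW := Pa.word
  have hB := Pa.B_pos
  have hKK : K ≤ inf := by
    rw [← hinf]
    have hK0 : 0 < K := by omega
    exact Nat.le_mul_of_pos_left _ (by positivity)
  have hkM : μ.M / (4 * μ.B) ≤ μ.M := Nat.div_le_self _ _
  have hkL : k ≤ k * L := Nat.le_mul_of_pos_right _ Pa.L_pos
  refine wp_seq (wp_read (y := 0) (x := 0) (eval_const _ _) (eval_const _ _) (by omega) ?_)
  refine wp_seq (wp_assign (by norm_num) (x := n) ?_ (by omega) ?_)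
  · rw [eval_load _ (by rw [eval_const]; omega), eval_const]
    simp only [zero_le, zero_add, true_and, zero_mul, Nat.sub_zero]
    rw [if_pos (by omega), h.size]
  have hmod : (n + 1) % μ.B < μ.B := Nat.mod_lt _ (by omega)
  refine wp_seq (wp_read (y := 0) (x := (n + 1) / μ.B) (eval_const _ _) ?_ (by omega) ?_)
  · rw [eval_div, eval_add, eval_var (by norm_num), eval_const, eval_blockSize]
    simp
  have hev : ∀ c : Conf, c.V 19 = n →
      (Expr.mod (.add (var 19) (.const 1)) .blockSize).eval μ (c.st μ.M) = (n + 1) % μ.B := by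
    intro c hc
    rw [eval_mod, eval_add, eval_var (by norm_num), eval_const, eval_blockSize, hc]
  refine wp_seq (wp_assign (by norm_num) (x := e) ?_ (by omega) ?_)
  · rw [eval_load _ (by rw [hev _ (by simp)]; omega), hev _ (by simp)]
    simp only [zero_le, zero_add, true_and, Nat.sub_zero]
    rw [if_pos hmod, Nat.div_add_mod', h.start n le_rfl, h.P_last]
  refine wp_seq (wp_assign (by norm_num) (x := n + 2 + e) ?_ (by omega) ?_)
  · rw [eval_add, eval_add, eval_var (by norm_num), eval_var (by norm_num), eval_const]
    simp
  refine wp_seq (wp_assign (by norm_num) (x := 0) (eval_const _ _) (by omega) ?_)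
  refine wp_seq (wp_assign (by norm_num) (x := L) ?_ (by omega) ?_)
  · rw [eval_div, eval_sub, eval_add, eval_var (by norm_num), eval_const, eval_blockSize]
    simpa using hL
  refine wp_seq (wp_assign (by norm_num) (x := L) ?_ (by omega) ?_)
  · rw [eval_var (by norm_num)]; simp
  refine wp_seq (wp_assign (by norm_num) (x := μ.M / (4 * μ.B)) ?_ (by omega) ?_)
  · rw [eval_div, eval_mul, eval_const, eval_blockSize, eval_memSize]
  -- the merge degree
  have fin : ∀ c : Conf, c.X = a.X → c.t = a.t + 2 → c.V 13 = 0 → c.V 14 = L → c.V 15 = L →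
      c.V 16 = k → c.V 19 = n → c.V 38 = n + 2 + e →
      wp μ (.seq (assign 18 (.mul (.const 4) (var 38)))
        (.seq (assign 17 (.mul (.mul (.mul (var 18) (var 18)) (var 18)) (var 18)))
        (.seq (assign 24 (.const 0)) (.seq (assign 25 (.const 0)) (assign 30 (.const 0)))))) Q c := by
    intro c cX ct c13 c14 c15 c16 c19 c38
    refine wp_seq (wp_assign (by norm_num) (x := K) ?_ (by omega) ?_)
    · rw [eval_mul, eval_var (by norm_num), eval_const, c38, hK]
    refine wp_seq (wp_assign (by norm_num) (x := inf) ?_ (by omega) ?_)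
    · rw [eval_mul, eval_mul, eval_mul, eval_var (by norm_num)]
      simpa using hinf
    refine wp_seq (wp_assign (by norm_num) (x := 0) (eval_const _ _) (by omega) ?_)
    refine wp_seq (wp_assign (by norm_num) (x := 0) (eval_const _ _) (by omega) ?_)
    refine wp_assign (by norm_num) (x := 0) (eval_const _ _) (by omega) ?_
    refine hQ _ ⟨.inl ⟨rfl, rfl⟩, ?_, ?_, ?_, ?_, ?_, ?_, ?_⟩ ?_ ?_ ?_ ?_ cX ct
    · simpa using c13
    · simpa using c14
    · simpa using c15
    · simpa using c16
    · simp
    · simp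
    · simpa using c19
    · simp
    · simp
    · simp
    · simpa using c38
  refine wp_seq (wp_ite_lt (x := 2) (y := μ.M / (4 * μ.B)) (eval_const _ _) ?_ ?_ ?_)
  · rw [eval_var (by norm_num)]; simp
  · intro hlt
    refine wp_skip (fin _ rfl rfl ?_ ?_ ?_ ?_ ?_ ?_)
    · simp
    · simp
    · simp
    · simp only [Function.update_self]
      omega
    · simp
    · simp
  · intro hge
    refine wp_assign (by norm_num) (x := 2) (eval_const _ _) (by omega)
      (fin _ rfl rfl ?_ ?_ ?_ ?_ ?_ ?_)
    · simp
    · simp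
    · simp
    · simp only [Function.update_self]
      omega
    · simp
    · simp

/-- The first check is made at a vertex x of maximum degree, the second, if needed, at the first
neighbour y of x. By `hno` they cannot both succeed. The bound adds 2 + 6 for set-up and output, 22L
for eleven scans in the worst case, and five sorts. -/
lemma wp_findSubgraph (Pa : Params μ L k inf) (hinf : K * K * K * K = inf) (hLW : L * μ.B < μ.W)
    (h : InputArray adj deg n e P a.X) (hK : 4 * (n + 2 + e) = K)
    (hcod : ∀ u, cod u = K - 1 - deg u) (hG : Graphic adj cod K n)
    (hL : (n + 2 + e + μ.B - 1) / μ.B = L) (hk : max 2 (μ.M / (4 * μ.B)) = k)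
    (hM : 2 * μ.B ≤ μ.M) (hBW : μ.B < μ.W) (hedge : ∃ v w, adj v w)
    (hno : ∀ x y y', (∀ u < n, deg u ≤ deg x) → Nested adj cod K x y → ¬Nested adj cod K y y')
    (hQ : ∀ b : Conf, Answer adj b.X → b.t ≤ a.t + 8 + 22 * L + 15 * L * (1 + Nat.log k L) → Q b) :
    wp μ findSubgraph Q a := by
  have hW := Pa.word
  have hB := Pa.B_pos
  have hn := hG.n_lt
  have hKK : K ≤ inf := hG.le_inf hinf
  obtain ⟨v0, w0, hvw⟩ := hedge
  have hv0 := (h.lt _ _ hvw).1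
  have hLB : n + 2 + e ≤ L * μ.B := by
    have := Nat.lt_div_mul_add (a := n + 2 + e + μ.B - 1) (b := μ.B) (by omega)
    rw [hL] at this
    omega
  refine wp_seq (wp_setup Pa hinf h hK hL hk hM hBW fun b1 r1 b24 b25 b30 b38 bX bt => ?_)
  refine wp_seq (wp_rowPass Pa hinf hLW (bX ▸ h) hK hcod r1 b24 b25 b30 b38 (by omega) hLB
    fun b2 r2 hx hmax hA t2 => ?_)
  rw [bX] at hA
  refine wp_seq (wp_sortArr Pa r2 (fun c hc => ?_) fun b3 s3 d3 r3 f3 o3 h3 t3 => ?_)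
  · rw [hA c hc, ← hinf]
    exact h.rowPassWord_lt hK hcod c
  have hra := h.rowArray (cod := cod) (K := K) hLB (A := arr μ s3 b3) fun y => (h3 y).trans (by
    constructor
    · rintro ⟨p, hp, he⟩; exact ⟨p, hp, (hA p hp).symm.trans he⟩
    · rintro ⟨p, hp, he⟩; exact ⟨p, hp, (hA p hp).trans he⟩)
  refine wp_seq (wp_joinPass Pa hinf hLW h hK hcod r3 hra o3 fun b4 r4 e4 h4 t4 => ?_)
  have hz4 : b4.V 30 = b2.V 30 := e4.trans (f3 30 (by norm_num))
  -- The graph has an edge, so a vertex of maximum degree has a neighbour and the check at it makes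
  -- sense.
  have hdeg : 0 < deg (b2.V 30) := (h.deg_pos hvw).trans_le (hmax v0 hv0)
  obtain ⟨w, hw⟩ := h.exists_adj hx hdeg
  refine wp_seq (wp_check Pa hinf hLW hG hz4 ⟨w, hG.symm _ _ hw⟩ r4 h4
    fun b5 s5 d5 r5 e5 c5 h5 t5 => ?_)
  have hcost : ∀ x : ℕ, x = L * (1 + Nat.log k L) → 15 * L * (1 + Nat.log k L) = 15 * x ∧
      3 * L * (1 + Nat.log k L) = 3 * x ∧ 6 * L * (1 + Nat.log k L) = 6 * x := by
    rintro x rfl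
    refine ⟨?_, ?_, ?_⟩ <;> ring
  obtain ⟨q1, q2, q3⟩ := hcost _ rfl
  -- the end of both branches
  have fin : ∀ (c : Conf) (src dst : ℕ), Ready L k inf K n src dst c →
      Conflict adj (c.V 30) (c.V 35) (c.V 36) (c.V 33) (c.V 37) →
      Holds adj (L * μ.B) (arr μ src c) (edgeWord cod K) →
      c.t ≤ b5.t + 8 * L + 6 * L * (1 + Nat.log k L) → wp μ report Q c := by
    intro c src dst hr hc hh ht
    refine wp_report Pa hinf hLW hM hG rfl rfl rfl rfl rfl hc hr hh fun d hd hdt => hQ d hd ?_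
    omega
  refine wp_seq (wp_ite_eq (x := b5.V 32) (y := 0) (eval_var (by norm_num) _) (eval_const _ _)
    (fun h32 => ?_) fun h32 => ?_)
  · have hN : Nested adj cod K (b2.V 30) (b5.V 31) := by
      rcases c5 with c5 | c5
      · exact c5.2
      · omega
    have hyK := hG.lt_K hN.1
    refine wp_seq (wp_assign (by norm_num) (x := b5.V 31) (eval_var (by norm_num) _) (by omega) ?_)
    refine wp_check Pa hinf hLW hG (src := s5) (dst := d5) (z := b5.V 31) (by simp)
      ⟨_, hG.symm _ _ hN.1⟩
      ⟨r5.twin, by simpa using r5.v13, by simpa using r5.v14, by simpa using r5.v15,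
        by simpa using r5.v16, by simpa using r5.v17, by simpa using r5.v18, by simpa using r5.v19⟩
      h5 fun b6 s6 d6 r6 e6 c6 h6 t6 => ?_
    rcases c6 with ⟨-, c6⟩ | ⟨-, c6⟩
    · exact absurd c6 (hno _ _ _ hmax hN)
    · exact fin b6 s6 d6 r6 (e6 ▸ c6) h6 t6
  · rcases c5 with c5 | ⟨-, c5⟩
    · exact absurd c5.1 h32
    · exact wp_skip (fin b5 s5 d5 r5 (e5 ▸ c5) h5 (by omega))

end
end ExtMem
namespace ExtMem

/-! ### The input array -/

lemma getD_flatten (l : List (List ℕ)) (v i : ℕ) (hi : i < (l.getD v []).length) :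
    l.flatten.getD (((l.take v).map List.length).sum + i) 0 = (l.getD v []).getD i 0 := by
  induction l generalizing v with
  | nil => simp at hi
  | cons x l ih =>
    cases v with
    | zero =>
      simp only [List.getD_cons_zero] at hi
      simp only [List.take_zero, List.map_nil, List.sum_nil, zero_add, List.flatten_cons,
        List.getD_cons_zero]
      exact List.getD_append _ _ _ _ hi
    | succ v =>
      simp only [List.getD_cons_succ] at hi ⊢
      rw [← ih v hi, List.flatten_cons, List.take_succ_cons, List.map_cons, List.sum_cons,
        List.getD_append_right _ _ _ _ (by omega)]
      congr 1
      omega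

section
variable {n : ℕ} {G : SimpleGraph (Fin n)} {rows : Fin n → List (Fin n)}
  {t : List (Fin n × Fin n)}

/-- Adjacency of vertex numbers. -/
def natAdj (G : SimpleGraph (Fin n)) (a b : ℕ) : Prop :=
  ∃ (ha : a < n) (hb : b < n), G.Adj ⟨a, ha⟩ ⟨b, hb⟩

/-- The neighbour list of a vertex number. -/
def natRow (rows : Fin n → List (Fin n)) (u : ℕ) : List ℕ :=
  if h : u < n then (rows ⟨u, h⟩).map Fin.val else []

/-- The position where a row starts. -/
def rowStart (rows : Fin n → List (Fin n)) (v : ℕ) : ℕ :=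
  ∑ j : Fin n, if (j : ℕ) < v then (rows j).length else 0

lemma natAdj_val (u v : Fin n) : natAdj G u v ↔ G.Adj u v :=
  ⟨fun ⟨_, _, h⟩ => h, fun h => ⟨u.2, v.2, h⟩⟩

lemma mem_natRow (hrows : IsNeighborLists G rows) (u w : ℕ) :
    w ∈ natRow rows u ↔ natAdj G u w := by
  unfold natRow natAdj
  split_ifs with h
  · simp only [List.mem_map, (hrows _).2, h, exists_true_left]
    constructor
    · rintro ⟨x, hx, rfl⟩
      exact ⟨x.2, hx⟩
    · rintro ⟨hw, hx⟩
      exact ⟨⟨w, hw⟩, hx, rfl⟩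
  · simp [h]

lemma nodup_natRow (hrows : IsNeighborLists G rows) (u : ℕ) : (natRow rows u).Nodup := by
  unfold natRow
  split_ifs with h
  · exact (hrows _).1.map Fin.val_injective
  · exact List.nodup_nil

open Classical in
lemma length_natRow (hrows : IsNeighborLists G rows) (u : ℕ) :
    (natRow rows u).length = ((Finset.range n).filter fun w => natAdj G u w).card := by
  rw [← List.toFinset_card_of_nodup (nodup_natRow hrows u)]
  congr 1
  ext w
  simp only [List.mem_toFinset, mem_natRow hrows, Finset.mem_filter, Finset.mem_range]
  exact ⟨fun h => ⟨h.2.1, h⟩, fun h => h.2⟩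

lemma rowStart_succ {v : ℕ} (hv : v < n) :
    rowStart rows (v + 1) = rowStart rows v + (natRow rows v).length := by
  have h1 : (natRow rows v).length = ∑ j : Fin n, if j = ⟨v, hv⟩ then (rows j).length else 0 := by
    rw [Finset.sum_ite_eq' Finset.univ, if_pos (Finset.mem_univ _)]
    simp [natRow, hv]
  rw [h1, rowStart, rowStart, ← Finset.sum_add_distrib]
  refine Finset.sum_congr rfl fun j _ => ?_
  have h2 : j = ⟨v, hv⟩ ↔ (j : ℕ) = v := by rw [Fin.ext_iff]
  simp only [h2]
  split_ifs <;> omega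

lemma rowStart_eq_sum_take (v : ℕ) (hv : v ≤ n) :
    rowStart rows v = ((((List.range n).map (natRow rows)).take v).map List.length).sum := by
  induction v with
  | zero => simp [rowStart]
  | succ v ih =>
    rw [rowStart_succ hv, ih (by omega), List.take_add_one]
    simp [List.getElem?_range (show v < n from hv)]

lemma rowEntries_eq : rowEntries rows = ((List.range n).map (natRow rows)).flatten := by
  have h : rowEntries rows = (List.ofFn rows).flatten.map Fin.val := by
    rw [rowEntries, List.map_id'' fun _ => rfl, List.map_eq_flatMap]
    rfl
  rw [h, List.map_flatten]
  congr 1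
  refine List.ext_getElem (by simp) fun i h1 h2 => ?_
  simp only [List.length_map, List.length_range] at h2
  simp [natRow, h2]

lemma rowStart_le (v : ℕ) : rowStart rows v ≤ rowStart rows n := by
  refine Finset.sum_le_sum fun j _ => ?_
  rw [if_pos j.2]
  split_ifs <;> omega

lemma rowStart_last (hrows : IsNeighborLists G rows) : rowStart rows n = 2 * G.edgeSet.ncard := by
  classical
  have h1 := G.sum_degrees_eq_twice_card_edges
  rw [← SimpleGraph.coe_edgeFinset, Set.ncard_coe_finset, ← h1]
  refine Finset.sum_congr rfl fun j _ => ?_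
  rw [if_pos j.2, ← SimpleGraph.card_neighborFinset_eq_degree,
    ← List.toFinset_card_of_nodup (hrows j).1]
  congr 1
  ext u
  rw [List.mem_toFinset, (hrows j).2, SimpleGraph.mem_neighborFinset]

/-- The stored list is n, then n + 1 row starts, then the entries; entry j therefore sits at
position n + 2 + j. The bound on all cells also covers the tree edges, which share the last block of
the array or follow it. -/
lemma inputArray (hrows : IsNeighborLists G rows) :
    InputArray (natAdj G) (fun u => (natRow rows u).length) n (2 * G.edgeSet.ncard)
      (rowStart rows) (initialState rows t).ext := by
  have hlen : (rowStarts rows).length = n + 1 := by simp [rowStarts]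
  have hent : (rowEntries rows).length = 2 * G.edgeSet.ncard := by
    rw [← rowStart_last hrows, rowStart_eq_sum_take n le_rfl, rowEntries_eq, List.length_flatten,
      List.take_of_length_le (by simp)]
  have hrow : ∀ v < n, ∀ i, i < (natRow rows v).length →
      (initialState rows t).ext (n + 2 + (rowStart rows v + i)) = (natRow rows v).getD i 0 := by
    intro v hv i hi
    have h1 := rowStart_succ (rows := rows) hv
    have h2 := rowStart_le (rows := rows) (v + 1)
    rw [rowStart_last hrows] at h2
    have h3 : ((List.range n).map (natRow rows)).getD v [] = natRow rows v := by
      simp [List.getD_eq_getElem?_getD, hv]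
    have h4 : n + 2 + (rowStart rows v + i) = (n + 1 + (rowStart rows v + i)) + 1 := by ring
    simp only [initialState, inputWords]
    rw [h4, List.getD_cons_succ, List.getD_append _ _ _ _ (by simp [hlen, hent]; omega),
      List.getD_append_right _ _ _ _ (by omega), hlen, Nat.add_sub_cancel_left, rowEntries_eq,
      rowStart_eq_sum_take v hv.le, getD_flatten _ _ _ (by rwa [h3]), h3]
  refine ⟨?_, ?_, ?_, fun v hv => rowStart_succ hv, rowStart_last hrows, ?_, ?_,
    fun v w h => ⟨h.1, h.2.1⟩, ?_⟩
  · simp [initialState, inputWords]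
  · intro v hv
    simp only [initialState, inputWords]
    rw [List.getD_cons_succ, List.getD_append _ _ _ _ (by simp [hlen]; omega),
      List.getD_append _ _ _ _ (by omega), List.getD_eq_getElem _ _ (by omega)]
    simp only [rowStarts, rowStart, List.getElem_ofFn]
  · simp [rowStart]
  · intro v hv j h1 h2
    rw [rowStart_succ hv] at h2
    have h3 := hrow v hv (j - rowStart rows v) (by omega)
    rw [Nat.add_sub_cancel' h1] at h3
    rw [h3, ← mem_natRow hrows, List.getD_eq_getElem _ _ (by omega)]
    exact List.getElem_mem _
  · intro v w h
    rw [← mem_natRow hrows] at h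
    obtain ⟨i, hi, he⟩ := List.getElem_of_mem h
    have hv : v < n := by
      by_contra hv
      simp [natRow, hv] at hi
    refine ⟨rowStart rows v + i, by omega, by rw [rowStart_succ hv]; omega, ?_⟩
    rw [hrow v hv i hi, List.getD_eq_getElem _ _ hi, he]
  · intro c
    have hmem : ∀ x ∈ inputWords rows t, x ≤ n + 2 * G.edgeSet.ncard := by
      intro x hx
      simp only [inputWords, List.mem_cons, List.mem_append, List.mem_flatMap] at hx
      rcases hx with rfl | (hx | hx) | ⟨y, -, hy⟩
      · omega
      · rw [rowStarts, List.mem_ofFn] at hx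
        obtain ⟨i, rfl⟩ := hx
        have := rowStart_le (rows := rows) i
        rw [rowStart_last hrows] at this
        unfold rowStart at this
        omega
      · rw [rowEntries_eq, List.mem_flatten] at hx
        obtain ⟨l, hl, hx⟩ := hx
        obtain ⟨u, -, rfl⟩ := List.mem_map.1 hl
        have := ((mem_natRow hrows u x).1 hx).2.1
        omega
      · have h1 := y.1.2
        have h2 := y.2.2
        simp at hy
        omega
    change (inputWords rows t).getD c 0 ≤ _
    by_cases hc : c < (inputWords rows t).length
    · rw [List.getD_eq_getElem _ _ hc]
      exact hmem _ (List.getElem_mem _)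
    · rw [List.getD_eq_default _ _ (by omega)]
      omega

/-- The last clause of `Graphic` is counting: if b' has at least the degree of b, then N(b') cannot
be a proper subset of N(b). The base K exceeds all degrees by so much that complementary degrees are
positive digits. -/
lemma graphic (hrows : IsNeighborLists G rows) {K : ℕ}
    (hK : 4 * (n + 2 + 2 * G.edgeSet.ncard) = K) :
    Graphic (natAdj G) (fun u => K - 1 - (natRow rows u).length) K n := by
  classical
  have hI := inputArray (t := []) hrows
  have hdeg : ∀ u, (natRow rows u).length ≤ 2 * G.edgeSet.ncard := by
    intro u
    by_cases hu : u < n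
    · exact hI.deg_le hu
    · simp [natRow, hu]
  refine ⟨fun u v h => h.1, fun u v ⟨h1, h2, h3⟩ => ⟨h2, h1, h3.symm⟩,
    fun u ⟨_, _, h⟩ => h.ne rfl, fun u v _ => ?_, fun u v _ => ?_, by omega, ?_⟩
  · have := hdeg u
    omega
  · omega
  · intro b b' v hle hbv hbv'
    by_contra hno
    push Not at hno
    have h1 := hdeg b
    have h2 := hdeg b'
    have h3 : (natRow rows b').length < (natRow rows b).length := by
      rw [length_natRow hrows, length_natRow hrows]
      refine Finset.card_lt_card ⟨fun u hu => ?_, fun hsub => ?_⟩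
      · rw [Finset.mem_filter] at hu ⊢
        exact ⟨hu.1, hno u hu.2⟩
      · have h4 := hsub (Finset.mem_filter.2 ⟨Finset.mem_range.2 hbv.2.1, hbv⟩)
        exact hbv' (Finset.mem_filter.1 h4).2
    omega

end
end ExtMem
namespace ExtMem

/-! ### Graphs without conflicts -/

section
variable {adj : ℕ → ℕ → Prop} {cod : ℕ → ℕ} {K n : ℕ}

/-- The vertex set is the union of the neighbourhoods of `x` and `y`, which are independent sets in
which the neighbourhoods are nested. -/
structure ChainParts (adj : ℕ → ℕ → Prop) (x y : ℕ) : Prop where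
  disjoint : ∀ w, adj w x → ¬adj w y
  left : ∀ w w', adj w x → adj w w' → adj w' y
  right : ∀ w w', adj w y → adj w w' → adj w' x
  chain : ∀ u u', adj u x ∧ adj u' x ∨ adj u y ∧ adj u' y →
    (∀ v, adj u v → adj u' v) ∨ ∀ v, adj u' v → adj u v

/-- Since x is a neighbour of y and y' dominates these, N(x) ⊆ N(y'). A further neighbour of y'
would contradict the maximal degree of x, so N(y') = N(x). Thus N(y) dominates the neighbourhoods of
N(x), and N(x) those of N(y). A vertex in both sets would make y adjacent to itself. -/
lemma chainParts (hG : Graphic adj cod K n) {x y y' : ℕ}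
    (hmax : ∀ w, adj x w → adj y' w → cod x ≤ cod y') (h : Nested adj cod K x y)
    (h' : Nested adj cod K y y') : ChainParts adj x y := by
  obtain ⟨a1, a2, a3⟩ := h
  obtain ⟨b1, b2, b3⟩ := h'
  have hxy := hG.symm _ _ a1
  have hy'x : ∀ v, adj x v → adj y' v := fun v => b3 x y' v hxy b1 (b2 x hxy)
  have hxy' : ∀ v, adj y' v → adj x v := by
    intro v hv
    by_contra hn
    obtain ⟨u, hu1, hu2⟩ := hG.missing y' x v (hmax y hxy b1) hv hn
    exact hu2 (hy'x u hu1)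
  have left : ∀ w w', adj w x → adj w w' → adj w' y := fun w w' hw hww =>
    hG.symm _ _ (a3 w y w' hw a1 (a2 w hw) hww)
  refine ⟨fun w hw hw' => hG.irrefl y (left w y hw hw'), left, fun w w' hw hww =>
    hG.symm _ _ (hxy' _ (b3 w y' w' hw b1 (b2 w hw) hww)), ?_⟩
  rintro u u' (⟨h1, h2⟩ | ⟨h1, h2⟩)
  · rcases le_total (key cod K u') (key cod K u) with h3 | h3
    · exact .inl fun v => a3 u u' v h1 h2 h3
    · exact .inr fun v => a3 u' u v h2 h1 h3
  · rcases le_total (key cod K u') (key cod K u) with h3 | h3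
    · exact .inl fun v => b3 u u' v h1 h2 h3
    · exact .inr fun v => b3 u' u v h2 h1 h3

end

section
variable {n : ℕ} {G : SimpleGraph (Fin n)} {x y : ℕ}

/-- Along a walk the vertices alternate between the two parts, so connectivity puts every vertex
into one of them. -/
lemma ChainParts.cover (h : ChainParts (natAdj G) x y) (hG : G.Connected) {w : ℕ}
    (hw : natAdj G w x) (u : Fin n) : natAdj G u x ∨ natAdj G u y := by
  obtain ⟨p⟩ := hG.preconnected ⟨w, hw.1⟩ u
  have hgen : ∀ a b : Fin n, G.Walk a b → natAdj G a x ∨ natAdj G a y →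
      natAdj G b x ∨ natAdj G b y := by
    intro a b q
    induction q with
    | nil => exact id
    | cons hadj _ ih =>
      intro ha
      refine ih (ha.elim (fun ha => .inr ?_) fun ha => .inl ?_)
      · exact h.left _ _ ha ((natAdj_val _ _).2 hadj)
      · exact h.right _ _ ha ((natAdj_val _ _).2 hadj)
  exact hgen _ _ p (.inl hw)

lemma ChainParts.not_matching (h : ChainParts (natAdj G) x y) {u v u' v' : ℕ}
    (hpart : natAdj G u x ∧ natAdj G u' x ∨ natAdj G u y ∧ natAdj G u' y)
    (h1 : natAdj G u v) (h2 : natAdj G u' v') (h3 : ¬natAdj G u' v) (h4 : ¬natAdj G u v') :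
    False := by
  rcases h.chain u u' hpart with h5 | h5
  · exact h3 (h5 v h1)
  · exact h4 (h5 v' h2)

/-- Going around an odd cycle ends in the wrong part, against disjointness. In a 2K₂ each edge has
an end in either part; choosing ends in the same part gives two incomparable neighbourhoods. -/
lemma ChainParts.not_contained (h : ChainParts (natAdj G) x y) (hG : G.Connected) {w : ℕ}
    (hw : natAdj G w x) : ¬((SimpleGraph.cycleGraph 3).IsIndContained G ∨
      (SimpleGraph.cycleGraph 5).IsIndContained G ∨ twoK2.IsIndContained G) := by
  have hc := h.cover hG hw
  have hd := h.disjoint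
  have hl := h.left
  have hr := h.right
  rintro (⟨⟨f⟩⟩ | ⟨⟨f⟩⟩ | ⟨⟨f⟩⟩)
  · have e : ∀ i j, (SimpleGraph.cycleGraph 3).Adj i j → natAdj G (f i) (f j) := fun i j hij =>
      (natAdj_val _ _).2 (f.map_rel_iff.2 hij)
    have e1 := e 0 1 (by decide)
    have e2 := e 1 2 (by decide)
    have e3 := e 2 0 (by decide)
    rcases hc (f 0) with h0 | h0
    · exact hd _ h0 (hl _ _ (hr _ _ (hl _ _ h0 e1) e2) e3)
    · exact hd _ (hr _ _ (hl _ _ (hr _ _ h0 e1) e2) e3) h0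
  · have e : ∀ i j, (SimpleGraph.cycleGraph 5).Adj i j → natAdj G (f i) (f j) := fun i j hij =>
      (natAdj_val _ _).2 (f.map_rel_iff.2 hij)
    have e1 := e 0 1 (by decide)
    have e2 := e 1 2 (by decide)
    have e3 := e 2 3 (by decide)
    have e4 := e 3 4 (by decide)
    have e5 := e 4 0 (by decide)
    rcases hc (f 0) with h0 | h0
    · exact hd _ h0 (hl _ _ (hr _ _ (hl _ _ (hr _ _ (hl _ _ h0 e1) e2) e3) e4) e5)
    · exact hd _ (hr _ _ (hl _ _ (hr _ _ (hl _ _ (hr _ _ h0 e1) e2) e3) e4) e5) h0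
  · have e : ∀ i j, twoK2.Adj i j → natAdj G (f i) (f j) := fun i j hij =>
      (natAdj_val _ _).2 (f.map_rel_iff.2 hij)
    have ne : ∀ i j, ¬twoK2.Adj i j → ¬natAdj G (f i) (f j) := fun i j hij hc =>
      hij (f.map_rel_iff.1 ((natAdj_val _ _).1 hc))
    have e1 := e 0 1 (by simp [twoK2])
    have e1' := e 1 0 (by simp [twoK2])
    have e2 := e 2 3 (by simp [twoK2])
    have e2' := e 3 2 (by simp [twoK2])
    have n1 := ne 2 1 (by simp [twoK2])
    have n2 := ne 0 3 (by simp [twoK2])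
    have n3 := ne 3 1 (by simp [twoK2])
    have n4 := ne 0 2 (by simp [twoK2])
    rcases hc (f 0) with h0 | h0 <;> rcases hc (f 2) with h2 | h2
    · exact h.not_matching (.inl ⟨h0, h2⟩) e1 e2 n1 n2
    · exact h.not_matching (.inl ⟨h0, hr _ _ h2 e2⟩) e1 e2' n3 n4
    · exact h.not_matching (.inr ⟨h0, hl _ _ h2 e2⟩) e1 e2' n3 n4
    · exact h.not_matching (.inr ⟨h0, h2⟩) e1 e2 n1 n2

/-! ### Induced subgraphs from answers -/

/-- The numbers are vertices because each of them is adjacent to something. They are distinct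
because H separates any two vertices by a neighbour of the first that is not a neighbour of the
second; so adjacencies of pairs i < j are all that must be checked. -/
lemma reports_of_adj {k : ℕ} {H : SimpleGraph (Fin k)} {s : State} (h0 : s.ext 0 = k)
    (hne : ∀ i, ∃ j, H.Adj i j) (htwin : ∀ i j, i ≠ j → ∃ l, H.Adj i l ∧ ¬H.Adj j l)
    (hadj : ∀ i j : Fin k, i < j → (natAdj G (s.ext (i + 1)) (s.ext (j + 1)) ↔ H.Adj i j)) :
    Reports H G s := by
  have hsymm : ∀ a b, natAdj G a b → natAdj G b a := fun a b ⟨h1, h2, h3⟩ => ⟨h2, h1, h3.symm⟩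
  have hadj' : ∀ i j : Fin k, natAdj G (s.ext (i + 1)) (s.ext (j + 1)) ↔ H.Adj i j := by
    intro i j
    rcases lt_trichotomy i j with h | rfl | h
    · exact hadj i j h
    · exact ⟨fun ⟨_, _, h⟩ => absurd rfl h.ne, fun h => absurd rfl h.ne⟩
    · exact ⟨fun h1 => ((hadj j i h).1 (hsymm _ _ h1)).symm,
        fun h1 => hsymm _ _ ((hadj j i h).2 h1.symm)⟩
  have hlt : ∀ i : Fin k, s.ext (i + 1) < n := fun i => by
    obtain ⟨j, hj⟩ := hne i
    exact ((hadj' i j).2 hj).1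
  have hG : ∀ i j : Fin k, G.Adj ⟨s.ext (i + 1), hlt i⟩ ⟨s.ext (j + 1), hlt j⟩ ↔ H.Adj i j :=
    fun i j => (natAdj_val _ _).symm.trans (hadj' i j)
  refine ⟨h0, ⟨⟨fun i => ⟨s.ext (i + 1), hlt i⟩, fun i j hij => ?_⟩, fun {i j} => hG i j⟩,
    fun i => rfl⟩
  by_contra hne'
  obtain ⟨l, h1, h2⟩ := htwin i j hne'
  rw [← hG] at h1 h2
  simp only at hij
  rw [hij] at h1
  exact h2 h1

lemma reports_of_answer {s : State} (h : Answer (natAdj G) s.ext) :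
    Reports (SimpleGraph.cycleGraph 3) G s ∨ Reports (SimpleGraph.cycleGraph 5) G s ∨
      Reports twoK2 G s := by
  rcases h with ⟨h0, h1, h2, h3⟩ | ⟨h0, ⟨h1, h2, h3, h4, h5⟩, h6, h7, h8, h9, h10⟩ |
      ⟨h0, ⟨h1, h2⟩, h3, h4, h5, h6⟩
  · refine .inl (reports_of_adj h0 (by decide) (by decide) fun i j hij => ?_)
    fin_cases i <;> fin_cases j <;> first | (exfalso; revert hij; decide) | skip
    · exact iff_of_true h1 (by decide)
    · exact iff_of_true h3 (by decide)
    · exact iff_of_true h2 (by decide)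
  · refine .inr (.inl (reports_of_adj h0 (by decide) (by decide) fun i j hij => ?_))
    fin_cases i <;> fin_cases j <;> first | (exfalso; revert hij; decide) | skip
    · exact iff_of_true h1 (by decide)
    · exact iff_of_false h6 (by decide)
    · exact iff_of_false h7 (by decide)
    · exact iff_of_true h5 (by decide)
    · exact iff_of_true h2 (by decide)
    · exact iff_of_false h8 (by decide)
    · exact iff_of_false h9 (by decide)
    · exact iff_of_true h3 (by decide)
    · exact iff_of_false h10 (by decide)
    · exact iff_of_true h4 (by decide)
  · have hK : ∀ i j : Fin 4, twoK2.Adj i j ↔ (i = 0 ∧ j = 1 ∨ i = 1 ∧ j = 0) ∨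
        i = 2 ∧ j = 3 ∨ i = 3 ∧ j = 2 := by
      intro i j
      fin_cases i <;> fin_cases j <;> simp [twoK2]
    refine .inr (.inr (reports_of_adj h0 (by simp only [hK]; decide) (by simp only [hK]; decide)
      fun i j hij => ?_))
    rw [hK]
    fin_cases i <;> fin_cases j <;> first | (exfalso; revert hij; decide) | skip
    · exact iff_of_true h1 (by decide)
    · exact iff_of_false h3 (by decide)
    · exact iff_of_false h4 (by decide)
    · exact iff_of_false h5 (by decide)
    · exact iff_of_false h6 (by decide)
    · exact iff_of_true h2 (by decide)

end

/-! ### Resources -/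

/-- With S the number of blocks and ℓ the logarithmic factor, L ≤ 2S and log_k L ≤ 12ℓ. Since S ≤
Sℓ, this bounds the cost by (8 + 44 + 30 + 360)Sℓ, which is the constant 442. -/
lemma cost_le {B M n m L k c : ℕ} (hB : 1 ≤ B) (hM : 2 * B ≤ M) (hn : 2 ≤ n)
    (hL : (n + 2 + 2 * m + B - 1) / B = L) (hk : max 2 (M / (4 * B)) = k)
    (hc : c ≤ 8 + 22 * L + 15 * L * (1 + Nat.log k L)) :
    (c : ℝ) ≤ 442 * sortBound B M (n + m) := by
  have hB0 : (0 : ℝ) < B := by exact_mod_cast hB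
  have hq2 : (2 : ℝ) ≤ (M : ℝ) / B := by
    rw [le_div_iff₀ hB0]; exact_mod_cast hM
  have hN0 : (0 : ℝ) < ((n + m : ℕ) : ℝ) / B := by
    have : (0 : ℝ) < ((n + m : ℕ) : ℝ) := by exact_mod_cast (by omega : 0 < n + m)
    positivity
  unfold sortBound
  set q : ℝ := (M : ℝ) / B with hq
  set x : ℝ := ((n + m : ℕ) : ℝ) / B with hx
  set S : ℕ := ⌈x⌉₊ with hS
  set ℓ : ℝ := max 1 (Real.logb q x) with hℓ
  have hS1 : 1 ≤ S := Nat.ceil_pos.2 hN0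
  have hℓ1 : 1 ≤ ℓ := le_max_left _ _
  have hLS : L ≤ 2 * S := by
    rw [← hL, Nat.div_le_iff_le_mul_add_pred (by omega)]
    have h1 : x ≤ S := Nat.le_ceil x
    rw [hx, div_le_iff₀ hB0] at h1
    have h2 : n + m ≤ S * B := by exact_mod_cast h1
    have h3 : B * (2 * S) = 2 * (S * B) := by ring
    omega
  have hL1 : 1 ≤ L := by
    rw [← hL]
    exact (Nat.le_div_iff_mul_le (by omega)).2 (by omega)
  have hk2 : 2 ≤ k := by omega
  have hkR : (2 : ℝ) ≤ k := by exact_mod_cast hk2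
  -- the merge degree and the ratio of memory size and block size
  have hqk : q ≤ (k : ℝ) ^ (4 : ℝ) := by
    have h1 : M / (4 * B) ≤ k := by omega
    have h2 : M < 4 * B * (k + 1) := by
      have := Nat.lt_mul_div_succ M (show 0 < 4 * B by omega)
      exact this.trans_le (Nat.mul_le_mul_left _ (by omega))
    have h3 : q ≤ 4 * (k + 1) := by
      rw [hq, div_le_iff₀ hB0]
      have h4 : (M : ℝ) ≤ 4 * B * (k + 1) := by exact_mod_cast h2.le
      linarith
    refine h3.trans ?_
    have h5 : (k : ℝ) ^ (4 : ℝ) = (k : ℝ) ^ 4 := by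
      rw [← Real.rpow_natCast]; norm_num
    have h6 : (8 : ℝ) ≤ (k : ℝ) ^ 3 := by
      calc (8 : ℝ) = 2 ^ 3 := by norm_num
        _ ≤ (k : ℝ) ^ 3 := pow_le_pow_left₀ (by norm_num) hkR 3
    rw [h5, pow_succ]
    nlinarith
  have hxq : x ≤ q ^ ℓ := by
    calc x = q ^ Real.logb q x := (Real.rpow_logb (by linarith) (by linarith) hN0).symm
      _ ≤ q ^ ℓ := Real.rpow_le_rpow_of_exponent_le (by linarith) (le_max_right _ _)
  have h1q : 1 ≤ q ^ ℓ := Real.one_le_rpow (by linarith) (by linarith)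
  -- L ≤ 2S ≤ 2(x + 1) ≤ 4q^ℓ, and the factor 4 is at most q² as q ≥ 2. The exponent 2 + ℓ is at
  -- most 3ℓ because ℓ ≥ 1.
  have hLq : (L : ℝ) ≤ q ^ (3 * ℓ) := by
    have h1 : (S : ℝ) ≤ x + 1 := (Nat.ceil_lt_add_one hN0.le).le
    have h2 : (L : ℝ) ≤ 2 * S := by exact_mod_cast hLS
    have h3 : (4 : ℝ) ≤ q ^ (2 : ℝ) := by
      have h5 : q ^ (2 : ℝ) = q ^ 2 := by rw [← Real.rpow_natCast]; norm_num
      rw [h5]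
      nlinarith
    calc (L : ℝ) ≤ 4 * q ^ ℓ := by linarith
      _ ≤ q ^ (2 : ℝ) * q ^ ℓ := by gcongr
      _ = q ^ (2 + ℓ) := (Real.rpow_add (by linarith) _ _).symm
      _ ≤ q ^ (3 * ℓ) := Real.rpow_le_rpow_of_exponent_le (by linarith) (by linarith)
  have hlog : (Nat.log k L : ℝ) ≤ 12 * ℓ := by
    have h1 : ((k ^ Nat.log k L : ℕ) : ℝ) ≤ L := by
      exact_mod_cast Nat.pow_log_le_self k (by omega)
    rw [← Real.rpow_le_rpow_left_iff (x := (k : ℝ)) (by linarith), Real.rpow_natCast]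
    calc (k : ℝ) ^ Nat.log k L = ((k ^ Nat.log k L : ℕ) : ℝ) := by push_cast; rfl
      _ ≤ L := h1
      _ ≤ q ^ (3 * ℓ) := hLq
      _ ≤ ((k : ℝ) ^ (4 : ℝ)) ^ (3 * ℓ) :=
        Real.rpow_le_rpow (by linarith) hqk (by linarith)
      _ = (k : ℝ) ^ (12 * ℓ) := by
        rw [← Real.rpow_mul (by linarith)]
        congr 1
        ring
  have hcR : (c : ℝ) ≤ 8 + 22 * L + 15 * L * (1 + Nat.log k L) := by exact_mod_cast hc
  have hLR : (L : ℝ) ≤ 2 * S := by exact_mod_cast hLS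
  have hSR : (1 : ℝ) ≤ S := by exact_mod_cast hS1
  have hSℓ : (S : ℝ) ≤ S * ℓ := le_mul_of_one_le_right (by linarith) hℓ1
  have h1 : 15 * (L : ℝ) * (1 + Nat.log k L) ≤ 15 * (2 * S) * (1 + 12 * ℓ) := by gcongr
  linarith

/-- The largest word is the sentinel K⁴. With N = n + m + M ≥ 5 one has K ≤ 8N ≤ N³, hence K⁴ ≤ N¹²,
and the surplus factor N⁴ ≥ 625 absorbs all other terms. This is where the exponent 16 comes from.
-/
lemma params {B M n m L k K : ℕ} {μ : Machine} (hμB : μ.B = B) (hμM : μ.M = M) (hB : 1 ≤ B)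
    (hM : 2 * B ≤ M) (hn : 2 ≤ n) (hm : 1 ≤ m)
    (hL : (n + 2 + 2 * m + B - 1) / B = L) (hk : max 2 (M / (4 * B)) = k)
    (hK : 4 * (n + 2 + 2 * m) = K) (hW : (n + m + M) ^ 16 ≤ μ.W) :
    Params μ L k (K * K * K * K) ∧ L * μ.B < μ.W ∧ μ.B < μ.W := by
  subst hμB hμM
  have hL1 : 1 ≤ L := by
    rw [← hL]
    exact (Nat.le_div_iff_mul_le (by omega)).2 (by omega)
  have hLt : L * μ.B ≤ n + 2 + 2 * m + μ.B - 1 := by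
    rw [← hL]; exact Nat.div_mul_le_self _ _
  have hLL : L ≤ L * μ.B := Nat.le_mul_of_pos_right _ hB
  have h4 : μ.M / (4 * μ.B) * (4 * μ.B) ≤ μ.M := Nat.div_mul_le_self _ _
  have hdM : μ.M / (4 * μ.B) ≤ μ.M / 4 := Nat.div_le_div_left (by omega) (by norm_num)
  set N := n + m + μ.M with hN
  have hN5 : 5 ≤ N := by omega
  have hkN : k ≤ N := by omega
  have hL2 : L ≤ 2 * N := by
    rw [← hL, Nat.div_le_iff_le_mul_add_pred (by omega)]
    have : N ≤ μ.B * N := Nat.le_mul_of_pos_left _ hB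
    have h5 : μ.B * (2 * N) = 2 * (μ.B * N) := by ring
    omega
  have hKN : K ≤ 8 * N := by omega
  have hKN3 : K ≤ N * N * N := by
    refine hKN.trans (Nat.mul_le_mul_right N ?_)
    nlinarith
  have hN1 : 1 ≤ N ^ 12 := Nat.one_le_pow _ _ (by omega)
  have hinf : K * K * K * K ≤ N ^ 12 := by
    calc K * K * K * K ≤ (N * N * N) * (N * N * N) * (N * N * N) * (N * N * N) := by gcongr
      _ = N ^ 12 := by ring
  have hN16 : N ^ 16 = N * N * N * N * N ^ 12 := by ring
  have hN12 : N ^ 3 ≤ N ^ 12 := Nat.pow_le_pow_right (by omega) (by norm_num)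
  have hN3 : N ^ 3 = N * N * N := by ring
  have hNN : 5 * N ≤ N * N := Nat.mul_le_mul_right N hN5
  have hNNN : 5 * (N * N) ≤ N * N * N := by
    rw [mul_assoc N N N]
    exact Nat.mul_le_mul_right _ hN5
  have h625 : 625 * N ^ 12 ≤ N ^ 16 := by
    rw [hN16]
    refine Nat.mul_le_mul_right _ ?_
    calc 625 = 5 * 5 * 5 * 5 := by norm_num
      _ ≤ N * N * N * N := by gcongr
  have hkL : k * L ≤ 2 * (N * N) := by
    calc k * L ≤ N * (2 * N) := Nat.mul_le_mul hkN hL2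
      _ = 2 * (N * N) := by ring
  have hkkL : k * (k * L) ≤ 2 * (N * N * N) := by
    calc k * (k * L) ≤ N * (2 * (N * N)) := Nat.mul_le_mul hkN hkL
      _ = 2 * (N * N * N) := by ring
  refine ⟨⟨hB, hL1, by omega, ?_, by omega⟩, by omega, by omega⟩
  -- For k = 2 the buffer, pointers and keys need 2B + 4 ≤ M + 4 words, which is why data memory has
  -- four words more than M. For larger k each of the three is a fraction of M.
  rcases le_total (μ.M / (4 * μ.B)) 2 with h | h
  · have : k = 2 := by omega
    rw [this]
    omega
  · have hk' : k = μ.M / (4 * μ.B) := by omega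
    rw [← hk'] at h4 hdM
    have : k * (4 * μ.B) = 4 * (k * μ.B) := by ring
    omega

end ExtMem


theorem mainTheorem6 :
    ∃ (p : ExtMem.Program) (extra κ : ℕ) (C : ℝ),
      ∀ (B M W : ℕ), 1 ≤ B → 2 * B ≤ M →
      ∀ (n m : ℕ) (G : SimpleGraph (Fin n)), G.edgeSet.ncard = m → (n + m + M) ^ κ ≤ W →
      G.Connected →
      (SimpleGraph.cycleGraph 3).IsIndContained G ∨
        (SimpleGraph.cycleGraph 5).IsIndContained G ∨ ExtMem.twoK2.IsIndContained G →
      ∀ (T : SimpleGraph (Fin n)), T ≤ G → T.IsTree →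
      ∀ (rows : Fin n → List (Fin n)) (t : List (Fin n × Fin n)),
      ExtMem.IsNeighborLists G rows → ExtMem.IsEdgeList T t →
      ∃ (s : ExtMem.State) (k : ℕ),
        ExtMem.Exec ⟨B, M, extra, W⟩ p (ExtMem.initialState rows t) s k ∧
        (k : ℝ) ≤ C * ExtMem.sortBound B M (n + m) ∧
        (ExtMem.Reports (SimpleGraph.cycleGraph 3) G s ∨
          ExtMem.Reports (SimpleGraph.cycleGraph 5) G s ∨
          ExtMem.Reports ExtMem.twoK2 G s) := by
  refine ⟨ExtMem.findSubgraph, ExtMem.extraWords, 16, 442, ?_⟩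
  intro B M W hB hM n m G hm hW hconn hsub _ _ _ rows t hrows _
  subst hm
  have hedge : ∃ u v, G.Adj u v := by
    rcases hsub with ⟨⟨f⟩⟩ | ⟨⟨f⟩⟩ | ⟨⟨f⟩⟩
    · exact ⟨f 0, f 1, f.map_rel_iff.2 (by decide)⟩
    · exact ⟨f 0, f 1, f.map_rel_iff.2 (by decide)⟩
    · exact ⟨f 0, f 1, f.map_rel_iff.2 (by simp [ExtMem.twoK2])⟩
  obtain ⟨u, v, huv⟩ := hedge
  have hn : 2 ≤ n := by
    have h1 := u.2
    have h2 := v.2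
    have h3 : (u : ℕ) ≠ v := fun h => huv.ne (Fin.ext h)
    omega
  have hm : 1 ≤ G.edgeSet.ncard := by
    exact (Set.ncard_pos (Set.toFinite _)).2 ⟨s(u, v), huv⟩
  have hI := ExtMem.inputArray (t := t) hrows
  obtain ⟨K, hK⟩ : ∃ K, 4 * (n + 2 + 2 * G.edgeSet.ncard) = K := ⟨_, rfl⟩
  have hG := ExtMem.graphic hrows hK
  obtain ⟨hP, hLW, hBW⟩ := ExtMem.params (μ := ⟨B, M, ExtMem.extraWords, W⟩) rfl rfl hB hM hn hm
    rfl rfl hK hW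
  have : Fact ((⟨B, M, ExtMem.extraWords, W⟩ : ExtMem.Machine).extra = ExtMem.extraWords) :=
    ⟨rfl⟩
  -- Two successful checks would make G a chain graph, contrary to the assumed induced subgraph.
  have hno : ∀ x y y', (∀ u < n, (ExtMem.natRow rows u).length ≤ (ExtMem.natRow rows x).length) →
      ExtMem.Nested (ExtMem.natAdj G) (fun u => K - 1 - (ExtMem.natRow rows u).length) K x y →
      ¬ExtMem.Nested (ExtMem.natAdj G) (fun u => K - 1 - (ExtMem.natRow rows u).length) K y y' := by
    intro x y y' hmax hx hy
    refine (ExtMem.chainParts hG (fun w _ hw => ?_) hx hy).not_contained hconn hx.1 hsub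
    have := hmax y' hw.1
    omega
  -- The ghost counter starts at 0, so its final value is the number of transfers of the run.
  obtain ⟨b, k, h1, h2, h3, h4⟩ := ExtMem.wp_findSubgraph
    (a := ⟨fun _ => 0, fun _ => 0, (ExtMem.initialState rows t).ext, 0⟩)
    (Q := fun b => ExtMem.Answer (ExtMem.natAdj G) b.X ∧ b.t ≤ 0 + 8 + 22 * _ + 15 * _ * _)
    hP rfl hLW hI hK (fun _ => rfl) hG rfl rfl hM hBW
    ⟨u, v, (ExtMem.natAdj_val u v).2 huv⟩ hno fun b hb hbt => ⟨hb, hbt⟩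
  refine ⟨b.st M, k, ?_, ExtMem.cost_le hB hM hn rfl rfl (c := k) ?_,
    ExtMem.reports_of_answer h3⟩
  · convert h1 using 1
    simp only [ExtMem.Conf.st, ite_self]
    rfl
  · rw [zero_add] at h2 h4
    rw [← h2]
    exact h4
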